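/- Let $\mathfrak h_7$ be the real Lie algebra with basis $e_1,\dots,e_6$ and structure equations $de^1=de^2=de^3=0$, $de^4=e^1\wedge e^2$, $de^5=e^1\wedge e^3$, $de^6=e^2\wedge e^3$, let $H_7$ be the simply connected nilpotent Lie group with Lie algebra $\mathfrak h_7$, and let $J_0$ be the left-invariant complex structure with $J_0e_1=e_2$, $J_0e_3=e_4$, $J_0e_5=e_6$. Let $\mathfrak f=\langle e_3,e_4,e_5,e_6\rangle$, an abelian $J_0$-invariant ideal, identified with a subgroup of $H_7$ by the exponential map and with $\mathbb C^2$ by the coordinates $dz_1=e^3+\mathrm i e^4$, $dz_2=e^5+\mathrm i e^6$. The quotient $H_7\to H_7/\mathfrak f=\mathbb C$ is given by $\exp(\sum x_je_j)\mapsto x_1+\mathrm i x_2$. For a lattice (discrete cocompact subgroup) $\Gamma\subset H_7$ let $M=(\Gamma\backslash H_7,J_0)$ be the associated compact complex manifold, and call an ideal $\mathfrak b\subset\mathfrak h_7$ $\Gamma$-rational if $(\langle\log\Gamma\rangle_{\mathbb Q}\cap\mathfrak b)\otimes\mathbb R\cong\mathfrak b$, i.e. if $\mathfrak b$ is the real span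 of $\langle\log\Gamma\rangle_{\mathbb Q}\cap\mathfrak b$. A connected abelian complex Lie group $F=V/L$ ($V$ a finite-dimensional complex vector space, $L\subset V$ a discrete subgroup) is called toroidal if every holomorphic function on $F$ is constant. Toroidal coordinates on $F$ are an isomorphism $V\cong\mathbb C^{m}\times\mathbb C^{q}$ under which $L$ is the group generated by the columns of $\begin{pmatrix} I_m & R\\ 0& P\end{pmatrix}$, where the columns of $P\in\mathrm{Mat}(q,2q,\mathbb C)$ are a real basis of $\mathbb C^q$ and the glueing matrix $R\in\mathrm{Mat}(m,2q,\mathbb R)$ satisfies $\sigma^tR\notin\mathbb Z^{2q}$ for all $\sigma\in\mathbb Z^m\setminus\{0\}$. A toroidal group $F$ is a toroidal theta group if for some choice of toroidal coordinates there is $r>0$ with $r^{-|\sigma|}\le\operatorname{dist}(R^t\sigma,\mathbb Z^{2q})$ for all $\sigma\in\mathbb Z^m\setminus\{0\}$; otherwise it is a toroidal wild group. **Proposition.** (1) Let $\Gamma\subset H_7$ be a lattice. If $\mathfrak h_7$ contains a non-trivial (i.e. different from $0$ and $\mathfrak h_7$) $J_0$-invariant and $\Gamma$-rational ideal, then $\mathfrak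 f$ is $J_0$-invariant and $\Gamma$-rational, the image $\Lambda$ of $\Gamma$ in $\mathbb C$ is a lattice, and the map $\pi\colon M\to\mathbb C/\Lambda$ induced by $H_7\to\mathbb C$ is a non-principal bundle of complex $2$-tori over this elliptic curve: $\pi$ is a holomorphic submersion all of whose fibres are complex $2$-tori, it is a locally trivial $C^\infty$ fibre bundle, and it is not a principal bundle for any action of a topological group on $M$. (2) Let $\Gamma\subset H_7$ be a lattice. If $\mathfrak f$ is not $\Gamma$-rational (equivalently, by (1), if no non-trivial $J_0$-invariant ideal is $\Gamma$-rational), then the complex abelian Lie group $F=(\Gamma\cap\mathfrak f)\backslash\mathfrak f$ is a non-compact toroidal group. (3) Both cases in (2) occur: there is a lattice $\Gamma\subset H_7$ such that $\mathfrak f$ is not $\Gamma$-rational and $F$ is a toroidal theta group, and there is a lattice $\Gamma\subset H_7$ such that $\mathfrak f$ is not $\Gamma$-rational and $F$ is a toroidal wild group. -/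

import Mathlib

open scoped Manifold ContDiff Topology

noncomputable section

/-! ### Complex manifolds presented as quotients of a vector space -/

namespace QuotientManifold

variable {E Y : Type*} [NormedAddCommGroup E] [TopologicalSpace Y] {p : E → Y}

theorem isManifold (𝕜 : Type*) [NontriviallyNormedField 𝕜] [NormedSpace 𝕜 E]
    (hp : IsLocalHomeomorph p) (hs : Function.Surjective p)
    (hdeck : ∀ x x', p x = p x' → ∃ g : E → E, ContDiff 𝕜 ω g ∧ g x = x' ∧ ∀ y, p (g y) = p y) :
    let := hp.chartedSpace hs (H := E)
    IsManifold 𝓘(𝕜, E) ω Y := by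
  let := hp.chartedSpace hs (H := E)
  apply isManifold_of_contDiffOn
  rintro _ _ ⟨y, rfl⟩ ⟨y', rfl⟩
  set g := hs.hasRightInverse.choose
  simp only [chartAt_self_eq, OpenPartialHomeomorph.trans_refl, modelWithCornersSelf_coe,
    modelWithCornersSelf_coe_symm, Function.comp_id, Function.id_comp, Set.range_id,
    Set.inter_univ, Set.preimage_id]
  set e := hp.localInverseAt (g y)
  set e' := hp.localInverseAt (g y')
  have he : ⇑e.symm = p := hp.localInverseAt_symm _
  have he' : ⇑e'.symm = p := hp.localInverseAt_symm _
  intro x hx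
  have hx' := hx
  rw [OpenPartialHomeomorph.trans_source] at hx'
  have hx2 : p x ∈ e'.source := by rw [← he]; exact hx'.2
  have hpx : p (e' (p x)) = p x := by
    have := e'.left_inv hx2
    rwa [he'] at this
  obtain ⟨γ, hγ, hγx, hγp⟩ := hdeck x (e' (p x)) hpx.symm
  have hnear : ∀ᶠ z in 𝓝 x, γ z ∈ e'.target := by
    apply hγ.continuous.continuousAt.eventually_mem
    rw [hγx]
    exact e'.open_target.mem_nhds (e'.map_source hx2)
  apply ContDiffAt.contDiffWithinAt
  refine (hγ.contDiffAt (x := x)).congr_of_eventuallyEq ?_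
  filter_upwards [hnear] with z hz
  have h1 := e'.right_inv hz
  rw [he', hγp] at h1
  simp only [OpenPartialHomeomorph.coe_trans, Function.comp_apply, he]
  exact h1

end QuotientManifold

section AdditiveQuotient

variable {V : Type*} [NormedAddCommGroup V] (L : AddSubgroup V) [DiscreteTopology L]

theorem isLocalHomeomorph_quotientMk :
    IsLocalHomeomorph (QuotientAddGroup.mk : V → V ⧸ L) :=
  (L.isAddQuotientCoveringMap_of_comm ⟨inferInstance⟩).isCoveringMap.isLocalHomeomorph

/-- For a discrete subgroup `L` of a vector space `V`, the charts of `V ⧸ L` are the local inverses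
of the quotient map. -/
instance quotientChartedSpace : ChartedSpace V (V ⧸ L) :=
  (isLocalHomeomorph_quotientMk L).chartedSpace QuotientAddGroup.mk_surjective

instance quotientIsManifold (𝕜 : Type*) [NontriviallyNormedField 𝕜] [NormedSpace 𝕜 V] :
    IsManifold 𝓘(𝕜, V) ω (V ⧸ L) := by
  apply QuotientManifold.isManifold 𝕜 (isLocalHomeomorph_quotientMk L)
    QuotientAddGroup.mk_surjective
  intro x x' h
  refine ⟨fun y => y + (x' - x), by fun_prop, by simp, fun y => ?_⟩
  have : (QuotientAddGroup.mk (x' - x) : V ⧸ L) = 0 := by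
    rw [QuotientAddGroup.mk_sub, h, sub_self]
  rw [QuotientAddGroup.mk_add, this, add_zero]

theorem contMDiff_quotientMk (𝕜 : Type*) [NontriviallyNormedField 𝕜] [NormedSpace 𝕜 V] :
    ContMDiff 𝓘(𝕜, V) 𝓘(𝕜, V) ω (QuotientAddGroup.mk : V → V ⧸ L) := by
  intro x
  set y : V ⧸ L := QuotientAddGroup.mk x
  set e := chartAt V y
  have he : ⇑e.symm = (QuotientAddGroup.mk : V → V ⧸ L) := by
    change ⇑(((isLocalHomeomorph_quotientMk L).localInverseAt _).trans (chartAt V _)).symm = _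
    rw [OpenPartialHomeomorph.coe_trans_symm, chartAt_self_eq]
    simp
  have hy : y ∈ e.source := mem_chart_source V y
  have hxe : (QuotientAddGroup.mk (e y - x) : V ⧸ L) = 0 := by
    rw [QuotientAddGroup.mk_sub, ← he, e.left_inv hy, he, sub_self]
  have h1 : ContMDiffAt 𝓘(𝕜, V) 𝓘(𝕜, V) ω e.symm (x + (e y - x)) := by
    rw [add_sub_cancel]
    exact (contMDiffOn_chart_symm (x := y)).contMDiffAt
      (e.open_target.mem_nhds (e.map_source hy))
  have h2 : ContMDiffAt 𝓘(𝕜, V) 𝓘(𝕜, V) ω (fun z : V => z + (e y - x)) x :=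
    (contDiff_id.add contDiff_const).contMDiff x
  refine (ContMDiffAt.comp x h1 h2).congr_of_eventuallyEq (Filter.Eventually.of_forall ?_)
  intro z
  simp only [Function.comp_apply, he]
  rw [QuotientAddGroup.mk_add, hxe, add_zero]

theorem quotientMk_chartAt (y : V ⧸ L) :
    ∀ᶠ z in 𝓝 y, (QuotientAddGroup.mk (chartAt V y z) : V ⧸ L) = z := by
  set e := chartAt V y
  have he : ⇑e.symm = (QuotientAddGroup.mk : V → V ⧸ L) := by
    change ⇑(((isLocalHomeomorph_quotientMk L).localInverseAt _).trans (chartAt V _)).symm = _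
    rw [OpenPartialHomeomorph.coe_trans_symm, chartAt_self_eq]
    simp
  filter_upwards [e.open_source.mem_nhds (mem_chart_source V y)] with z hz
  rw [← he, e.left_inv hz]

/-- `V ⧸ L` is an abelian Lie group (complex if `V` is a complex vector space). -/
instance quotientLieAddGroup (𝕜 : Type*) [NontriviallyNormedField 𝕜] [NormedSpace 𝕜 V] :
    LieAddGroup 𝓘(𝕜, V) ω (V ⧸ L) where
  contMDiff_add := by
    rintro ⟨a, b⟩
    have ha : ContMDiffAt (𝓘(𝕜, V).prod 𝓘(𝕜, V)) 𝓘(𝕜, V) ω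
        (fun z : (V ⧸ L) × (V ⧸ L) => chartAt V a z.1) (a, b) :=
      ContMDiffAt.comp (a, b) (g := chartAt V a)
        (contMDiffOn_chart.contMDiffAt ((chartAt V a).open_source.mem_nhds
          (mem_chart_source V a))) contMDiffAt_fst
    have hb : ContMDiffAt (𝓘(𝕜, V).prod 𝓘(𝕜, V)) 𝓘(𝕜, V) ω
        (fun z : (V ⧸ L) × (V ⧸ L) => chartAt V b z.2) (a, b) :=
      ContMDiffAt.comp (a, b) (g := chartAt V b)
        (contMDiffOn_chart.contMDiffAt ((chartAt V b).open_source.mem_nhds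
          (mem_chart_source V b))) contMDiffAt_snd
    refine (ContMDiffAt.comp (a, b) (contMDiff_quotientMk L 𝕜 _)
      (ha.add hb)).congr_of_eventuallyEq ?_
    filter_upwards [continuousAt_fst.eventually (quotientMk_chartAt L a),
      continuousAt_snd.eventually (quotientMk_chartAt L b)] with z h1 h2
    simp only [Function.comp_apply, Pi.add_apply]
    rw [QuotientAddGroup.mk_add, h1, h2]
  contMDiff_neg := by
    intro a
    have ha : ContMDiffAt 𝓘(𝕜, V) 𝓘(𝕜, V) ω (chartAt V a) a :=
      contMDiffOn_chart.contMDiffAt ((chartAt V a).open_source.mem_nhds (mem_chart_source V a))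
    refine (ContMDiffAt.comp a (contMDiff_quotientMk L 𝕜 _) ha.neg).congr_of_eventuallyEq ?_
    filter_upwards [quotientMk_chartAt L a] with z h1
    simp only [Function.comp_apply]
    rw [QuotientAddGroup.mk_neg, h1]

end AdditiveQuotient

/-! ### The Lie algebra `𝔥₇` with its complex structure -/

/-- The six-dimensional real Lie algebra `𝔥₇ = (0, 0, 0, 12, 13, 23)`. The vector `x` is
`∑ x (i - 1) • e_i`; from `de(x, y) = -e([x, y])` the non-zero brackets of basis vectors are
`[e₁, e₂] = -e₄`, `[e₁, e₃] = -e₅`, `[e₂, e₃] = -e₆`. -/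
def LieAlgH7 : Type := Fin 6 → ℝ

namespace LieAlgH7

instance : NormedAddCommGroup LieAlgH7 := inferInstanceAs (NormedAddCommGroup (Fin 6 → ℝ))
instance : NormedSpace ℝ LieAlgH7 := inferInstanceAs (NormedSpace ℝ (Fin 6 → ℝ))
instance : Module ℚ LieAlgH7 := inferInstanceAs (Module ℚ (Fin 6 → ℝ))
instance : CoeFun LieAlgH7 (fun _ => Fin 6 → ℝ) := ⟨fun x => x⟩

/-- The vector with the given coordinates with respect to `e₁, …, e₆`. -/
def ofCoords (x : Fin 6 → ℝ) : LieAlgH7 := x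

@[simp] theorem ofCoords_apply (x : Fin 6 → ℝ) (i : Fin 6) : ofCoords x i = x i := rfl
@[simp] theorem add_apply (x y : LieAlgH7) (i : Fin 6) : (x + y) i = x i + y i := rfl
@[simp] theorem neg_apply (x : LieAlgH7) (i : Fin 6) : (-x) i = -x i := rfl
@[simp] theorem smul_apply (c : ℝ) (x : LieAlgH7) (i : Fin 6) : (c • x) i = c * x i := rfl
@[simp] theorem zero_apply (i : Fin 6) : (0 : LieAlgH7) i = 0 := rfl

@[ext] theorem ext {x y : LieAlgH7} (h0 : x 0 = y 0) (h1 : x 1 = y 1) (h2 : x 2 = y 2)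
    (h3 : x 3 = y 3) (h4 : x 4 = y 4) (h5 : x 5 = y 5) : x = y := by
  funext i
  fin_cases i <;> assumption

instance : Bracket LieAlgH7 LieAlgH7 where
  bracket x y := ofCoords ![0, 0, 0, -(x 0 * y 1 - x 1 * y 0), -(x 0 * y 2 - x 2 * y 0),
    -(x 1 * y 2 - x 2 * y 1)]

theorem bracket_def (x y : LieAlgH7) : ⁅x, y⁆ = ofCoords ![0, 0, 0, -(x 0 * y 1 - x 1 * y 0),
    -(x 0 * y 2 - x 2 * y 0), -(x 1 * y 2 - x 2 * y 1)] := rfl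

instance : LieRing LieAlgH7 where
  add_lie x y z := by ext <;> simp [bracket_def] <;> ring
  lie_add x y z := by ext <;> simp [bracket_def] <;> ring
  lie_self x := by ext <;> simp [bracket_def] <;> ring
  leibniz_lie x y z := by ext <;> simp [bracket_def]

instance : LieAlgebra ℝ LieAlgH7 where
  lie_smul c x y := by ext <;> simp [bracket_def] <;> ring

/-- The complex structure `J₀ e₁ = e₂`, `J₀ e₃ = e₄`, `J₀ e₅ = e₆`. -/
def J₀ : LieAlgH7 →ₗ[ℝ] LieAlgH7 where
  toFun x := ofCoords ![-x 1, x 0, -x 3, x 2, -x 5, x 4]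
  map_add' x y := by ext <;> simp <;> ring
  map_smul' c x := by ext <;> simp

/-- The ideal `𝔣 = ⟨e₃, e₄, e₅, e₆⟩`. -/
def 𝔣 : LieIdeal ℝ LieAlgH7 where
  carrier := {x | x 0 = 0 ∧ x 1 = 0}
  zero_mem' := by simp
  add_mem' := by
    rintro x y ⟨hx0, hx1⟩ ⟨hy0, hy1⟩
    simp [hx0, hx1, hy0, hy1]
  smul_mem' := by
    rintro c x ⟨hx0, hx1⟩
    simp [hx0, hx1]
  lie_mem := by
    intro x y _
    simp [bracket_def]

/-- An ideal is `J₀`-invariant. -/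
def IsJ₀Invariant (𝔟 : LieIdeal ℝ LieAlgH7) : Prop := ∀ x ∈ 𝔟, J₀ x ∈ 𝔟

end LieAlgH7

/-! ### The Lie group `H₇` -/

/-- The simply connected nilpotent Lie group `H₇` with Lie algebra `𝔥₇`: the exponential map
`H7.exp : 𝔥₇ → H₇` is a global diffeomorphism, and the multiplication is given by the
Baker--Campbell--Hausdorff formula, which stops after the first bracket as `𝔥₇` is 2-step
nilpotent. -/
structure H7 where
  /-- The exponential map. -/
  exp ::
  /-- The logarithm. -/
  log : LieAlgH7

namespace H7

open LieAlgH7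

@[ext] theorem ext {g h : H7} (w : g.log = h.log) : g = h := by
  cases g; cases h; congr

/-- The logarithm as a bijection. -/
def logEquiv : H7 ≃ LieAlgH7 := ⟨log, exp, fun _ => rfl, fun _ => rfl⟩

instance : TopologicalSpace H7 := TopologicalSpace.induced log inferInstance

/-- The logarithm as a homeomorphism. -/
def logHomeomorph : H7 ≃ₜ LieAlgH7 := logEquiv.toHomeomorphOfIsInducing ⟨rfl⟩

theorem continuous_log : Continuous log := logHomeomorph.continuous
theorem continuous_exp : Continuous exp := logHomeomorph.symm.continuous

instance : Mul H7 := ⟨fun g h => exp (g.log + h.log + (1 / 2 : ℝ) • ⁅g.log, h.log⁆)⟩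
instance : One H7 := ⟨exp 0⟩
instance : Inv H7 := ⟨fun g => exp (-g.log)⟩

theorem log_mul (g h : H7) : (g * h).log = g.log + h.log + (1 / 2 : ℝ) • ⁅g.log, h.log⁆ := rfl
@[simp] theorem log_one : (1 : H7).log = 0 := rfl
@[simp] theorem log_inv (g : H7) : (g⁻¹).log = -g.log := rfl

instance : Group H7 :=
  Group.ofLeftAxioms
    (fun a b c => by ext <;> simp [log_mul, bracket_def] <;> ring)
    (fun a => by ext <;> simp [log_mul])
    (fun a => by ext <;> simp [log_mul])

theorem continuous_iff {X : Type*} [TopologicalSpace X] {f : X → H7} :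
    Continuous f ↔ ∀ i, Continuous fun x => (f x).log i :=
  (logHomeomorph.comp_continuous_iff (f := f)).symm.trans continuous_pi_iff

theorem continuous_log_apply (i : Fin 6) : Continuous fun g : H7 => g.log i :=
  continuous_iff.1 continuous_id i

instance : IsTopologicalGroup H7 where
  continuous_mul := by
    have h1 := fun i => (continuous_log_apply i).comp (continuous_fst (X := H7) (Y := H7))
    have h2 := fun i => (continuous_log_apply i).comp (continuous_snd (X := H7) (Y := H7))
    simp only [Function.comp_def] at h1 h2
    rw [continuous_iff]
    intro i
    fin_cases i <;> simp [log_mul, bracket_def] <;> fun_prop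
  continuous_inv := by
    rw [continuous_iff]
    intro i
    exact (continuous_log_apply i).neg

/-! ### Global holomorphic coordinates on `(H₇, J₀)` -/

/-- The projection `H₇ → ℂ`, `g ↦ x₁ + i x₂`, where `g = exp (∑ xⱼ eⱼ)`. -/
def baseCoord (g : H7) : ℂ := ⟨g.log 0, g.log 1⟩

/-- Global coordinates on `H₇`. They are holomorphic for the left-invariant complex structure
given by `J₀`, see `H7.holCoord_isHolomorphic`. -/
def holCoord (g : H7) : Fin 3 → ℂ :=
  let z : ℂ := ⟨g.log 0, g.log 1⟩
  let w : ℂ := ⟨g.log 2, g.log 3⟩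
  let v : ℂ := ⟨g.log 4, g.log 5⟩
  ![z, w - z * star z / 4, v + z * star w / 4 + z * z * star z / 16]

/-- The inverse of `H7.holCoord`. -/
def ofHolCoord (u : Fin 3 → ℂ) : H7 :=
  let z : ℂ := u 0
  let w : ℂ := u 1 + z * star z / 4
  let v : ℂ := u 2 - z * star w / 4 - z * z * star z / 16
  exp (ofCoords ![z.re, z.im, w.re, w.im, v.re, v.im])

theorem ofHolCoord_holCoord (g : H7) : ofHolCoord (holCoord g) = g := by
  ext <;> simp [ofHolCoord, holCoord] <;> ring

theorem holCoord_ofHolCoord (u : Fin 3 → ℂ) : holCoord (ofHolCoord u) = u := by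
  funext i
  fin_cases i <;> apply Complex.ext <;> simp [ofHolCoord, holCoord] <;> ring

/-- `H7.holCoord` as a homeomorphism. -/
def holHomeomorph : H7 ≃ₜ (Fin 3 → ℂ) where
  toFun := holCoord
  invFun := ofHolCoord
  left_inv := ofHolCoord_holCoord
  right_inv := holCoord_ofHolCoord
  continuous_toFun := by
    have h := continuous_log_apply
    have hc : ∀ i j, Continuous fun g : H7 => (⟨g.log i, g.log j⟩ : ℂ) := fun i j =>
      Complex.equivRealProdCLM.symm.continuous.comp ((h i).prodMk (h j))
    have h0 := hc 0 1
    have h1 := hc 2 3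
    have h2 := hc 4 5
    refine continuous_pi fun i => ?_
    fin_cases i <;> simp [holCoord] <;> fun_prop
  continuous_invFun := by
    rw [continuous_iff]
    intro i
    fin_cases i <;> simp [ofHolCoord] <;> fun_prop

/-- Left translation by `g` in the coordinates `H7.holCoord`. -/
def leftTranslation (g : H7) (u : Fin 3 → ℂ) : Fin 3 → ℂ :=
  let c : ℂ := ⟨g.log 0, g.log 1⟩
  let k : ℂ := ⟨g.log 2, g.log 3⟩ - c * star c / 4
  let v : ℂ := ⟨g.log 4, g.log 5⟩
  ![u 0 + c, u 1 + k - star c * u 0 / 2,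
    u 2 + (v + c * star k / 4 + c * c * star c / 8)
      + ((g.log 2 : ℂ) / 2 + star k / 4 + c * star c / 4) * u 0 - c * u 1 / 4
      + star c * u 0 * u 0 / 8]

theorem holCoord_mul (g h : H7) : holCoord (g * h) = leftTranslation g (holCoord h) := by
  funext i
  fin_cases i <;> apply Complex.ext <;>
    simp [holCoord, leftTranslation, log_mul, bracket_def] <;> ring

theorem contDiff_leftTranslation (g : H7) : ContDiff ℂ ω (leftTranslation g) := by
  rw [contDiff_pi]
  intro i
  fin_cases i <;> simp [leftTranslation] <;> fun_prop

/-- The differential of the coordinates `H7.holCoord` at `g` intertwines the left-invariant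
almost complex structure given by `J₀` with multiplication by `i`. -/
theorem holCoord_isHolomorphic (g : H7) :
    ∃ D : LieAlgH7 →L[ℝ] (Fin 3 → ℂ),
      HasFDerivAt (fun x : LieAlgH7 => holCoord (g * exp x)) D 0 ∧ Function.Injective D ∧
        ∀ x, D (J₀ x) = Complex.I • D x := by
  let pr (i : Fin 6) : LieAlgH7 →L[ℝ] ℝ := ContinuousLinearMap.proj (R := ℝ) (φ := fun _ => ℝ) i
  let pair (i j : Fin 6) : LieAlgH7 →L[ℝ] ℂ :=
    Complex.equivRealProdCLM.symm.toContinuousLinearMap.comp ((pr i).prod (pr j))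
  have hpair : ∀ i j x, pair i j x = ⟨x i, x j⟩ := fun i j x => rfl
  let B : LieAlgH7 →L[ℝ] (Fin 3 → ℂ) :=
    ContinuousLinearMap.pi ![pair 0 1, pair 2 3, pair 4 5]
  have hstar : ∀ i j, HasFDerivAt (fun x : LieAlgH7 => star (pair i j x))
      ((Complex.conjCLE : ℂ →L[ℝ] ℂ).comp (pair i j)) 0 := fun i j =>
    ((Complex.conjCLE : ℂ →L[ℝ] ℂ).comp (pair i j)).hasFDerivAt
  have hlin : ∀ i j, HasFDerivAt (fun x : LieAlgH7 => pair i j x) (pair i j) 0 := fun i j =>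
    (pair i j).hasFDerivAt
  have hB : HasFDerivAt (fun x : LieAlgH7 => holCoord (exp x)) B 0 := by
    rw [hasFDerivAt_pi]
    intro i
    fin_cases i
    · exact hlin 0 1
    · have h := (hlin 2 3).sub (((hlin 0 1).mul (hstar 0 1)).mul_const (1 / 4 : ℂ))
      refine (h.congr_of_eventuallyEq (Filter.Eventually.of_forall fun x => ?_)).congr_fderiv ?_
      · simp [holCoord, hpair]; ring
      · ext x; simp
    · have h := ((hlin 4 5).add (((hlin 0 1).mul (hstar 2 3)).mul_const (1 / 4 : ℂ))).add
        ((((hlin 0 1).mul (hlin 0 1)).mul (hstar 0 1)).mul_const (1 / 16 : ℂ))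
      refine (h.congr_of_eventuallyEq (Filter.Eventually.of_forall fun x => ?_)).congr_fderiv ?_
      · simp [holCoord, hpair]; ring
      · ext x; simp
  have hinv : ∀ u, leftTranslation g⁻¹ (leftTranslation g u) = u := by
    intro u
    rw [← holCoord_ofHolCoord u, ← holCoord_mul, ← holCoord_mul, inv_mul_cancel_left]
  have hdiff : ∀ h u, DifferentiableAt ℂ (leftTranslation h) u := fun h u =>
    ((contDiff_leftTranslation h).differentiable (by simp)) u
  set u := holCoord (exp 0)
  have hcomp : (fderiv ℂ (leftTranslation g⁻¹) (leftTranslation g u)).comp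
      (fderiv ℂ (leftTranslation g) u) = ContinuousLinearMap.id ℂ _ := by
    rw [← fderiv_comp u (hdiff _ _) (hdiff _ _), show leftTranslation g⁻¹ ∘ leftTranslation g = id
      from funext hinv, fderiv_id]
  refine ⟨((fderiv ℂ (leftTranslation g) u).restrictScalars ℝ).comp B, ?_, ?_, ?_⟩
  · have := ((hdiff g u).hasFDerivAt.restrictScalars ℝ).comp (0 : LieAlgH7) hB
    refine this.congr_of_eventuallyEq (Filter.Eventually.of_forall fun x => ?_)
    simp [holCoord_mul]
  · have hBinj : Function.Injective B := by
      intro x y hxy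
      have h0 := congrFun hxy 0
      have h1 := congrFun hxy 1
      have h2 := congrFun hxy 2
      simp only [B, ContinuousLinearMap.coe_pi', Matrix.cons_val_zero, Matrix.cons_val_one,
        Matrix.cons_val, hpair, Complex.ext_iff] at h0 h1 h2
      exact LieAlgH7.ext h0.1 h0.2 h1.1 h1.2 h2.1 h2.2
    intro x y hxy
    apply hBinj
    have h := congrArg (fderiv ℂ (leftTranslation g⁻¹) (leftTranslation g u)) hxy
    have h' := fun z => DFunLike.congr_fun hcomp z
    simp only [ContinuousLinearMap.comp_apply, ContinuousLinearMap.id_apply] at h'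
    simpa [h'] using h
  · intro x
    have hBJ : B (J₀ x) = Complex.I • B x := by
      funext i
      fin_cases i <;> simp [B, hpair, J₀, Complex.ext_iff]
    simp [hBJ]

end H7

/-! ### The nilmanifold `M = (Γ \ H₇, J₀)` -/

/-- The space `Γ \ H₇` of cosets `Γ g`. -/
def Nilmanifold (Γ : Subgroup H7) : Type := Quotient (MulAction.orbitRel Γ H7)

namespace Nilmanifold

open H7 LieAlgH7

variable (Γ : Subgroup H7)

instance : TopologicalSpace (Nilmanifold Γ) :=
  inferInstanceAs (TopologicalSpace (Quotient (MulAction.orbitRel Γ H7)))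

/-- The quotient map `H₇ → Γ \ H₇`. -/
def mk (g : H7) : Nilmanifold Γ := Quotient.mk (MulAction.orbitRel Γ H7) g

theorem mk_surjective : Function.Surjective (mk Γ) := Quotient.mk_surjective

theorem mk_eq_mk_iff {g h : H7} : mk Γ g = mk Γ h ↔ ∃ γ ∈ Γ, γ * h = g := by
  refine Quotient.eq''.trans ⟨?_, ?_⟩
  · rintro ⟨γ, rfl⟩
    exact ⟨γ, γ.2, rfl⟩
  · rintro ⟨γ, hγ, rfl⟩
    exact ⟨⟨γ, hγ⟩, rfl⟩

theorem isCoveringMap_mk [DiscreteTopology Γ] : IsCoveringMap (mk Γ) := by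
  refine (Topology.IsQuotientMap.isQuotientCoveringMap_of_subgroup (f := mk Γ)
    isQuotientMap_quotient_mk' Γ ⟨inferInstance⟩ ?_).isCoveringMap
  intro e₁ e₂
  rw [eq_comm, mk_eq_mk_iff]
  refine ⟨?_, fun h => ⟨_, h, by simp⟩⟩
  rintro ⟨γ, hγ, rfl⟩
  simpa using hγ

/-- The quotient map in the holomorphic coordinates of `H₇`. -/
def coordMk (u : Fin 3 → ℂ) : Nilmanifold Γ := mk Γ (holHomeomorph.symm u)

theorem coordMk_surjective : Function.Surjective (coordMk Γ) :=
  (mk_surjective Γ).comp holHomeomorph.symm.surjective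

theorem isLocalHomeomorph_coordMk [DiscreteTopology Γ] : IsLocalHomeomorph (coordMk Γ) :=
  (isCoveringMap_mk Γ).isLocalHomeomorph.comp holHomeomorph.symm.isLocalHomeomorph

/-- The complex manifold `(Γ \ H₇, J₀)`: the charts are the local inverses of the quotient map
`H₇ → Γ \ H₇`, followed by the global holomorphic coordinates of `(H₇, J₀)`. -/
instance [DiscreteTopology Γ] : ChartedSpace (Fin 3 → ℂ) (Nilmanifold Γ) :=
  (isLocalHomeomorph_coordMk Γ).chartedSpace (coordMk_surjective Γ)

instance [DiscreteTopology Γ] : IsManifold 𝓘(ℂ, Fin 3 → ℂ) ω (Nilmanifold Γ) := by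
  apply QuotientManifold.isManifold ℂ (isLocalHomeomorph_coordMk Γ) (coordMk_surjective Γ)
  intro x x' h
  obtain ⟨γ, hγ, hx⟩ := (mk_eq_mk_iff Γ).1 h.symm
  have key : ∀ u, holHomeomorph.symm (leftTranslation γ u) = γ * holHomeomorph.symm u := by
    intro u
    rw [Homeomorph.symm_apply_eq]
    change _ = holCoord _
    rw [holCoord_mul]
    exact congrArg _ (holHomeomorph.apply_symm_apply u).symm
  refine ⟨leftTranslation γ, contDiff_leftTranslation γ, ?_, fun u => ?_⟩
  · apply holHomeomorph.symm.injective
    rw [key, hx]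
  · exact (mk_eq_mk_iff Γ).2 ⟨γ, hγ, (key u).symm⟩

/-- An ideal `𝔟` is `Γ`-rational if `(⟨log Γ⟩_ℚ ∩ 𝔟) ⊗ ℝ ≅ 𝔟`, that is, if `𝔟` is the real span of
its intersection with the rational span of `log Γ`. -/
def IsRational (𝔟 : LieIdeal ℝ LieAlgH7) : Prop :=
  Submodule.span ℝ ((Submodule.span ℚ (log '' (Γ : Set H7)) : Set LieAlgH7) ∩ (𝔟 : Set LieAlgH7))
    = 𝔟.toSubmodule

/-! ### The fibration induced by `H₇ → H₇ / 𝔣 = ℂ` -/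

theorem baseCoord_mul (g h : H7) : baseCoord (g * h) = baseCoord g + baseCoord h := by
  apply Complex.ext <;> simp [baseCoord, log_mul, bracket_def]

theorem baseCoord_eq_zero_iff (g : H7) : baseCoord g = 0 ↔ g.log ∈ 𝔣 := by
  rw [Complex.ext_iff]
  exact Iff.rfl

/-- The image of `Γ` under the projection `H₇ → ℂ`. -/
def basePeriods : AddSubgroup ℂ where
  carrier := baseCoord '' (Γ : Set H7)
  zero_mem' := ⟨1, Γ.one_mem, by apply Complex.ext <;> simp [baseCoord]⟩
  add_mem' := by
    rintro _ _ ⟨g, hg, rfl⟩ ⟨h, hh, rfl⟩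
    exact ⟨g * h, Γ.mul_mem hg hh, baseCoord_mul g h⟩
  neg_mem' := by
    rintro _ ⟨g, hg, rfl⟩
    exact ⟨g⁻¹, Γ.inv_mem hg, by apply Complex.ext <;> simp [baseCoord]⟩

/-- The map `Γ \ H₇ → ℂ ⧸ basePeriods Γ` induced by the projection `H₇ → ℂ`. -/
def fibration : Nilmanifold Γ → ℂ ⧸ basePeriods Γ :=
  Quotient.lift (fun g => (QuotientAddGroup.mk (baseCoord g) : ℂ ⧸ basePeriods Γ)) (by
    rintro a b ⟨γ, rfl⟩
    refine (QuotientAddGroup.eq.2 ?_).symm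
    have h : baseCoord γ = -baseCoord b + baseCoord (γ * b) := by
      rw [baseCoord_mul]
      ring
    exact h ▸ ⟨γ, γ.2, rfl⟩)

/-! ### The leaf `F = (Γ ∩ 𝔣) \ 𝔣` -/

/-- The inclusion of `𝔣 = ℂ²` into `H₇`, where `ℂ²` has the coordinates
`dz₁ = e³ + i e⁴`, `dz₂ = e⁵ + i e⁶`. -/
def expFibre (w : Fin 2 → ℂ) : H7 :=
  exp (ofCoords ![0, 0, (w 0).re, (w 0).im, (w 1).re, (w 1).im])

theorem expFibre_add (w w' : Fin 2 → ℂ) : expFibre (w + w') = expFibre w * expFibre w' := by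
  ext <;> simp [expFibre, log_mul, bracket_def]

theorem expFibre_I_smul (w : Fin 2 → ℂ) :
    (expFibre (Complex.I • w)).log = J₀ (expFibre w).log := by
  ext <;> simp [expFibre, J₀]

theorem range_expFibre : Set.range expFibre = {g | g.log ∈ 𝔣} := by
  ext g
  refine ⟨?_, fun hg => ⟨![⟨g.log 2, g.log 3⟩, ⟨g.log 4, g.log 5⟩], ?_⟩⟩
  · rintro ⟨w, rfl⟩
    exact ⟨rfl, rfl⟩
  · ext <;> simp [expFibre]
    · exact hg.1.symm
    · exact hg.2.symm

theorem continuous_expFibre : Continuous expFibre := by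
  rw [continuous_iff]
  intro i
  fin_cases i <;> simp [expFibre] <;> fun_prop

theorem expFibre_injective : Function.Injective expFibre := by
  intro w w' h
  have h' : ∀ i, (expFibre w).log i = (expFibre w').log i := fun i => by rw [h]
  funext i
  fin_cases i
  · exact Complex.ext (h' 2) (h' 3)
  · exact Complex.ext (h' 4) (h' 5)

/-- The group `Γ ∩ 𝔣`, as a subgroup of `𝔣 = ℂ²`. The leaf is `F = ℂ² ⧸ fibrePeriods Γ`. -/
def fibrePeriods : AddSubgroup (Fin 2 → ℂ) where
  carrier := {w | expFibre w ∈ Γ}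
  zero_mem' := by
    have : expFibre 0 = 1 := by ext <;> simp [expFibre]
    simp [this]
  add_mem' := by
    intro w w' hw hw'
    simp only [Set.mem_ofPred_eq, expFibre_add] at *
    exact Γ.mul_mem hw hw'
  neg_mem' := by
    intro w hw
    have : expFibre (-w) = (expFibre w)⁻¹ := by ext <;> simp [expFibre]
    simp only [Set.mem_ofPred_eq, this] at *
    exact Γ.inv_mem hw

instance [DiscreteTopology Γ] : DiscreteTopology (fibrePeriods Γ) :=
  DiscreteTopology.of_continuous_injective
    (f := fun w : fibrePeriods Γ => (⟨expFibre w, w.2⟩ : Γ))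
    ((continuous_expFibre.comp continuous_subtype_val).subtype_mk _)
    (fun _ _ h => Subtype.ext (expFibre_injective (congrArg Subtype.val h)))

end Nilmanifold

/-! ### Torus bundles and principal bundles -/

/-- A discrete subgroup `L` of a real vector space `V` is a (full) lattice if it spans `V`. -/
def IsFullLattice {V : Type*} [NormedAddCommGroup V] [NormedSpace ℝ V] (L : AddSubgroup V) : Prop :=
  DiscreteTopology L ∧ Submodule.span ℝ (L : Set V) = ⊤

/-- A subset `S` of a complex manifold `M` is an embedded complex `n`-torus: it is the image of a
holomorphic embedding of `ℂⁿ ⧸ L` for a lattice `L`. -/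
def IsEmbeddedComplexTorus (EM : Type*) {M : Type*} [NormedAddCommGroup EM] [NormedSpace ℂ EM]
    [TopologicalSpace M] [ChartedSpace EM M] (n : ℕ) (S : Set M) : Prop :=
  ∃ (L : AddSubgroup (Fin n → ℂ)) (_ : DiscreteTopology L), IsFullLattice L ∧
    ∃ j : (Fin n → ℂ) ⧸ L → M,
      ContMDiff 𝓘(ℂ, Fin n → ℂ) 𝓘(ℂ, EM) ω j ∧
      (∀ x, Function.Injective (mfderiv 𝓘(ℂ, Fin n → ℂ) 𝓘(ℂ, EM) j x)) ∧
      Topology.IsEmbedding j ∧ Set.range j = S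

/-- `π : M → B` is a (differentiable) bundle of complex `n`-tori: a holomorphic submersion of
complex manifolds, all of whose fibres are complex `n`-tori, and which is a locally trivial
`C^∞` fibre bundle. The complex structure of the fibres may vary. -/
structure IsComplexTorusBundle (n : ℕ) (EM EB : Type*) {M B : Type*} [NormedAddCommGroup EM]
    [NormedSpace ℂ EM] [NormedAddCommGroup EB] [NormedSpace ℂ EB] [TopologicalSpace M]
    [ChartedSpace EM M] [TopologicalSpace B] [ChartedSpace EB B] (π : M → B) : Prop where
  holomorphic : ContMDiff 𝓘(ℂ, EM) 𝓘(ℂ, EB) ω π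
  submersion : ∀ x, Function.Surjective (mfderiv 𝓘(ℂ, EM) 𝓘(ℂ, EB) π x)
  fibre_torus : ∀ b, IsEmbeddedComplexTorus EM n (π ⁻¹' {b})
  locally_trivial : ∃ (L : AddSubgroup (Fin n → ℂ)) (_ : DiscreteTopology L), IsFullLattice L ∧
    ∀ b, ∃ e : Bundle.Trivialization ((Fin n → ℂ) ⧸ L) π, b ∈ e.baseSet ∧
      ContMDiffOn 𝓘(ℝ, EM) (𝓘(ℝ, EB).prod 𝓘(ℝ, Fin n → ℂ)) ∞ e e.source ∧
      ContMDiffOn (𝓘(ℝ, EB).prod 𝓘(ℝ, Fin n → ℂ)) 𝓘(ℝ, EM) ∞ e.toOpenPartialHomeomorph.symm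
        e.target

/-- `π : M → B` is a principal bundle with structure group `G` for the given action of `G`:
locally over `B` there are `G`-equivariant trivialisations, where `G` acts on `B × G` by
multiplication on the second factor. -/
def IsPrincipalBundle (G : Type*) {M B : Type*} [Group G] [TopologicalSpace G] [TopologicalSpace M]
    [TopologicalSpace B] [MulAction G M] (π : M → B) : Prop :=
  ∀ b, ∃ e : Bundle.Trivialization G π, b ∈ e.baseSet ∧
    ∀ x ∈ e.source, ∀ g : G, g • x ∈ e.source ∧ e (g • x) = ((e x).1, g * (e x).2)

/-- `π` is a (topological) principal bundle for some action of some topological group. -/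
def AdmitsPrincipalBundleStructure {M B : Type*} [TopologicalSpace M] [TopologicalSpace B]
    (π : M → B) : Prop :=
  ∃ (G : Type) (_ : Group G) (_ : TopologicalSpace G) (_ : IsTopologicalGroup G)
    (_ : MulAction G M) (_ : ContinuousSMul G M), IsPrincipalBundle G π

/-! ### Toroidal groups -/

/-- An abelian complex Lie group is toroidal if all holomorphic functions on it are constant. -/
def IsToroidalGroup (V F : Type*) [NormedAddCommGroup V] [NormedSpace ℂ V] [AddCommGroup F]
    [TopologicalSpace F] [ChartedSpace V F] [LieAddGroup 𝓘(ℂ, V) ω F] : Prop :=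
  ∀ f : F → ℂ, MDifferentiable 𝓘(ℂ, V) 𝓘(ℂ, ℂ) f → ∃ c, ∀ x, f x = c

/-- Toroidal coordinates for `V ⧸ L`, where `L` is a discrete subgroup of the complex vector space
`V`: an isomorphism `V ≃ ℂᵐ × ℂ^q` under which `L` becomes the group generated by the columns of
the period matrix
`(1 R)`
`(0 P)`,
where `P` is the period matrix of a complex torus of dimension `q`, i.e. its columns form a real
basis of `ℂ^q`, and `R` is a real matrix, the glueing matrix, such that `σᵗ R` is not integral for
integral `σ ≠ 0`. -/
structure ToroidalCoordinates {V : Type*} [NormedAddCommGroup V] [NormedSpace ℂ V]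
    (L : AddSubgroup V) (m q : ℕ) where
  coord : V ≃ₗ[ℂ] (Fin m → ℂ) × (Fin q → ℂ)
  R : Matrix (Fin m) (Fin (2 * q)) ℝ
  P : Module.Basis (Fin (2 * q)) ℝ (Fin q → ℂ)
  mem_iff : ∀ v, v ∈ L ↔ ∃ (a : Fin m → ℤ) (b : Fin (2 * q) → ℤ),
    coord v = (fun i => (a i : ℂ) + ∑ j, (R i j : ℂ) * (b j : ℂ), ∑ j, (b j : ℝ) • P j)
  irrational : ∀ σ : Fin m → ℤ, σ ≠ 0 → ∀ τ : Fin (2 * q) → ℤ,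
    ∃ j, ∑ i, (σ i : ℝ) * R i j ≠ (τ j : ℝ)

/-- The Euclidean norm of a real vector. -/
def euclideanNorm {k : ℕ} (x : Fin k → ℝ) : ℝ := √(∑ i, x i ^ 2)

/-- A real matrix `R` satisfies the theta condition if there is `r > 0` such that
`r ^ (-|σ|) ≤ dist (Rᵗ σ, ℤ^{k})` for all non-zero integral vectors `σ`. -/
def ThetaCondition {m k : ℕ} (R : Matrix (Fin m) (Fin k) ℝ) : Prop :=
  ∃ r : ℝ, 0 < r ∧ ∀ σ : Fin m → ℤ, σ ≠ 0 →
    r ^ (-euclideanNorm fun i => (σ i : ℝ)) ≤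
      ⨅ τ : Fin k → ℤ, euclideanNorm fun j => ∑ i, (σ i : ℝ) * R i j - (τ j : ℝ)

/-- The group `V ⧸ L` is a toroidal theta group: it is toroidal and the glueing matrix with respect
to toroidal coordinates satisfies the theta condition. -/
def IsToroidalThetaGroup {V : Type*} [NormedAddCommGroup V] [NormedSpace ℂ V] (L : AddSubgroup V)
    [DiscreteTopology L] : Prop :=
  IsToroidalGroup V (V ⧸ L) ∧
    ∃ (m q : ℕ) (c : ToroidalCoordinates L m q), ThetaCondition c.R

/-- The group `V ⧸ L` is a toroidal wild group: it is toroidal, but not a toroidal theta group. -/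
def IsToroidalWildGroup {V : Type*} [NormedAddCommGroup V] [NormedSpace ℂ V] (L : AddSubgroup V)
    [DiscreteTopology L] : Prop :=
  IsToroidalGroup V (V ⧸ L) ∧ ¬ IsToroidalThetaGroup L

end

/-! ### Discrete subgroups of normed spaces -/

namespace DiscreteSubgroup

/-! The lattice Γ is studied through the additive group `logLattice Γ` generated by its logarithms.
Because 𝔥₇ is 2-step nilpotent, doubling an element of this group gives the logarithm of an element
of Γ (`exp_two_nsmul_mem`). So the group is discrete and closed under brackets, it spans 𝔥₇ when Γ
is cocompact (`span_logLattice`), and it detects rationality of ideals (`isRational_iff`).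

The central dichotomy concerns `heightGroup Γ`, the group of e₄-coordinates of central vectors of
this lattice. It contains every determinant x₀y₁ − x₁y₀ of lattice vectors. If it is cyclic,
Cramer's rule with these commensurable determinants produces enough lattice vectors in 𝔣, and 𝔣 is
rational; so if 𝔣 is not rational, the heights are dense in ℝ. Besides 𝔣, the only non-trivial
J₀-invariant ideal is ⟨e₅, e₆⟩. Its rationality would make the image of the lattice modulo ⟨e₅, e₆⟩
discrete, which is incompatible with dense heights. Hence any rational non-trivial J₀-invariant
ideal forces 𝔣 to be rational.

If 𝔣 is rational, the factorisation g = exp(w)·s(z), with s = `baseSection`, gives real-analytic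
local trivialisations. The opposite order s(z)·exp(w) parametrises each fibre holomorphically,
because left translations are holomorphic; its period lattice is twisted by `shear`, which is only
real linear, so the complex structure of the fibres may vary. A principal structure would make Γ ∩ 𝔣
commute with Γ (`commute_of_isPrincipalBundle`). Since Γ ∩ 𝔣 spans 𝔣, bracketing with e₃ then shows
that Γ projects to 0 in ℂ, contradicting cocompactness.

If 𝔣 is not rational, let F be an entire function on ℂ² invariant under Γ ∩ 𝔣. The periods span at
least the centre {Re z₁ = 0}, so F is bounded there; Liouville's theorem in z₂ and density of the
heights make F constant on the centre, and the identity theorem in z₁ makes it constant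
(`eq_const_of_periodic`).

For (3), `slopeLattice α` with α irrational has a leaf with glueing matrix (α, 0). Bad
approximability of √2 gives the theta case. For wildness all toroidal coordinates must be excluded:
every glueing entry is t(κ + αμ) with κ, μ integral and a common t for which t(k + αl) = 1, so
super-exponentially good approximations of α, which exist by Baire category, carry over to every
glueing matrix. -/

theorem of_gap {E : Type*} [NormedAddCommGroup E] (L : AddSubgroup E) {ε : ℝ} (hε : 0 < ε)
    (h : ∀ x ∈ L, ‖x‖ < ε → x = 0) : DiscreteTopology L := by
  apply discreteTopology_of_isOpen_singleton_zero
  rw [Metric.isOpen_iff]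
  rintro x rfl
  refine ⟨ε, hε, fun y hy => ?_⟩
  have hy' : ‖(y : E)‖ < ε := by simpa [Metric.mem_ball, dist_eq_norm] using hy
  exact Subtype.ext (h y y.2 hy')

variable {E : Type*} [NormedAddCommGroup E] [NormedSpace ℝ E] [FiniteDimensional ℝ E]

theorem finite_inter_closedBall (L : AddSubgroup E) [DiscreteTopology L] (r : ℝ) :
    ((L : Set E) ∩ Metric.closedBall 0 r).Finite := by
  have : ProperSpace E := FiniteDimensional.proper ℝ E
  rw [Set.inter_comm]
  exact Metric.finite_isBounded_inter_isClosed (DiscreteTopology.isDiscrete (s := (L : Set E)))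
    Metric.isBounded_closedBall (AddSubgroup.isClosed_of_discrete (H := L))

/-- A subgroup is coarsely dense in its real span. -/
theorem exists_near_of_mem_span (L : AddSubgroup E) :
    ∃ C : ℝ, ∀ x ∈ Submodule.span ℝ (L : Set E), ∃ l ∈ L, ‖x - l‖ ≤ C := by
  obtain ⟨f, hf, hspan, -⟩ :=
    Submodule.exists_fun_fin_finrank_span_eq ℝ (L : Set E)
  refine ⟨∑ i, ‖f i‖, fun x hx => ?_⟩
  rw [← hspan, Submodule.mem_span_range_iff_exists_fun] at hx
  obtain ⟨c, rfl⟩ := hx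
  -- Round the coefficients down; the error lies in the parallelepiped spanned by the `f i`.
  refine ⟨∑ i, ⌊c i⌋ • f i, sum_mem fun i _ => L.zsmul_mem (hf i) _, ?_⟩
  rw [← Finset.sum_sub_distrib]
  refine (norm_sum_le _ _).trans (Finset.sum_le_sum fun i _ => ?_)
  have : c i • f i - ⌊c i⌋ • f i = Int.fract (c i) • f i := by
    rw [← Int.cast_smul_eq_zsmul ℝ, ← sub_smul, Int.fract]
  rw [this, norm_smul, Real.norm_of_nonneg (Int.fract_nonneg _)]
  exact mul_le_of_le_one_left (norm_nonneg _) (Int.fract_lt_one _).le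

/-- The image of a discrete subgroup under a linear map with rational kernel is discrete. -/
theorem exists_gap_map {F : Type*} [NormedAddCommGroup F] [NormedSpace ℝ F]
    (L : AddSubgroup E) [DiscreteTopology L] (f : E →ₗ[ℝ] F)
    (hf : LinearMap.ker f ≤ Submodule.span ℝ ((L : Set E) ∩ LinearMap.ker f)) :
    ∃ ε > 0, ∀ x ∈ L, ‖f x‖ < ε → f x = 0 := by
  obtain ⟨C, hC⟩ := exists_near_of_mem_span (L ⊓ (LinearMap.ker f).toAddSubgroup)
  have hC' : ∀ x ∈ LinearMap.ker f, ∃ l ∈ L, f l = 0 ∧ ‖x - l‖ ≤ C := by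
    intro x hx
    obtain ⟨l, hl, h⟩ := hC x (hf hx)
    exact ⟨l, hl.1, hl.2, h⟩
  obtain ⟨g, hg⟩ := f.rangeRestrict.exists_rightInverse_of_surjective f.range_rangeRestrict
  have hg' : ∀ x, f (g (f.rangeRestrict x)) = f x := fun x =>
    congrArg Subtype.val (LinearMap.congr_fun hg (f.rangeRestrict x))
  set G := LinearMap.toContinuousLinearMap g
  -- Modulo lattice vectors in the kernel, each lattice point with ‖f x‖ < 1 has a representative in
  -- this ball: its kernel component is within C of a lattice vector, and the complementary
  -- component has norm at most ‖G‖. So only finitely many values of f are small, and ε separates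
  -- the non-zero ones from 0.
  have hfin := (finite_inter_closedBall L (C + ‖G‖)).image f
  have hopen := (hfin.sdiff (t := {0})).isClosed.isOpen_compl
  obtain ⟨ε, hε, hball⟩ := Metric.isOpen_iff.1 hopen 0 (by simp)
  refine ⟨min ε 1, by positivity, fun x hx hxε => ?_⟩
  by_contra hne
  have hker : x - g (f.rangeRestrict x) ∈ LinearMap.ker f := by
    rw [LinearMap.mem_ker, map_sub, hg', sub_self]
  obtain ⟨l, hl, hfl, hn⟩ := hC' _ hker
  have hfx : f (x - l) = f x := by rw [map_sub, hfl, sub_zero]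
  have hmem : x - l ∈ (L : Set E) ∩ Metric.closedBall 0 (C + ‖G‖) := by
    refine ⟨L.sub_mem hx hl, ?_⟩
    rw [mem_closedBall_zero_iff]
    calc ‖x - l‖ = ‖(x - g (f.rangeRestrict x) - l) + G (f.rangeRestrict x)‖ := by
          congr 1; simp [G]; abel
      _ ≤ C + ‖G‖ * ‖f.rangeRestrict x‖ := (norm_add_le _ _).trans
          (add_le_add hn (G.le_opNorm _))
      _ ≤ C + ‖G‖ * 1 := by
          gcongr
          exact (hxε.trans_le (min_le_right _ _)).le
      _ = _ := by ring
  have : f x ∈ Metric.ball (0 : F) ε := by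
    simpa using hxε.trans_le (min_le_left _ _)
  exact hball this ⟨⟨x - l, hmem, hfx⟩, hne⟩

theorem compactSpace_quotient (L : AddSubgroup E) (hL : Submodule.span ℝ (L : Set E) = ⊤) :
    CompactSpace (E ⧸ L) := by
  have : ProperSpace E := FiniteDimensional.proper ℝ E
  obtain ⟨C, hC⟩ := exists_near_of_mem_span L
  have hc : IsCompact ((QuotientAddGroup.mk : E → E ⧸ L) '' Metric.closedBall 0 C) :=
    (isCompact_closedBall 0 C).image continuous_quotient_mk'
  refine ⟨hc.of_isClosed_subset isClosed_univ ?_⟩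
  rintro y -
  obtain ⟨x, rfl⟩ := QuotientAddGroup.mk_surjective y
  obtain ⟨l, hl, h⟩ := hC x (hL ▸ Submodule.mem_top)
  refine ⟨x - l, by simpa using h, ?_⟩
  rw [QuotientAddGroup.mk_sub, (QuotientAddGroup.eq_zero_iff l).2 hl, sub_zero]

/-- A non-zero linear functional vanishing on L would descend to an unbounded continuous function on
the compact quotient. -/
theorem span_eq_top_of_compactSpace_quotient (L : AddSubgroup E)
    [CompactSpace (E ⧸ L)] : Submodule.span ℝ (L : Set E) = ⊤ := by
  by_contra hne
  obtain ⟨φ, hφ, hle⟩ := Submodule.exists_le_ker_of_lt_top _ (lt_top_iff_ne_top.2 hne)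
  have hφc : Continuous φ := φ.continuous_of_finiteDimensional
  let ψ : E ⧸ L →+ ℝ := QuotientAddGroup.lift L φ.toAddMonoidHom
    fun x hx => hle (Submodule.subset_span hx)
  have hψ : Continuous ψ := hφc.quotient_lift _
  obtain ⟨v, hv⟩ : ∃ v, φ v ≠ 0 := by
    by_contra! h
    exact hφ (LinearMap.ext h)
  obtain ⟨K, hK⟩ := (isCompact_range hψ).bddAbove
  have := hK ⟨QuotientAddGroup.mk (((K + 1) / φ v) • v), rfl⟩
  change φ (((K + 1) / φ v) • v) ≤ K at this
  rw [map_smul, smul_eq_mul, div_mul_cancel₀ _ hv] at this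
  linarith

end DiscreteSubgroup

theorem exists_nsmul_mem_closure_of_mem_span_rat {V : Type*} [AddCommGroup V] [Module ℚ V]
    {S : Set V} {x : V} (hx : x ∈ Submodule.span ℚ S) :
    ∃ n : ℕ, n ≠ 0 ∧ n • x ∈ AddSubgroup.closure S := by
  induction hx using Submodule.span_induction with
  | mem x h => exact ⟨1, one_ne_zero, by simpa using AddSubgroup.subset_closure h⟩
  | zero => exact ⟨1, one_ne_zero, by simp⟩
  | add x y _ _ hx hy =>
    obtain ⟨n, hn, hx⟩ := hx
    obtain ⟨m, hm, hy⟩ := hy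
    refine ⟨n * m, mul_ne_zero hn hm, ?_⟩
    rw [smul_add]
    refine add_mem ?_ ?_
    · rw [mul_comm, mul_smul]; exact AddSubgroup.nsmul_mem _ hx _
    · rw [mul_smul]; exact AddSubgroup.nsmul_mem _ hy _
  | smul c x _ hx =>
    obtain ⟨n, hn, hx⟩ := hx
    refine ⟨c.den * n, mul_ne_zero c.den_nz hn, ?_⟩
    have : (c.den * n) • c • x = c.num • n • x := by
      rw [← Nat.cast_smul_eq_nsmul ℚ, ← Int.cast_smul_eq_zsmul ℚ, ← Nat.cast_smul_eq_nsmul ℚ n,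
        smul_smul, smul_smul]
      congr 1
      push_cast
      rw [mul_right_comm, mul_comm (c.den : ℚ) c, Rat.mul_den_eq_num]
    rw [this]
    exact AddSubgroup.zsmul_mem _ hx _

/-! ### The additive lattice generated by the logarithms of a lattice in `H₇` -/

namespace LieAlgH7

instance : FiniteDimensional ℝ LieAlgH7 := inferInstanceAs (FiniteDimensional ℝ (Fin 6 → ℝ))

/-- The coordinate functionals of `𝔥₇`. -/
def coordL (i : Fin 6) : LieAlgH7 →ₗ[ℝ] ℝ := LinearMap.proj (R := ℝ) (φ := fun _ : Fin 6 => ℝ) i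

@[simp] theorem coordL_apply (i : Fin 6) (x : LieAlgH7) : coordL i x = x i := rfl

theorem abs_apply_le_norm (x : LieAlgH7) (i : Fin 6) : |x i| ≤ ‖x‖ :=
  norm_le_pi_norm (x : Fin 6 → ℝ) i

@[simp] theorem sub_apply (x y : LieAlgH7) (i : Fin 6) : (x - y) i = x i - y i := rfl
@[simp] theorem nsmul_apply (n : ℕ) (x : LieAlgH7) (i : Fin 6) : (n • x) i = n * x i := by
  rw [← Nat.cast_smul_eq_nsmul ℝ, smul_apply]
@[simp] theorem zsmul_apply (n : ℤ) (x : LieAlgH7) (i : Fin 6) : (n • x) i = n * x i := by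
  rw [← Int.cast_smul_eq_zsmul ℝ, smul_apply]

theorem mem_𝔣 (x : LieAlgH7) : x ∈ 𝔣 ↔ x 0 = 0 ∧ x 1 = 0 := Iff.rfl

end LieAlgH7

namespace H7

theorem discreteTopology_iff_exists_gap (Γ : Subgroup H7) :
    DiscreteTopology Γ ↔ ∃ ε > 0, ∀ g ∈ Γ, ‖g.log‖ < ε → g = 1 := by
  constructor
  · intro h
    have h1 : IsOpen ({1} : Set Γ) := isOpen_discrete _
    obtain ⟨U, hU, hU'⟩ := isOpen_induced_iff.1 h1
    obtain ⟨V, hV, rfl⟩ := isOpen_induced_iff.1 hU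
    have h0 : (0 : LieAlgH7) ∈ V := by
      have : (1 : Γ) ∈ ((↑) : Γ → H7) ⁻¹' (log ⁻¹' V) := hU' ▸ rfl
      exact this
    obtain ⟨ε, hε, hb⟩ := Metric.isOpen_iff.1 hV 0 h0
    refine ⟨ε, hε, fun g hg hn => ?_⟩
    have : (⟨g, hg⟩ : Γ) ∈ ((↑) : Γ → H7) ⁻¹' (log ⁻¹' V) := hb (by simpa using hn)
    rw [hU'] at this
    exact congrArg Subtype.val this
  · rintro ⟨ε, hε, h⟩
    apply discreteTopology_of_isOpen_singleton_one
    rw [isOpen_induced_iff]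
    refine ⟨log ⁻¹' Metric.ball 0 ε, Metric.isOpen_ball.preimage continuous_log, ?_⟩
    ext g
    simp only [Set.mem_preimage, mem_ball_zero_iff, Set.mem_singleton_iff]
    refine ⟨fun hg => Subtype.ext (h g g.2 hg), ?_⟩
    rintro rfl
    simpa using hε

open LieAlgH7

/-- All triple brackets vanish, so the commutator has no higher correction terms. Hence brackets of
logarithms of elements of Γ are again logarithms of elements of Γ. -/
theorem log_commutator (g h : H7) : (g * h * g⁻¹ * h⁻¹).log = ⁅g.log, h.log⁆ := by
  ext <;> simp [log_mul, bracket_def] <;> ring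

end H7

namespace Nilmanifold

open H7 LieAlgH7

/-- The additive group generated by the logarithms of the elements of `Γ`. -/
def logLattice (Γ : Subgroup H7) : AddSubgroup LieAlgH7 := AddSubgroup.closure (log '' (Γ : Set H7))

variable (Γ : Subgroup H7)

theorem log_mem_logLattice {g : H7} (hg : g ∈ Γ) : g.log ∈ logLattice Γ :=
  AddSubgroup.subset_closure ⟨g, hg, rfl⟩

theorem exp_bracket_log_mem {g h : H7} (hg : g ∈ Γ) (hh : h ∈ Γ) : exp ⁅g.log, h.log⁆ ∈ Γ := by
  have : exp ⁅g.log, h.log⁆ = g * h * g⁻¹ * h⁻¹ := by rw [← log_commutator]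
  rw [this]
  exact Γ.mul_mem (Γ.mul_mem (Γ.mul_mem hg hh) (Γ.inv_mem hg)) (Γ.inv_mem hh)

/-- For a generator log k the product g k k has logarithm log g + 2 log k + [log g, log k], and the
bracket term is removed by a commutator in Γ. A single factor k would leave half a bracket, whence
the factor 2. The quantifier over g lets the induction pass through sums. -/
theorem exp_log_add_two_nsmul_mem {x : LieAlgH7} (hx : x ∈ logLattice Γ) :
    ∀ g ∈ Γ, exp (g.log + 2 • x) ∈ Γ := by
  induction hx using AddSubgroup.closure_induction with
  | mem x hx =>
    obtain ⟨k, hk, rfl⟩ := hx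
    intro g hg
    have : exp (g.log + 2 • k.log) = g * k * k * (exp ⁅g.log, k.log⁆)⁻¹ := by
      ext <;> simp [log_mul, bracket_def] <;> ring
    rw [this]
    exact Γ.mul_mem (Γ.mul_mem (Γ.mul_mem hg hk) hk) (Γ.inv_mem (exp_bracket_log_mem Γ hg hk))
  | zero => intro g hg; simpa using hg
  | add x y _ _ hx hy =>
    intro g hg
    have := hy _ (hx g hg)
    rwa [add_assoc, ← smul_add] at this
  | neg x _ hx =>
    intro g hg
    have h := Γ.inv_mem (hx _ (Γ.inv_mem hg))
    have e : (exp ((g⁻¹).log + 2 • x))⁻¹ = exp (g.log + 2 • -x) := by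
      ext <;> simp <;> ring
    rwa [e] at h

theorem exp_two_nsmul_mem {x : LieAlgH7} (hx : x ∈ logLattice Γ) : exp (2 • x) ∈ Γ := by
  simpa using exp_log_add_two_nsmul_mem Γ hx 1 Γ.one_mem

theorem bracket_mem_logLattice {x y : LieAlgH7} (hx : x ∈ logLattice Γ) (hy : y ∈ logLattice Γ) :
    ⁅x, y⁆ ∈ logLattice Γ := by
  induction hx, hy using AddSubgroup.closure_induction₂ with
  | mem x y hx hy =>
    obtain ⟨g, hg, rfl⟩ := hx
    obtain ⟨h, hh, rfl⟩ := hy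
    exact log_mem_logLattice Γ (exp_bracket_log_mem Γ hg hh)
  | zero_left => simp
  | zero_right => simp
  | add_left x y z _ _ _ h1 h2 => rw [add_lie]; exact add_mem h1 h2
  | add_right x y z _ _ _ h1 h2 => rw [lie_add]; exact add_mem h1 h2
  | neg_left x y _ _ h => rw [neg_lie]; exact neg_mem h
  | neg_right x y _ _ h => rw [lie_neg]; exact neg_mem h

instance discreteTopology_logLattice [DiscreteTopology Γ] : DiscreteTopology (logLattice Γ) := by
  obtain ⟨ε, hε, h⟩ := (discreteTopology_iff_exists_gap Γ).1 inferInstance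
  refine DiscreteSubgroup.of_gap _ (half_pos hε) fun x hx hn => ?_
  have := h _ (exp_two_nsmul_mem Γ hx) (by
    change ‖2 • x‖ < ε
    rw [← Nat.cast_smul_eq_nsmul ℝ, norm_smul]
    simp
    linarith)
  have h2 : 2 • x = 0 := congrArg log this
  rw [← Nat.cast_smul_eq_nsmul ℝ] at h2
  simpa using h2

/-- Clearing denominators moves a vector of the rational span into `logLattice Γ`, and real spans do
not see the scaling. -/
theorem isRational_iff (𝔟 : LieIdeal ℝ LieAlgH7) :
    IsRational Γ 𝔟 ↔ Submodule.span ℝ ((logLattice Γ : Set LieAlgH7) ∩ (𝔟 : Set LieAlgH7)) =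
      𝔟.toSubmodule := by
  have : Submodule.span ℝ ((Submodule.span ℚ (log '' (Γ : Set H7)) : Set LieAlgH7) ∩
      (𝔟 : Set LieAlgH7)) =
      Submodule.span ℝ ((logLattice Γ : Set LieAlgH7) ∩ (𝔟 : Set LieAlgH7)) := by
    apply le_antisymm
    · rw [Submodule.span_le]
      rintro x ⟨hx, hxb⟩
      obtain ⟨n, hn, h⟩ := exists_nsmul_mem_closure_of_mem_span_rat hx
      have hn' : (n : ℝ) ≠ 0 := Nat.cast_ne_zero.2 hn
      have e : x = (n : ℝ)⁻¹ • (n • x) := by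
        rw [← Nat.cast_smul_eq_nsmul ℝ, smul_smul, inv_mul_cancel₀ hn', one_smul]
      have hb : n • x ∈ 𝔟 := by
        rw [← Nat.cast_smul_eq_nsmul ℝ]
        exact 𝔟.smul_mem _ hxb
      rw [e]
      exact Submodule.smul_mem _ _ (Submodule.subset_span ⟨h, hb⟩)
    · refine Submodule.span_mono (Set.inter_subset_inter_left _ ?_)
      intro x hx
      have : logLattice Γ ≤ (Submodule.span ℚ (log '' (Γ : Set H7))).toAddSubgroup :=
        (AddSubgroup.closure_le _).2 Submodule.subset_span
      exact this hx
  rw [IsRational, this]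

/-- The abelianisation of a lattice spans the abelianisation of `𝔥₇`. -/
theorem exists_mem_span_of_compactSpace [CompactSpace (Nilmanifold Γ)] (v : Fin 3 → ℝ) :
    ∃ x ∈ Submodule.span ℝ (logLattice Γ : Set LieAlgH7), x 0 = v 0 ∧ x 1 = v 1 ∧ x 2 = v 2 := by
  let pr : LieAlgH7 →ₗ[ℝ] (Fin 3 → ℝ) := LinearMap.pi ![coordL 0, coordL 1, coordL 2]
  have hpr : ∀ g h : H7, pr (g * h).log = pr g.log + pr h.log := by
    intro g h
    funext i
    fin_cases i <;> simp [pr, log_mul, bracket_def]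
  suffices h : (Submodule.span ℝ (logLattice Γ : Set LieAlgH7)).map pr = ⊤ by
    have hv : v ∈ (⊤ : Submodule ℝ (Fin 3 → ℝ)) := Submodule.mem_top
    rw [← h] at hv
    obtain ⟨x, hx, hxv⟩ := hv
    exact ⟨x, hx, congrFun hxv 0, congrFun hxv 1, congrFun hxv 2⟩
  by_contra hne
  obtain ⟨φ, hφ, hle⟩ := Submodule.exists_le_ker_of_lt_top _ (lt_top_iff_ne_top.2 hne)
  -- The projection to the first three coordinates is additive on the group, so a functional killing
  -- the lattice descends to the compact quotient, where it would be unbounded.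
  let ψ : Nilmanifold Γ → ℝ := Quotient.lift (fun g => φ (pr g.log)) (by
    rintro a b ⟨γ, rfl⟩
    have h0 : φ (pr (γ : H7).log) = 0 :=
      hle ⟨_, Submodule.subset_span (log_mem_logLattice Γ γ.2), rfl⟩
    change φ (pr ((γ : H7) * b).log) = _
    rw [hpr, map_add, h0, zero_add])
  have hψ : Continuous ψ :=
    ((φ ∘ₗ pr).continuous_of_finiteDimensional.comp continuous_log).quotient_lift _
  obtain ⟨v, hv⟩ : ∃ v, φ v ≠ 0 := by
    by_contra! h
    exact hφ (LinearMap.ext h)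
  obtain ⟨K, hK⟩ := (isCompact_range hψ).bddAbove
  have hK' := hK ⟨mk Γ (exp (((K + 1) / φ v) • ofCoords ![v 0, v 1, v 2, 0, 0, 0])), rfl⟩
  change φ (pr (((K + 1) / φ v) • ofCoords ![v 0, v 1, v 2, 0, 0, 0])) ≤ K at hK'
  have hpv : pr (ofCoords ![v 0, v 1, v 2, 0, 0, 0]) = v := by
    funext i
    fin_cases i <;> simp [pr]
  rw [map_smul, hpv, map_smul, smul_eq_mul, div_mul_cancel₀ _ hv] at hK'
  linarith

theorem bracket_mem_span_of_forall {S : Set LieAlgH7} (hS : ∀ x ∈ logLattice Γ, ∀ y ∈ logLattice Γ,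
      ⁅x, y⁆ ∈ S) {x y : LieAlgH7}
    (hx : x ∈ Submodule.span ℝ (logLattice Γ : Set LieAlgH7))
    (hy : y ∈ Submodule.span ℝ (logLattice Γ : Set LieAlgH7)) :
    ⁅x, y⁆ ∈ Submodule.span ℝ S := by
  induction hx, hy using Submodule.span_induction₂ with
  | mem_mem x y hx hy => exact Submodule.subset_span (hS x hx y hy)
  | zero_left => simp
  | zero_right => simp
  | add_left x y z _ _ _ h1 h2 => rw [add_lie]; exact add_mem h1 h2
  | add_right x y z _ _ _ h1 h2 => rw [lie_add]; exact add_mem h1 h2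
  | smul_left c x y _ _ h => rw [smul_lie]; exact Submodule.smul_mem _ _ h
  | smul_right c x y _ _ h => rw [lie_smul]; exact Submodule.smul_mem _ _ h

/-- The commutators of a lattice span the centre of `𝔥₇`. -/
theorem mem_span_brackets [CompactSpace (Nilmanifold Γ)] {z : LieAlgH7} (h0 : z 0 = 0)
    (h1 : z 1 = 0) (h2 : z 2 = 0) :
    z ∈ Submodule.span ℝ {w | ∃ g ∈ Γ, ∃ h ∈ Γ, w = ⁅g.log, h.log⁆} := by
  set B := {w | ∃ g ∈ Γ, ∃ h ∈ Γ, w = ⁅g.log, h.log⁆}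
  obtain ⟨a, ha, ha0, ha1, ha2⟩ := exists_mem_span_of_compactSpace Γ ![1, 0, 0]
  obtain ⟨b, hb, hb0, hb1, hb2⟩ := exists_mem_span_of_compactSpace Γ ![0, 1, 0]
  obtain ⟨c, hc, hc0, hc1, hc2⟩ := exists_mem_span_of_compactSpace Γ ![0, 0, 1]
  have key : ∀ x ∈ Submodule.span ℝ (logLattice Γ : Set LieAlgH7),
      ∀ y ∈ Submodule.span ℝ (logLattice Γ : Set LieAlgH7), ⁅x, y⁆ ∈ Submodule.span ℝ B := by
    intro x hx y hy
    have h : ∀ x ∈ logLattice Γ, ∀ y ∈ logLattice Γ,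
        ⁅x, y⁆ ∈ (Submodule.span ℝ B : Set LieAlgH7) := by
      intro x hx y hy
      induction hx, hy using AddSubgroup.closure_induction₂ with
      | mem x y hx hy =>
        obtain ⟨g, hg, rfl⟩ := hx
        obtain ⟨h, hh, rfl⟩ := hy
        exact Submodule.subset_span ⟨g, hg, h, hh, rfl⟩
      | zero_left => simp
      | zero_right => simp
      | add_left x y z _ _ _ h1 h2 => rw [add_lie]; exact add_mem h1 h2
      | add_right x y z _ _ _ h1 h2 => rw [lie_add]; exact add_mem h1 h2
      | neg_left x y _ _ h => rw [neg_lie]; exact neg_mem h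
      | neg_right x y _ _ h => rw [lie_neg]; exact neg_mem h
    simpa using bracket_mem_span_of_forall Γ h hx hy
  -- The vectors a, b, c agree with e₁, e₂, e₃ modulo the centre, so their brackets are exactly −e₄,
  -- −e₅, −e₆.
  have e : z = (-z 3) • ⁅a, b⁆ + (-z 4) • ⁅a, c⁆ + (-z 5) • ⁅b, c⁆ := by
    simp at ha0 ha1 ha2 hb0 hb1 hb2 hc0 hc1 hc2
    ext <;> simp [bracket_def, *]
  rw [e]
  exact add_mem (add_mem (Submodule.smul_mem _ _ (key a ha b hb))
    (Submodule.smul_mem _ _ (key a ha c hc))) (Submodule.smul_mem _ _ (key b hb c hc))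

/-- Compactness controls the coordinates modulo the centre, and the commutators supply the centre.
-/
theorem span_logLattice [CompactSpace (Nilmanifold Γ)] :
    Submodule.span ℝ (logLattice Γ : Set LieAlgH7) = ⊤ := by
  rw [eq_top_iff]
  rintro x -
  obtain ⟨y, hy, h0, h1, h2⟩ := exists_mem_span_of_compactSpace Γ ![x 0, x 1, x 2]
  have hB : {w | ∃ g ∈ Γ, ∃ h ∈ Γ, w = ⁅g.log, h.log⁆} ⊆ (logLattice Γ : Set LieAlgH7) := by
    rintro _ ⟨g, hg, h, hh, rfl⟩
    exact bracket_mem_logLattice Γ (log_mem_logLattice Γ hg) (log_mem_logLattice Γ hh)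
  have hxy : x - y ∈ Submodule.span ℝ (logLattice Γ : Set LieAlgH7) := by
    refine Submodule.span_mono hB (mem_span_brackets Γ ?_ ?_ ?_) <;> simp [h0, h1, h2]
  simpa using add_mem hxy hy

end Nilmanifold

/-! ### Rational `J₀`-invariant ideals -/

namespace LieAlgH7

theorem isJ₀Invariant_𝔣 : IsJ₀Invariant 𝔣 := by
  rintro x ⟨h0, h1⟩
  simp [mem_𝔣, J₀, h0, h1]

variable {𝔟 : LieIdeal ℝ LieAlgH7}

/-- One bracket produces a non-zero vector of ⟨e₅, e₆⟩ in the ideal: bracketing with e₃ if x has a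
component along e₁, e₂, and with e₁ otherwise. This plane is a complex line for J₀, so it is then
contained in the ideal. -/
theorem mem_of_mem_of_apply_two_ne_zero (hJ : IsJ₀Invariant 𝔟) {x : LieAlgH7} (hx : x ∈ 𝔟)
    (h2 : x 0 ^ 2 + x 1 ^ 2 ≠ 0 ∨ x 2 ≠ 0) {y : LieAlgH7} (hy0 : y 0 = 0) (hy1 : y 1 = 0)
    (hy2 : y 2 = 0) (hy3 : y 3 = 0) : y ∈ 𝔟 := by
  have main : ∀ u ∈ 𝔟, u 0 = 0 → u 1 = 0 → u 2 = 0 → u 3 = 0 → u 4 ^ 2 + u 5 ^ 2 ≠ 0 → y ∈ 𝔟 := by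
    intro u hu h0 h1 h2 h3 hne
    -- J₀ is multiplication by i on this plane; the coefficients are the real and imaginary parts of
    -- the complex quotient y / u. The same formula recurs for the other J₀-invariant planes.
    have e : y = ((u 4 * y 4 + u 5 * y 5) / (u 4 ^ 2 + u 5 ^ 2)) • u +
        ((u 4 * y 5 - u 5 * y 4) / (u 4 ^ 2 + u 5 ^ 2)) • J₀ u := by
      ext <;> simp [J₀, *] <;> field_simp <;> ring
    rw [e]
    exact add_mem (𝔟.smul_mem _ hu) (𝔟.smul_mem _ (hJ u hu))
  by_cases h : x 0 ^ 2 + x 1 ^ 2 = 0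
  · have hx0 : x 0 = 0 := by nlinarith [sq_nonneg (x 0), sq_nonneg (x 1)]
    have hx1 : x 1 = 0 := by nlinarith [sq_nonneg (x 0), sq_nonneg (x 1)]
    have hx2 : x 2 ≠ 0 := h2.resolve_left (not_not.2 h)
    refine main ⁅x, ofCoords ![1, 0, 0, 0, 0, 0]⁆ (lie_mem_left ℝ _ 𝔟 _ _ hx) ?_ ?_ ?_ ?_ ?_ <;>
      simp [bracket_def, hx0, hx1, hx2]
  · refine main ⁅x, ofCoords ![0, 0, 1, 0, 0, 0]⁆ (lie_mem_left ℝ _ 𝔟 _ _ hx) ?_ ?_ ?_ ?_ ?_ <;>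
      simp [bracket_def, h]

theorem eq_top_of_mem (hJ : IsJ₀Invariant 𝔟) {x : LieAlgH7} (hx : x ∈ 𝔟)
    (h : x 0 ^ 2 + x 1 ^ 2 ≠ 0) : 𝔟 = ⊤ := by
  have h56 : ∀ y : LieAlgH7, y 0 = 0 → y 1 = 0 → y 2 = 0 → y 3 = 0 → y ∈ 𝔟 := fun y =>
    mem_of_mem_of_apply_two_ne_zero hJ hx (Or.inl h)
  set S := x 0 ^ 2 + x 1 ^ 2
  have h4 : ofCoords ![0, 0, 0, 1, 0, 0] ∈ 𝔟 := by
    -- Chosen so that v has e₄-coordinate (x₁² + x₀²)/S = 1; modulo ⟨e₅, e₆⟩ it equals e₄, and J₀ e₄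
    -- = −e₃ then gives all of 𝔣.
    set v := (x 1 / S) • ⁅x, ofCoords ![1, 0, 0, 0, 0, 0]⁆ +
      (- x 0 / S) • ⁅x, ofCoords ![0, 1, 0, 0, 0, 0]⁆
    have hv : v ∈ 𝔟 := add_mem (𝔟.smul_mem _ (lie_mem_left ℝ _ 𝔟 _ _ hx))
      (𝔟.smul_mem _ (lie_mem_left ℝ _ 𝔟 _ _ hx))
    have hd : ofCoords ![0, 0, 0, 1, 0, 0] - v ∈ 𝔟 := by
      apply h56 <;> simp [v, bracket_def]
      field_simp
      simp only [S]
      ring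
    simpa using add_mem hd hv
  have h𝔣 : ∀ y : LieAlgH7, y 0 = 0 → y 1 = 0 → y ∈ 𝔟 := by
    intro y hy0 hy1
    have e : y = (y 3) • ofCoords ![0, 0, 0, 1, 0, 0] + (-y 2) • J₀ (ofCoords ![0, 0, 0, 1, 0, 0])
        + ofCoords ![0, 0, 0, 0, y 4, y 5] := by
      ext <;> simp [J₀, *]
    rw [e]
    exact add_mem (add_mem (𝔟.smul_mem _ h4) (𝔟.smul_mem _ (hJ _ h4))) (by apply h56 <;> simp)
  rw [eq_top_iff]
  rintro y -
  set v := ((x 0 * y 0 + x 1 * y 1) / S) • x + ((x 0 * y 1 - x 1 * y 0) / S) • J₀ x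
  have hv : v ∈ 𝔟 := add_mem (𝔟.smul_mem _ hx) (𝔟.smul_mem _ (hJ _ hx))
  have hd : y - v ∈ 𝔟 := by
    apply h𝔣 <;> simp [v, J₀] <;> field_simp <;> simp only [S] <;> ring
  simpa using add_mem hd hv

/-- The non-trivial `J₀`-invariant ideals of `𝔥₇` are `𝔣` and `⟨e₅, e₆⟩`. -/
theorem eq_𝔣_or_of_isJ₀Invariant (hJ : IsJ₀Invariant 𝔟) (hbot : 𝔟 ≠ ⊥) (htop : 𝔟 ≠ ⊤) :
    𝔟 = 𝔣 ∨ ∀ x, x ∈ 𝔟 ↔ x 0 = 0 ∧ x 1 = 0 ∧ x 2 = 0 ∧ x 3 = 0 := by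
  have hle : ∀ x ∈ 𝔟, x 0 = 0 ∧ x 1 = 0 := by
    intro x hx
    have h : x 0 ^ 2 + x 1 ^ 2 = 0 := by
      by_contra h
      exact htop (eq_top_of_mem hJ hx h)
    constructor <;> nlinarith [sq_nonneg (x 0), sq_nonneg (x 1)]
  by_cases h : ∃ x ∈ 𝔟, x 2 ≠ 0
  · left
    obtain ⟨x, hx, hx2⟩ := h
    obtain ⟨hx0, hx1⟩ := hle x hx
    ext y
    refine ⟨hle y, fun ⟨hy0, hy1⟩ => ?_⟩
    have hne : x 2 ^ 2 + x 3 ^ 2 ≠ 0 := by positivity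
    set v := ((x 2 * y 2 + x 3 * y 3) / (x 2 ^ 2 + x 3 ^ 2)) • x +
      ((x 2 * y 3 - x 3 * y 2) / (x 2 ^ 2 + x 3 ^ 2)) • J₀ x
    have hv : v ∈ 𝔟 := add_mem (𝔟.smul_mem _ hx) (𝔟.smul_mem _ (hJ _ hx))
    have hd : y - v ∈ 𝔟 := by
      apply mem_of_mem_of_apply_two_ne_zero hJ hx (Or.inr hx2) <;>
        simp [v, J₀, hx0, hx1, hy0, hy1] <;> field_simp <;> ring
    simpa using add_mem hd hv
  · right
    push Not at h
    have hle' : ∀ x ∈ 𝔟, x 0 = 0 ∧ x 1 = 0 ∧ x 2 = 0 ∧ x 3 = 0 := fun x hx => by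
      -- The e₃-coordinate of J₀ x is −x₃, so the vanishing of all e₃-coordinates on the ideal
      -- forces that of the e₄-coordinates.
      have := h _ (hJ x hx)
      simp only [J₀, LinearMap.coe_mk, AddHom.coe_mk, ofCoords_apply] at this
      exact ⟨(hle x hx).1, (hle x hx).2, h x hx, by simpa using this⟩
    obtain ⟨u, hu, hu0⟩ : ∃ u ∈ 𝔟, u ≠ 0 := by
      by_contra! hall
      exact hbot ((LieSubmodule.eq_bot_iff 𝔟).2 hall)
    refine fun y => ⟨hle' y, fun ⟨h0, h1, h2, h3⟩ => ?_⟩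
    obtain ⟨hu0', hu1, hu2, hu3⟩ := hle' u hu
    have hne : u 4 ^ 2 + u 5 ^ 2 ≠ 0 := by
      intro hz
      apply hu0
      have h4 : u 4 = 0 := by nlinarith [sq_nonneg (u 4), sq_nonneg (u 5)]
      have h5 : u 5 = 0 := by nlinarith [sq_nonneg (u 4), sq_nonneg (u 5)]
      ext <;> simp [*]
    have e : y = ((u 4 * y 4 + u 5 * y 5) / (u 4 ^ 2 + u 5 ^ 2)) • u +
        ((u 4 * y 5 - u 5 * y 4) / (u 4 ^ 2 + u 5 ^ 2)) • J₀ u := by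
      ext <;> simp [J₀, *] <;> field_simp <;> ring
    rw [e]
    exact add_mem (𝔟.smul_mem _ hu) (𝔟.smul_mem _ (hJ u hu))

end LieAlgH7

/-! ### The height dichotomy and rationality of 𝔣 -/

namespace Nilmanifold

open H7 LieAlgH7

/-- The fourth coordinates of the central elements of the lattice `logLattice Γ`. -/
def heightGroup (Γ : Subgroup H7) : AddSubgroup ℝ where
  carrier := {t | ∃ x ∈ logLattice Γ, x 0 = 0 ∧ x 1 = 0 ∧ x 2 = 0 ∧ x 3 = t}
  zero_mem' := ⟨0, zero_mem _, by simp⟩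
  add_mem' := by
    rintro _ _ ⟨x, hx, hx0, hx1, hx2, rfl⟩ ⟨y, hy, hy0, hy1, hy2, rfl⟩
    exact ⟨x + y, add_mem hx hy, by simp [*]⟩
  neg_mem' := by
    rintro _ ⟨x, hx, hx0, hx1, hx2, rfl⟩
    exact ⟨-x, neg_mem hx, by simp [*]⟩

variable (Γ : Subgroup H7)

theorem bracket_apply_mem_heightGroup {x y : LieAlgH7} (hx : x ∈ logLattice Γ)
    (hy : y ∈ logLattice Γ) : x 0 * y 1 - x 1 * y 0 ∈ heightGroup Γ := by
  have : -(x 0 * y 1 - x 1 * y 0) ∈ heightGroup Γ :=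
    ⟨_, bracket_mem_logLattice Γ hx hy, rfl, rfl, rfl, rfl⟩
  simpa using neg_mem this

/-- All determinants of projections of lattice vectors to ⟨e₁, e₂⟩ are integral multiples of a.
Fixing g, h with non-zero determinant ma, Cramer's rule turns every lattice vector x into an
integral combination mx − kg − lh lying in 𝔣. So 𝔥₇ is spanned by g, h and lattice vectors of 𝔣. -/
theorem isRational_𝔣_of_heightGroup_eq_closure [CompactSpace (Nilmanifold Γ)] {a : ℝ}
    (ha : heightGroup Γ = AddSubgroup.closure {a}) : IsRational Γ 𝔣 := by
  obtain ⟨g, hg, h, hh, hne⟩ : ∃ g ∈ logLattice Γ, ∃ h ∈ logLattice Γ,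
      g 0 * h 1 - g 1 * h 0 ≠ 0 := by
    by_contra! hall
    -- If all determinants vanished, no bracket of vectors in the real span would have an
    -- e₄-component, contrary to [e₁, e₂] = −e₄.
    obtain ⟨x, hx, hx0, hx1, -⟩ := exists_mem_span_of_compactSpace Γ ![1, 0, 0]
    obtain ⟨y, hy, hy0, hy1, -⟩ := exists_mem_span_of_compactSpace Γ ![0, 1, 0]
    have := bracket_mem_span_of_forall Γ (S := LinearMap.ker (coordL 3)) (fun x hx y hy => by
      have := hall x hx y hy
      simp only [SetLike.mem_coe, LinearMap.mem_ker, coordL_apply, bracket_def, ofCoords_apply]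
      simp [this]) hx hy
    rw [Submodule.span_eq, LinearMap.mem_ker] at this
    simp [bracket_def, hx0, hx1, hy0, hy1] at this
  have hint : ∀ x ∈ logLattice Γ, ∀ y ∈ logLattice Γ, ∃ n : ℤ, x 0 * y 1 - x 1 * y 0 = n * a := by
    intro x hx y hy
    have := bracket_apply_mem_heightGroup Γ hx hy
    rw [ha, AddSubgroup.mem_closure_singleton] at this
    obtain ⟨n, hn⟩ := this
    exact ⟨n, by rw [← hn, zsmul_eq_mul]⟩
  obtain ⟨m, hm⟩ := hint g hg h hh
  have ha0 : a ≠ 0 := by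
    rintro rfl
    exact hne (by rw [hm, mul_zero])
  have hm0 : (m : ℝ) ≠ 0 := by
    intro h0
    exact hne (by rw [hm, h0, zero_mul])
  set S := Submodule.span ℝ ((logLattice Γ : Set LieAlgH7) ∩ (𝔣 : Set LieAlgH7))
  have hdecomp : ∀ x : LieAlgH7, ∃ s ∈ S, ∃ c d : ℝ, x = s + c • g + d • h := by
    intro x
    have hx : x ∈ Submodule.span ℝ (logLattice Γ : Set LieAlgH7) := by
      rw [span_logLattice]; trivial
    have hle : Submodule.span ℝ (logLattice Γ : Set LieAlgH7) ≤ S ⊔ Submodule.span ℝ {g, h} := by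
      rw [Submodule.span_le]
      intro x hx
      obtain ⟨k, hk⟩ := hint x hx h hh
      obtain ⟨l, hl⟩ := hint g hg x hx
      have hy : m • x - k • g - l • h ∈ S := by
        refine Submodule.subset_span ⟨sub_mem (sub_mem (zsmul_mem hx _) (zsmul_mem hg _))
          (zsmul_mem hh _), ?_⟩
        have key : ∀ i : Fin 6, (i = 0 ∨ i = 1) → (m • x - k • g - l • h) i = 0 := by
          intro i hi
          rw [LieAlgH7.sub_apply, LieAlgH7.sub_apply, zsmul_apply, zsmul_apply, zsmul_apply]
          apply (mul_eq_zero.1 (_ : (_ : ℝ) * a = 0)).resolve_right ha0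
          rcases hi with rfl | rfl
          · linear_combination (-x 0) * hm + g 0 * hk + h 0 * hl
          · linear_combination (-x 1) * hm + g 1 * hk + h 1 * hl
        exact ⟨key 0 (Or.inl rfl), key 1 (Or.inr rfl)⟩
      have e : x = (m : ℝ)⁻¹ • (m • x - k • g - l • h) +
          (((m : ℝ)⁻¹ * k) • g + ((m : ℝ)⁻¹ * l) • h) := by
        ext <;> simp <;> field_simp <;> ring
      rw [e]
      exact Submodule.add_mem_sup (S.smul_mem _ hy) (Submodule.mem_span_pair.2 ⟨_, _, rfl⟩)
    obtain ⟨s, hs, t, ht, e⟩ := Submodule.mem_sup.1 (hle hx)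
    obtain ⟨c, d, rfl⟩ := Submodule.mem_span_pair.1 ht
    exact ⟨s, hs, c, d, by rw [add_assoc, e]⟩
  have hS : S ≤ 𝔣.toSubmodule := Submodule.span_le.2 Set.inter_subset_right
  rw [isRational_iff]
  refine le_antisymm hS fun x hx => ?_
  obtain ⟨s, hs, c, d, rfl⟩ := hdecomp x
  obtain ⟨hs0, hs1⟩ := hS hs
  obtain ⟨hx0, hx1⟩ := hx
  simp only [LieAlgH7.add_apply, LieAlgH7.smul_apply, hs0, hs1, zero_add] at hx0 hx1
  -- The projections of g and h are linearly independent, so a vector of 𝔣 has no g- or h-component.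
  have hc : c = 0 := by
    apply (mul_eq_zero.1 (_ : c * (g 0 * h 1 - g 1 * h 0) = 0)).resolve_right hne
    linear_combination h 1 * hx0 - h 0 * hx1
  have hd : d = 0 := by
    apply (mul_eq_zero.1 (_ : d * (g 0 * h 1 - g 1 * h 0) = 0)).resolve_right hne
    linear_combination g 0 * hx1 - g 1 * hx0
  simpa [hc, hd] using hs

theorem dense_heightGroup [CompactSpace (Nilmanifold Γ)] (h : ¬ IsRational Γ 𝔣) :
    Dense (heightGroup Γ : Set ℝ) :=
  (AddSubgroup.dense_or_cyclic (heightGroup Γ)).resolve_right fun ⟨_, ha⟩ =>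
    h (isRational_𝔣_of_heightGroup_eq_closure Γ ha)

theorem isRational_𝔣_of_exists [DiscreteTopology Γ] [CompactSpace (Nilmanifold Γ)]
    {𝔟 : LieIdeal ℝ LieAlgH7} (hbot : 𝔟 ≠ ⊥) (htop : 𝔟 ≠ ⊤) (hJ : IsJ₀Invariant 𝔟)
    (hrat : IsRational Γ 𝔟) : IsRational Γ 𝔣 := by
  rcases eq_𝔣_or_of_isJ₀Invariant hJ hbot htop with rfl | h𝔟
  · exact hrat
  by_contra hnot
  have hdense := dense_heightGroup Γ hnot
  let f : LieAlgH7 →ₗ[ℝ] (Fin 4 → ℝ) := LinearMap.pi ![coordL 0, coordL 1, coordL 2, coordL 3]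
  have hker : LinearMap.ker f = 𝔟.toSubmodule := by
    ext x
    change _ ↔ x ∈ 𝔟
    rw [h𝔟, LinearMap.mem_ker, funext_iff, Fin.forall_fin_succ, Fin.forall_fin_succ,
      Fin.forall_fin_succ, Fin.forall_fin_succ]
    simp [f]
  -- Rationality of ⟨e₅, e₆⟩ makes the image of the lattice in the quotient discrete, whereas dense
  -- heights give arbitrarily short non-zero images (0, 0, 0, t).
  obtain ⟨ε, hε, hgap⟩ := DiscreteSubgroup.exists_gap_map (logLattice Γ) f (by
    rw [hker]
    exact ((isRational_iff Γ 𝔟).1 hrat).ge)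
  obtain ⟨t, ⟨x, hx, hx0, hx1, hx2, rfl⟩, ht0, htε⟩ := hdense.exists_between hε
  have hfx : f x = ![0, 0, 0, x 3] := by
    funext i
    fin_cases i <;> simp [f, hx0, hx1, hx2]
  have h0 := hgap x hx (by
    rw [hfx, pi_norm_lt_iff hε]
    intro i
    fin_cases i <;> simp [hε, abs_of_pos ht0, htε])
  have := congrFun h0 3
  rw [hfx] at this
  simp at this
  exact ht0.ne' this

end Nilmanifold

/-! ### The period groups of the base and of the leaf -/

namespace Nilmanifold

open H7 LieAlgH7

/-- The inclusion of `𝔣 = ℂ²` into `𝔥₇`. -/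
def fibreInclusion : (Fin 2 → ℂ) →ₗ[ℝ] LieAlgH7 where
  toFun w := (expFibre w).log
  map_add' w w' := by ext <;> simp [expFibre]
  map_smul' c w := by ext <;> simp [expFibre]

/-- The projection of `𝔥₇` onto `𝔣 = ℂ²` along `⟨e₁, e₂⟩`. -/
def fibreProjection : LieAlgH7 →ₗ[ℝ] (Fin 2 → ℂ) where
  toFun x := ![⟨x 2, x 3⟩, ⟨x 4, x 5⟩]
  map_add' x y := by funext i; fin_cases i <;> apply Complex.ext <;> simp
  map_smul' c x := by funext i; fin_cases i <;> apply Complex.ext <;> simp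

theorem fibreProjection_fibreInclusion (w : Fin 2 → ℂ) :
    fibreProjection (fibreInclusion w) = w := by
  funext i
  fin_cases i <;> apply Complex.ext <;> simp [fibreProjection, fibreInclusion, expFibre]

theorem fibreInclusion_fibreProjection {x : LieAlgH7} (hx : x ∈ 𝔣) :
    fibreInclusion (fibreProjection x) = x := by
  ext <;> simp [fibreProjection, fibreInclusion, expFibre, hx.1, hx.2]

theorem fibreInclusion_mem_𝔣 (w : Fin 2 → ℂ) : fibreInclusion w ∈ 𝔣 := ⟨rfl, rfl⟩

/-- The projection `𝔥₇ → 𝔥₇ / 𝔣 = ℂ`. -/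
def baseProjection : LieAlgH7 →ₗ[ℝ] ℂ where
  toFun x := ⟨x 0, x 1⟩
  map_add' x y := by apply Complex.ext <;> simp
  map_smul' c x := by apply Complex.ext <;> simp

variable (Γ : Subgroup H7)

theorem two_nsmul_fibreProjection_mem {x : LieAlgH7} (hx : x ∈ logLattice Γ) (hx' : x ∈ 𝔣) :
    2 • fibreProjection x ∈ fibrePeriods Γ := by
  change exp (fibreInclusion (2 • fibreProjection x)) ∈ Γ
  rw [map_nsmul, fibreInclusion_fibreProjection hx']
  exact exp_two_nsmul_mem Γ hx

theorem fibreProjection_mem_span {x : LieAlgH7} (hx : x ∈ logLattice Γ) (hx' : x ∈ 𝔣) :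
    fibreProjection x ∈ Submodule.span ℝ (fibrePeriods Γ : Set (Fin 2 → ℂ)) := by
  have := Submodule.smul_mem _ (2⁻¹ : ℝ)
    (Submodule.subset_span (R := ℝ) (two_nsmul_fibreProjection_mem Γ hx hx'))
  rwa [← Nat.cast_smul_eq_nsmul ℝ, smul_smul, Nat.cast_ofNat, inv_mul_cancel₀ two_ne_zero,
    one_smul] at this

/-- The groups `logLattice Γ` ∩ 𝔣 and Γ ∩ 𝔣 have the same real span, since twice the former lies in
the latter. -/
theorem isRational_𝔣_iff : IsRational Γ 𝔣 ↔
    Submodule.span ℝ (fibrePeriods Γ : Set (Fin 2 → ℂ)) = ⊤ := by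
  rw [isRational_iff]
  constructor
  · intro h
    rw [eq_top_iff]
    rintro w -
    rw [← fibreProjection_fibreInclusion w]
    have hw : fibreInclusion w ∈ 𝔣.toSubmodule := fibreInclusion_mem_𝔣 w
    rw [← h] at hw
    have := Submodule.mem_map_of_mem (f := fibreProjection) hw
    rw [Submodule.map_span] at this
    refine Submodule.span_le.2 ?_ this
    rintro _ ⟨x, ⟨hx, hx'⟩, rfl⟩
    exact fibreProjection_mem_span Γ hx hx'
  · intro h
    refine le_antisymm (Submodule.span_le.2 Set.inter_subset_right) fun x hx => ?_
    rw [← fibreInclusion_fibreProjection hx]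
    have hw : fibreProjection x ∈ (⊤ : Submodule ℝ (Fin 2 → ℂ)) := trivial
    rw [← h] at hw
    have := Submodule.mem_map_of_mem (f := fibreInclusion) hw
    rw [Submodule.map_span] at this
    refine Submodule.span_mono ?_ this
    rintro _ ⟨w, hw, rfl⟩
    exact ⟨log_mem_logLattice Γ hw, fibreInclusion_mem_𝔣 w⟩

theorem baseProjection_mem_basePeriods {x : LieAlgH7} (hx : x ∈ logLattice Γ) :
    baseProjection x ∈ basePeriods Γ := by
  have : logLattice Γ ≤ (basePeriods Γ).comap baseProjection.toAddMonoidHom := by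
    rw [logLattice, AddSubgroup.closure_le]
    rintro _ ⟨g, hg, rfl⟩
    exact ⟨g, hg, rfl⟩
  exact this hx

theorem span_basePeriods [CompactSpace (Nilmanifold Γ)] :
    Submodule.span ℝ (basePeriods Γ : Set ℂ) = ⊤ := by
  rw [eq_top_iff]
  rintro z -
  obtain ⟨x, hx, hx0, hx1, -⟩ := exists_mem_span_of_compactSpace Γ ![z.re, z.im, 0]
  have hz : baseProjection x = z := Complex.ext hx0 hx1
  rw [← hz]
  have := Submodule.mem_map_of_mem (f := baseProjection) hx
  rw [Submodule.map_span] at this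
  refine Submodule.span_mono ?_ this
  rintro _ ⟨y, hy, rfl⟩
  exact baseProjection_mem_basePeriods Γ hy

/-- The projection to ℂ has kernel 𝔣, so rationality of the kernel gives discreteness of the image.
-/
theorem discreteTopology_basePeriods [DiscreteTopology Γ] (h : IsRational Γ 𝔣) :
    DiscreteTopology (basePeriods Γ) := by
  have hker : LinearMap.ker baseProjection = 𝔣.toSubmodule := by
    ext x
    exact Complex.ext_iff
  obtain ⟨ε, hε, hgap⟩ := DiscreteSubgroup.exists_gap_map (logLattice Γ) baseProjection (by
    rw [hker]
    exact ((isRational_iff Γ 𝔣).1 h).ge)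
  refine DiscreteSubgroup.of_gap _ hε ?_
  rintro _ ⟨g, hg, rfl⟩ hn
  exact hgap _ (log_mem_logLattice Γ hg) hn

/-! ### Leaves for non-rational 𝔣: non-compact and toroidal -/

theorem not_compactSpace_leaf (h : ¬ IsRational Γ 𝔣) :
    ¬ CompactSpace ((Fin 2 → ℂ) ⧸ fibrePeriods Γ) := fun _ =>
  h ((isRational_𝔣_iff Γ).2 (DiscreteSubgroup.span_eq_top_of_compactSpace_quotient _))

/-- The real hyperplane Re z₁ = 0 of 𝔣 is the centre of 𝔥₇, which is spanned by commutators of Γ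
whether or not 𝔣 is rational. -/
theorem mem_span_fibrePeriods [CompactSpace (Nilmanifold Γ)] {w : Fin 2 → ℂ} (hw : (w 0).re = 0) :
    w ∈ Submodule.span ℝ (fibrePeriods Γ : Set (Fin 2 → ℂ)) := by
  rw [← fibreProjection_fibreInclusion w]
  have := Submodule.mem_map_of_mem (f := fibreProjection)
    (mem_span_brackets Γ (z := fibreInclusion w) rfl rfl (by simpa [fibreInclusion, expFibre]))
  rw [Submodule.map_span] at this
  refine Submodule.span_mono ?_ this
  rintro _ ⟨_, ⟨g, hg, h, hh, rfl⟩, rfl⟩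
  change exp (fibreInclusion _) ∈ Γ
  rw [fibreInclusion_fibreProjection ⟨rfl, rfl⟩]
  exact exp_bracket_log_mem Γ hg hh

/-- An entire function on `ℂ²` that is periodic with respect to the periods of a leaf is constant
if the fourth coordinates of the central periods are dense. -/
theorem eq_const_of_periodic [CompactSpace (Nilmanifold Γ)]
    (hdense : Dense (heightGroup Γ : Set ℝ)) {F : (Fin 2 → ℂ) → ℂ} (hF : Differentiable ℂ F)
    (hper : ∀ w, ∀ l ∈ fibrePeriods Γ, F (w + l) = F w) (w : Fin 2 → ℂ) : F w = F 0 := by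
  obtain ⟨C, hC⟩ := DiscreteSubgroup.exists_near_of_mem_span (fibrePeriods Γ)
  obtain ⟨B, hB⟩ := (isCompact_closedBall (0 : Fin 2 → ℂ) C).exists_bound_of_continuousOn
    hF.continuous.continuousOn
  -- Translation by periods moves every point of the centre into a fixed compact ball.
  have hbound : ∀ w : Fin 2 → ℂ, (w 0).re = 0 → ‖F w‖ ≤ B := by
    intro w hw
    obtain ⟨l, hl, hn⟩ := hC w (mem_span_fibrePeriods Γ hw)
    rw [← sub_add_cancel w l, hper _ l hl]
    exact hB _ (by simpa using hn)
  -- The complex line {it} × ℂ lies in the centre, so Liouville's theorem applies.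
  have hline : ∀ t : ℝ, ∀ v v' : ℂ, F ![t * Complex.I, v] = F ![t * Complex.I, v'] := by
    intro t v v'
    have hd : Differentiable ℂ fun v : ℂ => F ![t * Complex.I, v] := by
      refine hF.comp (differentiable_pi.2 fun i => ?_)
      fin_cases i <;> simp
    refine hd.apply_eq_apply_of_bounded 
      (isBounded_iff_forall_norm_le.2 ⟨B, Set.forall_mem_range.2 fun v => ?_⟩) v v'
    exact hbound _ (by simp)
  -- For a height t, some point of the line z₁ = 2ti is a period, and F is constant on that line.
  -- The factor 2 appears because a lattice vector is only known to give a period after doubling.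
  have hzero : ∀ t : ℝ, F ![t * Complex.I, 0] = F 0 := by
    have hcont : Continuous fun t : ℝ => F ![(2 * t : ℝ) * Complex.I, 0] := by
      refine hF.continuous.comp (continuous_pi fun i => ?_)
      fin_cases i <;> simp <;> fun_prop
    have hmem : ∀ t ∈ (heightGroup Γ : Set ℝ), F ![(2 * t : ℝ) * Complex.I, 0] = F 0 := by
      rintro _ ⟨x, hx, hx0, hx1, hx2, rfl⟩
      have hl := two_nsmul_fibreProjection_mem Γ hx ⟨hx0, hx1⟩
      rw [← hper 0 _ hl, hline _ 0 (2 * ⟨x 4, x 5⟩ : ℂ)]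
      congr 1
      funext i
      fin_cases i <;> apply Complex.ext <;> simp [fibreProjection, hx2]
    have hall := hcont.ext_on hdense continuous_const hmem
    intro t
    have := congrFun hall (t / 2)
    simpa [mul_div_cancel₀] using this
  have key : ∀ v z : ℂ, F ![z, v] = F 0 := by
    intro v
    have hd : Differentiable ℂ fun z : ℂ => F ![z, v] := by
      refine hF.comp (differentiable_pi.2 fun i => ?_)
      fin_cases i <;> simp
    have han : AnalyticOnNhd ℂ (fun z : ℂ => F ![z, v]) Set.univ :=
      fun z _ => hd.analyticAt z
    have hconst : AnalyticOnNhd ℂ (fun _ : ℂ => F 0) Set.univ := fun _ _ => analyticAt_const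
    have hI : ∀ t : ℝ, F ![t * Complex.I, v] = F 0 := fun t => by rw [hline t v 0, hzero]
    -- The imaginary axis accumulates at 0, which suffices for the identity theorem.
    have hfreq : ∃ᶠ z in 𝓝[≠] (0 : ℂ), F ![z, v] = F 0 := by
      have ht : Filter.Tendsto (fun t : ℝ => (t : ℂ) * Complex.I) (𝓝[≠] 0) (𝓝[≠] 0) := by
        refine tendsto_nhdsWithin_iff.2 ⟨?_, ?_⟩
        · have : Continuous fun t : ℝ => (t : ℂ) * Complex.I := by fun_prop
          exact (this.tendsto' 0 0 (by simp)).mono_left nhdsWithin_le_nhds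
        · filter_upwards [self_mem_nhdsWithin] with t ht
          simpa using ht
      exact ht.frequently (Filter.Eventually.of_forall hI).frequently
    exact fun z => congrFun (han.eq_of_frequently_eq hconst hfreq) z
  have hw : w = ![w 0, w 1] := by
    funext i
    fin_cases i <;> rfl
  rw [hw, key]

theorem isToroidalGroup_leaf [DiscreteTopology Γ] [CompactSpace (Nilmanifold Γ)]
    (h : ¬ IsRational Γ 𝔣) :
    IsToroidalGroup (Fin 2 → ℂ) ((Fin 2 → ℂ) ⧸ fibrePeriods Γ) := by
  intro f hf
  have hF : Differentiable ℂ fun w : Fin 2 → ℂ => f (QuotientAddGroup.mk w) :=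
    (hf.comp ((contMDiff_quotientMk (fibrePeriods Γ) ℂ).mdifferentiable (by simp))).differentiable
  refine ⟨f (QuotientAddGroup.mk 0), fun y => ?_⟩
  obtain ⟨w, rfl⟩ := QuotientAddGroup.mk_surjective y
  refine eq_const_of_periodic Γ (dense_heightGroup Γ h) hF (fun w l hl => ?_) w
  rw [QuotientAddGroup.mk_add, (QuotientAddGroup.eq_zero_iff l).2 hl, add_zero]

end Nilmanifold

/-! ### Smooth maps out of quotient manifolds -/

/-- The manifold `Y` has the local inverses of `p : E → Y` as charts, and any two points in a fibre
of `p` are related by a smooth deck transformation. -/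
structure IsQuotientManifold (𝕜 : Type*) {E Y : Type*} [NontriviallyNormedField 𝕜]
    [NormedAddCommGroup E] [NormedSpace 𝕜 E] [TopologicalSpace Y] [ChartedSpace E Y]
    (p : E → Y) : Prop where
  isLocalHomeomorph : IsLocalHomeomorph p
  surjective : Function.Surjective p
  chartAt_symm : ∀ y, ⇑(chartAt E y).symm = p
  exists_deck : ∀ x x', p x = p x' → ∃ g : E → E, ContDiff 𝕜 ω g ∧ g x = x' ∧ ∀ y, p (g y) = p y

namespace IsQuotientManifold

variable {𝕜 E Y : Type*} [NontriviallyNormedField 𝕜] [NormedAddCommGroup E] [NormedSpace 𝕜 E]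
  [TopologicalSpace Y] [ChartedSpace E Y] {p : E → Y}

theorem proj_chartAt (h : IsQuotientManifold 𝕜 p) (y : Y) :
    ∀ᶠ z in 𝓝 y, p (chartAt E y z) = z := by
  filter_upwards [(chartAt E y).open_source.mem_nhds (mem_chart_source E y)] with z hz
  rw [← h.chartAt_symm y, (chartAt E y).left_inv hz]

variable [IsManifold 𝓘(𝕜, E) ω Y]

theorem contMDiff (h : IsQuotientManifold 𝕜 p) : ContMDiff 𝓘(𝕜, E) 𝓘(𝕜, E) ω p := by
  intro x
  -- The chart inverts p on one sheet, which need not contain x; a deck transformation moves x to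
  -- that sheet.
  obtain ⟨g, hg, hgx, hgp⟩ := h.exists_deck x (chartAt E (p x) (p x))
    (h.proj_chartAt (p x)).self_of_nhds.symm
  have h1 : ContMDiffAt 𝓘(𝕜, E) 𝓘(𝕜, E) ω p (g x) := by
    rw [hgx]
    have := (chartAt E (p x)).open_target.mem_nhds
      ((chartAt E (p x)).map_source (mem_chart_source E (p x)))
    refine ContMDiffOn.contMDiffAt (s := (chartAt E (p x)).target) ?_ this
    have h2 := contMDiffOn_chart_symm (I := 𝓘(𝕜, E)) (n := ω) (x := p x)
    rwa [h.chartAt_symm (p x)] at h2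
  refine (ContMDiffAt.comp x h1 hg.contMDiff.contMDiffAt).congr_of_eventuallyEq
    (Filter.Eventually.of_forall fun y => ?_)
  exact (hgp y).symm

/-- Composing the chart with a deck transformation gives a local inverse of p through the prescribed
point x. It reduces smoothness and differentials downstairs to computations in E. -/
theorem exists_section (h : IsQuotientManifold 𝕜 p) (x : E) :
    ∃ s : Y → E, s (p x) = x ∧ ContMDiffAt 𝓘(𝕜, E) 𝓘(𝕜, E) ω s (p x) ∧
      (∀ᶠ y in 𝓝 (p x), p (s y) = y) ∧ ∀ᶠ z in 𝓝 x, s (p z) = z := by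
  obtain ⟨g, hg, hgx, hgp⟩ := h.exists_deck (chartAt E (p x) (p x)) x
    (h.proj_chartAt (p x)).self_of_nhds
  have hs : ContMDiffAt 𝓘(𝕜, E) 𝓘(𝕜, E) ω (fun y => g (chartAt E (p x) y)) (p x) :=
    ContMDiffAt.comp (p x) hg.contMDiff.contMDiffAt
      (contMDiffOn_chart.contMDiffAt ((chartAt E (p x)).open_source.mem_nhds
        (mem_chart_source E (p x))))
  have hps : ∀ᶠ y in 𝓝 (p x), p (g (chartAt E (p x) y)) = y := by
    filter_upwards [h.proj_chartAt (p x)] with y hy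
    rw [hgp, hy]
  refine ⟨fun y => g (chartAt E (p x) y), hgx, hs, hps, ?_⟩
  -- s ∘ p = id near x because both sides have the same image under p and both lie where p is
  -- injective.
  obtain ⟨e, hxe, rfl⟩ := h.isLocalHomeomorph x
  have hp : Filter.Tendsto e (𝓝 x) (𝓝 (e x)) := h.isLocalHomeomorph.continuous.continuousAt
  have hcont : Filter.Tendsto (fun z => g (chartAt E (e x) (e z))) (𝓝 x) (𝓝 x) := by
    have := hs.continuousAt.tendsto.comp hp
    simpa only [Function.comp_def, hgx] using this
  filter_upwards [hp.eventually hps, e.open_source.mem_nhds hxe,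
    hcont.eventually (e.open_source.mem_nhds hxe)] with z h1 h2 h3
  exact e.injOn h3 h2 h1

theorem contMDiffAt_of_comp (h : IsQuotientManifold 𝕜 p) {F H Z : Type*} [NormedAddCommGroup F]
    [NormedSpace 𝕜 F] [TopologicalSpace H] {I : ModelWithCorners 𝕜 F H} [TopologicalSpace Z]
    [ChartedSpace H Z] {n : ℕ∞ω} {f : Y → Z} {x : E}
    (hf : ContMDiffAt 𝓘(𝕜, E) I n (f ∘ p) x) : ContMDiffAt 𝓘(𝕜, E) I n f (p x) := by
  obtain ⟨s, hsx, hs, hps, -⟩ := h.exists_section x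
  rw [← hsx] at hf
  refine (ContMDiffAt.comp (p x) hf (hs.of_le le_top)).congr_of_eventuallyEq ?_
  filter_upwards [hps] with y hy
  simp [hy]

theorem contMDiff_of_comp (h : IsQuotientManifold 𝕜 p) {F H Z : Type*} [NormedAddCommGroup F]
    [NormedSpace 𝕜 F] [TopologicalSpace H] {I : ModelWithCorners 𝕜 F H} [TopologicalSpace Z]
    [ChartedSpace H Z] {n : ℕ∞ω} {f : Y → Z}
    (hf : ContMDiff 𝓘(𝕜, E) I n (f ∘ p)) : ContMDiff 𝓘(𝕜, E) I n f := by
  intro y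
  obtain ⟨x, rfl⟩ := h.surjective y
  exact h.contMDiffAt_of_comp (hf x)

theorem mfderiv_bijective (h : IsQuotientManifold 𝕜 p) (x : E) :
    Function.Bijective (mfderiv 𝓘(𝕜, E) 𝓘(𝕜, E) p x) := by
  obtain ⟨s, hsx, hs, hps, hsp⟩ := h.exists_section x
  have hdp : MDifferentiableAt 𝓘(𝕜, E) 𝓘(𝕜, E) p x := (h.contMDiff x).mdifferentiableAt (by simp)
  have hds : MDifferentiableAt 𝓘(𝕜, E) 𝓘(𝕜, E) s (p x) := hs.mdifferentiableAt (by simp)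
  constructor
  · have h1 : HasMFDerivAt 𝓘(𝕜, E) 𝓘(𝕜, E) (s ∘ p) x (ContinuousLinearMap.id 𝕜 E) :=
      (hasMFDerivAt_id x).congr_of_eventuallyEq hsp
    have h2 := hasMFDerivAt_unique (hds.hasMFDerivAt.comp x hdp.hasMFDerivAt) h1
    exact Function.LeftInverse.injective fun v => DFunLike.congr_fun h2 v
  · have hdp' : HasMFDerivAt 𝓘(𝕜, E) 𝓘(𝕜, E) p (s (p x)) (mfderiv 𝓘(𝕜, E) 𝓘(𝕜, E) p x) := by
      rw [hsx]; exact hdp.hasMFDerivAt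
    have h1 : HasMFDerivAt 𝓘(𝕜, E) 𝓘(𝕜, E) (p ∘ s) (p x) (ContinuousLinearMap.id 𝕜 E) :=
      (hasMFDerivAt_id (p x)).congr_of_eventuallyEq hps
    have h2 := hasMFDerivAt_unique (hdp'.comp (p x) hds.hasMFDerivAt) h1
    exact Function.RightInverse.surjective fun v => DFunLike.congr_fun h2 v

/-- For a map `f` between quotient manifolds with lift `F`, the differentials of `f` are as
injective as those of `F`. -/
theorem mfderiv_injective_of_lift (h : IsQuotientManifold 𝕜 p) {E' Y' : Type*}
    [NormedAddCommGroup E'] [NormedSpace 𝕜 E'] [TopologicalSpace Y'] [ChartedSpace E' Y']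
    [IsManifold 𝓘(𝕜, E') ω Y'] {p' : E' → Y'} (h' : IsQuotientManifold 𝕜 p') {f : Y → Y'}
    {F : E → E'} (hF : Differentiable 𝕜 F) (hf : MDifferentiable 𝓘(𝕜, E) 𝓘(𝕜, E') f)
    (hlift : ∀ x, f (p x) = p' (F x)) {x : E} (hinj : Function.Injective (fderiv 𝕜 F x)) :
    Function.Injective (mfderiv 𝓘(𝕜, E) 𝓘(𝕜, E') f (p x)) := by
  have hdp := h.contMDiff.mdifferentiable (by simp) x
  have hdp' := h'.contMDiff.mdifferentiable (by simp) (F x)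
  have e1 : mfderiv 𝓘(𝕜, E) 𝓘(𝕜, E') (f ∘ p) x = _ := mfderiv_comp x (hf (p x)) hdp
  have e2 : mfderiv 𝓘(𝕜, E) 𝓘(𝕜, E') (p' ∘ F) x = _ :=
    mfderiv_comp x hdp' (hF x).mdifferentiableAt
  rw [show f ∘ p = p' ∘ F from funext hlift, e2, mfderiv_eq_fderiv] at e1
  intro v v' hv
  obtain ⟨u, rfl⟩ := (h.mfderiv_bijective x).2 v
  obtain ⟨u', rfl⟩ := (h.mfderiv_bijective x).2 v'
  have hu : mfderiv 𝓘(𝕜, E') 𝓘(𝕜, E') p' (F x) (fderiv 𝕜 F x u) =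
      mfderiv 𝓘(𝕜, E') 𝓘(𝕜, E') p' (F x) (fderiv 𝕜 F x u') :=
    ((DFunLike.congr_fun e1 u).trans hv).trans (DFunLike.congr_fun e1 u').symm
  exact congrArg _ (hinj ((h'.mfderiv_bijective (F x)).1 hu))

/-- For a map `f` between quotient manifolds with lift `F`, the differentials of `f` are as
surjective as those of `F`. -/
theorem mfderiv_surjective_of_lift (h : IsQuotientManifold 𝕜 p) {E' Y' : Type*}
    [NormedAddCommGroup E'] [NormedSpace 𝕜 E'] [TopologicalSpace Y'] [ChartedSpace E' Y']
    [IsManifold 𝓘(𝕜, E') ω Y'] {p' : E' → Y'} (h' : IsQuotientManifold 𝕜 p') {f : Y → Y'}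
    {F : E → E'} (hF : Differentiable 𝕜 F) (hf : MDifferentiable 𝓘(𝕜, E) 𝓘(𝕜, E') f)
    (hlift : ∀ x, f (p x) = p' (F x)) {x : E} (hsurj : Function.Surjective (fderiv 𝕜 F x)) :
    Function.Surjective (mfderiv 𝓘(𝕜, E) 𝓘(𝕜, E') f (p x)) := by
  have hdp := h.contMDiff.mdifferentiable (by simp) x
  have hdp' := h'.contMDiff.mdifferentiable (by simp) (F x)
  have e1 : mfderiv 𝓘(𝕜, E) 𝓘(𝕜, E') (f ∘ p) x = _ := mfderiv_comp x (hf (p x)) hdp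
  have e2 : mfderiv 𝓘(𝕜, E) 𝓘(𝕜, E') (p' ∘ F) x = _ :=
    mfderiv_comp x hdp' (hF x).mdifferentiableAt
  rw [show f ∘ p = p' ∘ F from funext hlift, e2, mfderiv_eq_fderiv] at e1
  intro v
  -- The base points f (p x) and p' (F x) are only propositionally equal, hence the cast; both
  -- tangent spaces unfold to E'.
  obtain ⟨w, hw⟩ := (h'.mfderiv_bijective (F x)).2 ((congrArg (TangentSpace 𝓘(𝕜, E')) (hlift x)).mp v)
  obtain ⟨u, rfl⟩ := hsurj w
  exact ⟨mfderiv 𝓘(𝕜, E) 𝓘(𝕜, E) p x u, (DFunLike.congr_fun e1 u).symm.trans hw⟩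

end IsQuotientManifold

theorem isQuotientManifold_quotientMk (𝕜 : Type*) {V : Type*} [NontriviallyNormedField 𝕜]
    [NormedAddCommGroup V] [NormedSpace 𝕜 V] (L : AddSubgroup V) [DiscreteTopology L] :
    IsQuotientManifold 𝕜 (QuotientAddGroup.mk : V → V ⧸ L) where
  isLocalHomeomorph := isLocalHomeomorph_quotientMk L
  surjective := QuotientAddGroup.mk_surjective
  chartAt_symm y := by
    change ⇑(((isLocalHomeomorph_quotientMk L).localInverseAt _).trans (chartAt V _)).symm = _
    rw [OpenPartialHomeomorph.coe_trans_symm, chartAt_self_eq]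
    simp
  exists_deck x x' h := by
    refine ⟨fun y => y + (x' - x), by fun_prop, by simp, fun y => ?_⟩
    have : (QuotientAddGroup.mk (x' - x) : V ⧸ L) = 0 := by
      rw [QuotientAddGroup.mk_sub, h, sub_self]
    rw [QuotientAddGroup.mk_add, this, add_zero]

/-! ### The nilmanifold as a complex and real quotient manifold -/

namespace Nilmanifold

open H7

variable (Γ : Subgroup H7) [DiscreteTopology Γ]

theorem holHomeomorph_symm_leftTranslation (g : H7) (u : Fin 3 → ℂ) :
    holHomeomorph.symm (leftTranslation g u) = g * holHomeomorph.symm u := by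
  rw [Homeomorph.symm_apply_eq]
  change _ = holCoord _
  rw [holCoord_mul]
  exact congrArg _ (holHomeomorph.apply_symm_apply u).symm

theorem isQuotientManifold_coordMk : IsQuotientManifold ℂ (coordMk Γ) where
  isLocalHomeomorph := isLocalHomeomorph_coordMk Γ
  surjective := coordMk_surjective Γ
  chartAt_symm y := by
    change ⇑(((isLocalHomeomorph_coordMk Γ).localInverseAt _).trans (chartAt _ _)).symm = _
    rw [OpenPartialHomeomorph.coe_trans_symm, chartAt_self_eq]
    simp
  exists_deck x x' h := by
    obtain ⟨γ, hγ, hx⟩ := (mk_eq_mk_iff Γ).1 h.symm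
    refine ⟨leftTranslation γ, contDiff_leftTranslation γ, ?_, fun u => ?_⟩
    · apply holHomeomorph.symm.injective
      rw [holHomeomorph_symm_leftTranslation, hx]
    · exact (mk_eq_mk_iff Γ).2 ⟨γ, hγ, (holHomeomorph_symm_leftTranslation γ u).symm⟩

theorem isQuotientManifold_real_coordMk : IsQuotientManifold ℝ (coordMk Γ) where
  isLocalHomeomorph := isLocalHomeomorph_coordMk Γ
  surjective := coordMk_surjective Γ
  chartAt_symm := (isQuotientManifold_coordMk Γ).chartAt_symm
  exists_deck x x' h :=
    let ⟨g, hg, hg'⟩ := (isQuotientManifold_coordMk Γ).exists_deck x x' h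
    ⟨g, hg.restrict_scalars ℝ, hg'⟩

instance : IsManifold 𝓘(ℝ, Fin 3 → ℂ) ω (Nilmanifold Γ) :=
  QuotientManifold.isManifold ℝ (isLocalHomeomorph_coordMk Γ) (coordMk_surjective Γ)
    (isQuotientManifold_real_coordMk Γ).exists_deck

end Nilmanifold

/-! ### The torus bundle structure -/

namespace Nilmanifold

open H7 LieAlgH7

/-- The section `z ↦ exp (Re z e₁ + Im z e₂)` of the projection `H₇ → ℂ`. -/
def baseSection (z : ℂ) : H7 := exp (ofCoords ![z.re, z.im, 0, 0, 0, 0])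

@[simp] theorem baseCoord_baseSection (z : ℂ) : baseCoord (baseSection z) = z := rfl

@[simp] theorem baseCoord_expFibre (w : Fin 2 → ℂ) : baseCoord (expFibre w) = 0 := rfl

/-- The diffeomorphism `(z, w) ↦ exp w * baseSection z` of `ℂ × ℂ²` with `H₇`, in holomorphic
coordinates of the latter. -/
noncomputable def bundleCoord (q : ℂ × (Fin 2 → ℂ)) : Fin 3 → ℂ :=
  ![q.1, q.2 0 - q.1 * star q.1 / 4,
    q.2 1 + (q.2 0 + star (q.2 0)) * q.1 / 4 + q.1 * star (q.2 0) / 4 + q.1 * q.1 * star q.1 / 16]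

/-- The inverse of `bundleCoord`. -/
noncomputable def bundleCoordInv (u : Fin 3 → ℂ) : ℂ × (Fin 2 → ℂ) :=
  (u 0, ![u 1 + u 0 * star (u 0) / 4,
    u 2 - ((u 1 + u 0 * star (u 0) / 4) + star (u 1 + u 0 * star (u 0) / 4)) * u 0 / 4
      - u 0 * star (u 1 + u 0 * star (u 0) / 4) / 4 - u 0 * u 0 * star (u 0) / 16])

theorem holCoord_expFibre_mul_baseSection (q : ℂ × (Fin 2 → ℂ)) :
    holCoord (expFibre q.2 * baseSection q.1) = bundleCoord q := by
  funext i
  fin_cases i <;> apply Complex.ext <;>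
    simp [holCoord, bundleCoord, log_mul, bracket_def, expFibre, baseSection] <;> ring

theorem bundleCoord_bundleCoordInv (u : Fin 3 → ℂ) : bundleCoord (bundleCoordInv u) = u := by
  funext i
  fin_cases i
  · rfl
  · simp only [bundleCoord, bundleCoordInv, Fin.mk_one, Matrix.cons_val_one, Matrix.cons_val_zero]
    ring
  · simp only [bundleCoord, bundleCoordInv, Fin.reduceFinMk, Matrix.cons_val_one,
      Matrix.cons_val_zero, Matrix.cons_val]
    ring

theorem contDiff_star {n : ℕ∞ω} : ContDiff ℝ n (star : ℂ → ℂ) :=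
  Complex.conjCLE.contDiff

theorem contDiff_bundleCoord : ContDiff ℝ ω bundleCoord := by
  have h0 : ContDiff ℝ ω fun q : ℂ × (Fin 2 → ℂ) => star q.1 := contDiff_star.comp contDiff_fst
  have hi : ∀ i : Fin 2, ContDiff ℝ ω fun q : ℂ × (Fin 2 → ℂ) => q.2 i := fun i => by fun_prop
  have h1 : ContDiff ℝ ω fun q : ℂ × (Fin 2 → ℂ) => star (q.2 0) := contDiff_star.comp (hi 0)
  rw [contDiff_pi]
  intro i
  fin_cases i
  · exact contDiff_fst
  · exact (hi 0).sub ((contDiff_fst.mul h0).div_const 4)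
  · exact (((hi 1).add ((((hi 0).add h1).mul contDiff_fst).div_const 4)).add
      ((contDiff_fst.mul h1).div_const 4)).add
      (((contDiff_fst.mul contDiff_fst).mul h0).div_const 16)

theorem contDiff_bundleCoordInv : ContDiff ℝ ω bundleCoordInv := by
  have hi : ∀ i : Fin 3, ContDiff ℝ ω fun u : Fin 3 → ℂ => u i := fun i => by fun_prop
  have h0 : ContDiff ℝ ω fun u : Fin 3 → ℂ => star (u 0) := contDiff_star.comp (hi 0)
  have h1 : ContDiff ℝ ω fun u : Fin 3 → ℂ => u 1 + u 0 * star (u 0) / 4 := by fun_prop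
  have h2 : ContDiff ℝ ω fun u : Fin 3 → ℂ => star (u 1 + u 0 * star (u 0) / 4) :=
    contDiff_star.comp h1
  refine (hi 0).prodMk (contDiff_pi.2 fun i => ?_)
  fin_cases i
  · exact h1
  · exact (((hi 2).sub (((h1.add h2).mul (hi 0)).div_const 4)).sub
      (((hi 0).mul h2).div_const 4)).sub ((((hi 0).mul (hi 0)).mul h0).div_const 16)

theorem exists_eq_expFibre_mul_baseSection (g : H7) :
    ∃ w, g = expFibre w * baseSection (baseCoord g) := by
  refine ⟨(bundleCoordInv (holCoord g)).2, holHomeomorph.injective ?_⟩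
  change holCoord g = holCoord _
  rw [show baseCoord g = (bundleCoordInv (holCoord g)).1 from rfl,
    holCoord_expFibre_mul_baseSection, bundleCoord_bundleCoordInv]

/-- With the fibre variable on the left, g cancels and the periods do not depend on it. This makes
the trivialisations have the constant fibre ℂ² / (Γ ∩ 𝔣). -/
theorem mk_mul_eq_mk_mul_iff (Γ : Subgroup H7) (w w' : Fin 2 → ℂ) (g : H7) :
    mk Γ (expFibre w * g) = mk Γ (expFibre w' * g) ↔
      (QuotientAddGroup.mk w : (Fin 2 → ℂ) ⧸ fibrePeriods Γ) = QuotientAddGroup.mk w' := by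
  have key : expFibre w = expFibre (w - w') * expFibre w' := by
    rw [← expFibre_add, sub_add_cancel]
  rw [mk_eq_mk_iff, eq_comm (a := (QuotientAddGroup.mk w : (Fin 2 → ℂ) ⧸ fibrePeriods Γ)),
    QuotientAddGroup.eq, neg_add_eq_sub]
  constructor
  · rintro ⟨γ, hγ, h⟩
    rw [← mul_assoc, mul_left_inj, key, mul_left_inj] at h
    change expFibre (w - w') ∈ Γ
    rwa [← h]
  · intro h
    exact ⟨_, h, by rw [← mul_assoc, ← key]⟩

variable (Γ : Subgroup H7)

theorem fibration_mk (g : H7) : fibration Γ (mk Γ g) = QuotientAddGroup.mk (baseCoord g) := rfl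

theorem fibration_coordMk (u : Fin 3 → ℂ) :
    fibration Γ (coordMk Γ u) = QuotientAddGroup.mk (u 0) := rfl

theorem coordMk_holCoord (g : H7) : coordMk Γ (holCoord g) = mk Γ g :=
  congrArg (mk Γ) (holHomeomorph.symm_apply_apply g)

theorem coordMk_bundleCoord (q : ℂ × (Fin 2 → ℂ)) :
    coordMk Γ (bundleCoord q) = mk Γ (expFibre q.2 * baseSection q.1) := by
  rw [← holCoord_expFibre_mul_baseSection, coordMk_holCoord]

/-- The periods of the fibre of the fibration through `Γ · baseSection z`. -/
def shearedPeriods (Γ : Subgroup H7) (z : ℂ) : AddSubgroup (Fin 2 → ℂ) where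
  carrier := {w | baseSection z * expFibre w * (baseSection z)⁻¹ ∈ Γ}
  zero_mem' := by
    have : expFibre 0 = 1 := by ext <;> simp [expFibre]
    simp [this]
  add_mem' := by
    intro w w' hw hw'
    have := Γ.mul_mem hw hw'
    simpa [expFibre_add, mul_assoc] using this
  neg_mem' := by
    intro w hw
    have h : expFibre (-w) = (expFibre w)⁻¹ := by ext <;> simp [expFibre]
    have := Γ.inv_mem hw
    simpa [h, mul_assoc] using this

/-- The adjoint action of `baseSection z` on `𝔣 = ℂ²`. -/
noncomputable def shear (z : ℂ) : (Fin 2 → ℂ) →ₗ[ℝ] (Fin 2 → ℂ) where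
  toFun w := ![w 0, w 1 - (w 0).re • z]
  map_add' w w' := by
    funext i
    fin_cases i <;> simp [add_smul]
    ring
  map_smul' c w := by
    funext i
    fin_cases i <;> simp
    ring

theorem shear_neg_shear (z : ℂ) (w : Fin 2 → ℂ) : shear (-z) (shear z w) = w := by
  funext i
  fin_cases i <;> simp [shear]

theorem expFibre_shear (z : ℂ) (w : Fin 2 → ℂ) :
    expFibre (shear z w) = baseSection z * expFibre w * (baseSection z)⁻¹ := by
  ext <;> simp [expFibre, shear, baseSection, log_mul, bracket_def] <;> ring

theorem mem_shearedPeriods_iff {z : ℂ} {w : Fin 2 → ℂ} :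
    w ∈ shearedPeriods Γ z ↔ shear z w ∈ fibrePeriods Γ := by
  change _ ↔ expFibre _ ∈ Γ
  rw [expFibre_shear]
  rfl

theorem span_shearedPeriods (h : Submodule.span ℝ (fibrePeriods Γ : Set (Fin 2 → ℂ)) = ⊤) (z : ℂ) :
    Submodule.span ℝ (shearedPeriods Γ z : Set (Fin 2 → ℂ)) = ⊤ := by
  rw [eq_top_iff]
  rintro w -
  have hw : shear z w ∈ (⊤ : Submodule ℝ (Fin 2 → ℂ)) := trivial
  rw [← h] at hw
  have := Submodule.mem_map_of_mem (f := shear (-z)) hw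
  rw [Submodule.map_span, shear_neg_shear] at this
  refine Submodule.span_mono ?_ this
  rintro _ ⟨v, hv, rfl⟩
  rw [SetLike.mem_coe, mem_shearedPeriods_iff]
  have := shear_neg_shear (-z) v
  rw [neg_neg] at this
  rwa [this]

/-- With the fibre variable on the right, the periods are conjugated by `baseSection z`; in exchange
the parametrisation is holomorphic. -/
theorem mk_baseSection_mul_eq_iff (z : ℂ) (w w' : Fin 2 → ℂ) :
    mk Γ (baseSection z * expFibre w) = mk Γ (baseSection z * expFibre w') ↔
      (QuotientAddGroup.mk w : (Fin 2 → ℂ) ⧸ shearedPeriods Γ z) = QuotientAddGroup.mk w' := by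
  have key : baseSection z * expFibre w =
      baseSection z * expFibre (w - w') * (baseSection z)⁻¹ * (baseSection z * expFibre w') := by
    rw [mul_assoc, inv_mul_cancel_left, mul_assoc, ← expFibre_add, sub_add_cancel]
  rw [mk_eq_mk_iff, eq_comm (a := (QuotientAddGroup.mk w : (Fin 2 → ℂ) ⧸ shearedPeriods Γ z)),
    QuotientAddGroup.eq, neg_add_eq_sub]
  constructor
  · rintro ⟨γ, hγ, h⟩
    rw [key, mul_left_inj] at h
    change baseSection z * expFibre (w - w') * (baseSection z)⁻¹ ∈ Γ
    rwa [← h]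
  · intro h
    exact ⟨_, h, key.symm⟩

/-- The parametrisation of a fibre of the fibration by a complex torus. -/
noncomputable def fibreMap (z : ℂ) : (Fin 2 → ℂ) ⧸ shearedPeriods Γ z → Nilmanifold Γ :=
  Quotient.lift (fun w => mk Γ (baseSection z * expFibre w)) fun w w' h =>
    (mk_baseSection_mul_eq_iff Γ z w w').2 (Quotient.sound h)

/-- On 𝔣 the holomorphic coordinates of the group reduce to (0, w₀, w₁), so the lift of the fibre
map is a left translation restricted to a complex plane. -/
theorem fibreMap_mk (z : ℂ) (w : Fin 2 → ℂ) :
    fibreMap Γ z (QuotientAddGroup.mk w) =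
      coordMk Γ (leftTranslation (baseSection z) ![0, w 0, w 1]) := by
  have : holCoord (expFibre w) = ![0, w 0, w 1] := by
    funext i
    fin_cases i <;> apply Complex.ext <;> simp [holCoord, expFibre]
  rw [← this, ← holCoord_mul, coordMk_holCoord]
  rfl

theorem fderiv_injective_of_leftInverse {𝕜 E F : Type*} [NontriviallyNormedField 𝕜]
    [NormedAddCommGroup E] [NormedSpace 𝕜 E] [NormedAddCommGroup F] [NormedSpace 𝕜 F]
    {f : E → F} {g : F → E} (hf : Differentiable 𝕜 f) (hg : Differentiable 𝕜 g)
    (h : Function.LeftInverse g f) (x : E) : Function.Injective (fderiv 𝕜 f x) := by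
  have h1 : (fderiv 𝕜 g (f x)).comp (fderiv 𝕜 f x) = ContinuousLinearMap.id 𝕜 E := by
    rw [← fderiv_comp x (hg _) (hf _), h.comp_eq_id, fderiv_id]
  exact Function.LeftInverse.injective fun v => DFunLike.congr_fun h1 v

variable [DiscreteTopology Γ]

/-- A discrete subgroup acts properly discontinuously by left translation. Separation is needed for
an injective continuous map from a compact torus to be an embedding. -/
instance : T2Space (Nilmanifold Γ) := by
  have : LocallyCompactSpace H7 := by
    have : ProperSpace LieAlgH7 := FiniteDimensional.proper ℝ LieAlgH7
    exact holHomeomorph.isClosedEmbedding.locallyCompactSpace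
  have : T2Space H7 := holHomeomorph.isEmbedding.t2Space
  have : ProperlyDiscontinuousSMul Γ H7 :=
    Γ.properlyDiscontinuousSMul_of_tendsto_cofinite
      (Γ.tendsto_coe_cofinite_of_discrete (DiscreteTopology.isDiscrete (s := (Γ : Set H7))))
  exact t2Space_of_properlyDiscontinuousSMul_of_t2Space (Γ := Γ) (T := H7)

instance (z : ℂ) : DiscreteTopology (shearedPeriods Γ z) :=
  DiscreteTopology.of_continuous_injective
    (f := fun w : shearedPeriods Γ z =>
      (⟨shear z w, (mem_shearedPeriods_iff Γ).1 w.2⟩ : fibrePeriods Γ))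
    (((shear z).continuous_of_finiteDimensional.comp continuous_subtype_val).subtype_mk _)
    (fun w w' h => Subtype.ext (by
      rw [← shear_neg_shear z w, ← shear_neg_shear z w']
      exact congrArg (shear (-z)) (congrArg Subtype.val h)))

theorem isEmbeddedComplexTorus_fibre
    (h : Submodule.span ℝ (fibrePeriods Γ : Set (Fin 2 → ℂ)) = ⊤) (b : ℂ ⧸ basePeriods Γ) :
    IsEmbeddedComplexTorus (Fin 3 → ℂ) 2 (fibration Γ ⁻¹' {b}) := by
  obtain ⟨z, rfl⟩ := QuotientAddGroup.mk_surjective b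
  have hspan := span_shearedPeriods Γ h z
  refine ⟨shearedPeriods Γ z, inferInstance, ⟨inferInstance, hspan⟩, fibreMap Γ z, ?_⟩
  have hq := isQuotientManifold_quotientMk ℂ (shearedPeriods Γ z)
  have hM := isQuotientManifold_coordMk Γ
  set F : (Fin 2 → ℂ) → (Fin 3 → ℂ) := fun w => leftTranslation (baseSection z) ![0, w 0, w 1]
  have hFs : ContDiff ℂ ω F := by
    refine (contDiff_leftTranslation _).comp (contDiff_pi.2 fun i => ?_)
    fin_cases i <;> simp <;> fun_prop
  have hsmooth : ContMDiff 𝓘(ℂ, Fin 2 → ℂ) 𝓘(ℂ, Fin 3 → ℂ) ω (fibreMap Γ z) := by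
    apply hq.contMDiff_of_comp
    rw [show fibreMap Γ z ∘ QuotientAddGroup.mk = coordMk Γ ∘ F from funext (fibreMap_mk Γ z)]
    exact hM.contMDiff.comp hFs.contMDiff
  have hinj : Function.Injective (fibreMap Γ z) := by
    intro x y hxy
    obtain ⟨w, rfl⟩ := QuotientAddGroup.mk_surjective x
    obtain ⟨w', rfl⟩ := QuotientAddGroup.mk_surjective y
    exact (mk_baseSection_mul_eq_iff Γ z w w').1 hxy
  refine ⟨hsmooth, fun x => ?_, ?_, ?_⟩
  · obtain ⟨w, rfl⟩ := QuotientAddGroup.mk_surjective x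
    -- Translating back and dropping the first coordinate is a holomorphic left inverse of F, so F
    -- is an immersion.
    have hG : Differentiable ℂ fun u : Fin 3 → ℂ =>
        (fun v : Fin 3 → ℂ => ![v 1, v 2]) (leftTranslation (baseSection z)⁻¹ u) := by
      have hT : Differentiable ℂ fun v : Fin 3 → ℂ => ![v 1, v 2] := by
        refine differentiable_pi.2 fun i => ?_
        fin_cases i <;> simp <;> fun_prop
      exact hT.comp ((contDiff_leftTranslation _).differentiable (by simp))
    refine hq.mfderiv_injective_of_lift hM (hFs.differentiable (by simp))
      (hsmooth.mdifferentiable (by simp)) (fibreMap_mk Γ z)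
      (fderiv_injective_of_leftInverse (hFs.differentiable (by simp)) hG (fun v => ?_) w)
    have : leftTranslation (baseSection z)⁻¹ (F v) = ![0, v 0, v 1] := by
      simp only [F]
      rw [← holCoord_ofHolCoord ![0, v 0, v 1], ← holCoord_mul, ← holCoord_mul,
        inv_mul_cancel_left]
    change ![leftTranslation (baseSection z)⁻¹ (F v) 1, leftTranslation (baseSection z)⁻¹ (F v) 2] = v
    rw [this]
    funext i
    fin_cases i <;> rfl
  · have := DiscreteSubgroup.compactSpace_quotient _ hspan
    exact (hsmooth.continuous.isClosedEmbedding hinj).isEmbedding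
  · ext m
    obtain ⟨g, rfl⟩ := mk_surjective Γ m
    rw [Set.mem_preimage, Set.mem_singleton_iff, fibration_mk]
    constructor
    · rintro ⟨x, hx⟩
      obtain ⟨w, rfl⟩ := QuotientAddGroup.mk_surjective x
      rw [← fibration_mk, ← hx]
      change (QuotientAddGroup.mk (baseCoord (baseSection z * expFibre w)) : ℂ ⧸ basePeriods Γ) = _
      rw [baseCoord_mul]
      simp
    · intro hg
      -- Moving g by γ puts it exactly over z, so that it differs from `baseSection z` by an element
      -- of 𝔣 on the right.
      obtain ⟨γ, hγ, hγz⟩ := QuotientAddGroup.eq.1 hg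
      have h0 : ((baseSection z)⁻¹ * (γ * g)).log ∈ 𝔣 := by
        rw [← baseCoord_eq_zero_iff, baseCoord_mul, baseCoord_mul, hγz]
        apply Complex.ext <;> simp [baseCoord, baseSection]
      rw [← Set.mem_ofPred_eq (p := fun g : H7 => g.log ∈ 𝔣), ← range_expFibre] at h0
      obtain ⟨w, hw⟩ := h0
      refine ⟨QuotientAddGroup.mk w, ?_⟩
      change mk Γ (baseSection z * expFibre w) = _
      rw [hw, mul_inv_cancel_left]
      exact (mk_eq_mk_iff Γ).2 ⟨γ, hγ, rfl⟩

end Nilmanifold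

/-! ### Smooth local trivialisations of the fibration -/

namespace Nilmanifold

open H7 LieAlgH7

variable (Γ : Subgroup H7)

/-- The map from the product of the base with the leaf to the nilmanifold that belongs to a section
`s` of the universal covering of the base. -/
noncomputable def trivializationInv (s : ℂ ⧸ basePeriods Γ → ℂ)
    (q : (ℂ ⧸ basePeriods Γ) × ((Fin 2 → ℂ) ⧸ fibrePeriods Γ)) : Nilmanifold Γ :=
  Quotient.lift (fun w => mk Γ (expFibre w * baseSection (s q.1))) (fun w w' h =>
    (mk_mul_eq_mk_mul_iff Γ w w' _).2 (Quotient.sound h)) q.2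

variable {Γ} {s : ℂ ⧸ basePeriods Γ → ℂ}

theorem trivializationInv_mk (y : ℂ ⧸ basePeriods Γ) (w : Fin 2 → ℂ) :
    trivializationInv Γ s (y, QuotientAddGroup.mk w) = coordMk Γ (bundleCoord (s y, w)) := by
  rw [coordMk_bundleCoord]
  rfl

variable {U : Set (ℂ ⧸ basePeriods Γ)}

theorem fibration_trivializationInv (hs : ∀ y ∈ U, QuotientAddGroup.mk (s y) = y)
    {q : (ℂ ⧸ basePeriods Γ) × ((Fin 2 → ℂ) ⧸ fibrePeriods Γ)} (hq : q.1 ∈ U) :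
    fibration Γ (trivializationInv Γ s q) = q.1 := by
  obtain ⟨y, x⟩ := q
  obtain ⟨w, rfl⟩ := QuotientAddGroup.mk_surjective x
  rw [trivializationInv_mk, fibration_coordMk]
  exact hs y hq

theorem bijOn_trivializationInv (hs : ∀ y ∈ U, QuotientAddGroup.mk (s y) = y) :
    Set.BijOn (trivializationInv Γ s) (U ×ˢ Set.univ) (fibration Γ ⁻¹' U) := by
  refine ⟨?_, ?_, ?_⟩
  · rintro q ⟨hq, -⟩
    rwa [Set.mem_preimage, fibration_trivializationInv hs hq]
  · rintro q ⟨hq, -⟩ q' ⟨hq', -⟩ h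
    have h1 : q.1 = q'.1 := by
      rw [← fibration_trivializationInv hs hq, ← fibration_trivializationInv hs hq', h]
    obtain ⟨y, x⟩ := q
    obtain ⟨y', x'⟩ := q'
    obtain rfl : y = y' := h1
    obtain ⟨w, rfl⟩ := QuotientAddGroup.mk_surjective x
    obtain ⟨w', rfl⟩ := QuotientAddGroup.mk_surjective x'
    exact congrArg _ ((mk_mul_eq_mk_mul_iff Γ w w' _).1 h)
  · intro m hm
    obtain ⟨g, rfl⟩ := mk_surjective Γ m
    set y := fibration Γ (mk Γ g)
    have hy : (QuotientAddGroup.mk (baseCoord g) : ℂ ⧸ basePeriods Γ) =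
      QuotientAddGroup.mk (s y) := (hs y hm).symm
    -- Replace g by the representative γ g of its coset whose base coordinate is the chosen lift s
    -- y.
    obtain ⟨γ, hγ, hγs⟩ := QuotientAddGroup.eq.1 hy
    obtain ⟨w, hw⟩ := exists_eq_expFibre_mul_baseSection (γ * g)
    refine ⟨(y, QuotientAddGroup.mk w), ⟨hm, trivial⟩, ?_⟩
    change mk Γ (expFibre w * baseSection (s y)) = mk Γ g
    rw [show s y = baseCoord (γ * g) by rw [baseCoord_mul, hγs]; ring, ← hw]
    exact (mk_eq_mk_iff Γ).2 ⟨γ, hγ, rfl⟩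

variable [DiscreteTopology Γ] [DiscreteTopology (basePeriods Γ)]

theorem contMDiffAt_trivializationInv
    {q : (ℂ ⧸ basePeriods Γ) × ((Fin 2 → ℂ) ⧸ fibrePeriods Γ)}
    (hs : ContMDiffAt 𝓘(ℝ, ℂ) 𝓘(ℝ, ℂ) ω s q.1) :
    ContMDiffAt (𝓘(ℝ, ℂ).prod 𝓘(ℝ, Fin 2 → ℂ)) 𝓘(ℝ, Fin 3 → ℂ) ω (trivializationInv Γ s) q := by
  have hL := isQuotientManifold_quotientMk ℝ (fibrePeriods Γ)
  obtain ⟨y, x⟩ := q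
  have h1 : ContMDiffAt (𝓘(ℝ, ℂ).prod 𝓘(ℝ, Fin 2 → ℂ)) 𝓘(ℝ, ℂ) ω
      (fun q : (ℂ ⧸ basePeriods Γ) × ((Fin 2 → ℂ) ⧸ fibrePeriods Γ) => s q.1) (y, x) :=
    ContMDiffAt.comp (y, x) hs contMDiffAt_fst
  have h2 : ContMDiffAt (𝓘(ℝ, ℂ).prod 𝓘(ℝ, Fin 2 → ℂ)) 𝓘(ℝ, Fin 2 → ℂ) ω
      (fun q : (ℂ ⧸ basePeriods Γ) × ((Fin 2 → ℂ) ⧸ fibrePeriods Γ) =>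
        chartAt (Fin 2 → ℂ) x q.2) (y, x) :=
    ContMDiffAt.comp (y, x) (g := chartAt (Fin 2 → ℂ) x)
      (contMDiffOn_chart.contMDiffAt ((chartAt _ x).open_source.mem_nhds (mem_chart_source _ x)))
      contMDiffAt_snd
  have h3 := ContMDiffAt.comp (y, x) (g := coordMk Γ ∘ bundleCoord)
    (((isQuotientManifold_real_coordMk Γ).contMDiff.comp contDiff_bundleCoord.contMDiff) _)
    (h1.prodMk_space h2)
  refine h3.congr_of_eventuallyEq ?_
  filter_upwards [continuousAt_snd.eventually (hL.proj_chartAt x)] with q hq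
  simp only [Function.comp_apply]
  rw [← trivializationInv_mk, hq]

/-- On the universal covers e is given locally by `bundleCoordInv`. The condition on s says that s
is a local inverse of the projection near the sheet point s y. -/
theorem contMDiffAt_of_rightInverse_trivializationInv {y : ℂ ⧸ basePeriods Γ}
    (hy : ∀ᶠ z in 𝓝 (s y), (QuotientAddGroup.mk z : ℂ ⧸ basePeriods Γ) ∈ U ∧
      s (QuotientAddGroup.mk z) = z)
    {e : Nilmanifold Γ → (ℂ ⧸ basePeriods Γ) × ((Fin 2 → ℂ) ⧸ fibrePeriods Γ)}
    (he : ∀ q, q.1 ∈ U → e (trivializationInv Γ s q) = q) (x : (Fin 2 → ℂ) ⧸ fibrePeriods Γ) :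
    ContMDiffAt 𝓘(ℝ, Fin 3 → ℂ) (𝓘(ℝ, ℂ).prod 𝓘(ℝ, Fin 2 → ℂ)) ω e
      (trivializationInv Γ s (y, x)) := by
  obtain ⟨w, rfl⟩ := QuotientAddGroup.mk_surjective x
  rw [trivializationInv_mk]
  apply (isQuotientManifold_real_coordMk Γ).contMDiffAt_of_comp
  have h1 : ContMDiff 𝓘(ℝ, Fin 3 → ℂ) 𝓘(ℝ, ℂ) ω
      (fun u : Fin 3 → ℂ => (QuotientAddGroup.mk (bundleCoordInv u).1 : ℂ ⧸ basePeriods Γ)) :=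
    (isQuotientManifold_quotientMk ℝ (basePeriods Γ)).contMDiff.comp
      (contDiff_bundleCoordInv.fst).contMDiff
  have h2 : ContMDiff 𝓘(ℝ, Fin 3 → ℂ) 𝓘(ℝ, Fin 2 → ℂ) ω (fun u : Fin 3 → ℂ =>
      (QuotientAddGroup.mk (bundleCoordInv u).2 : (Fin 2 → ℂ) ⧸ fibrePeriods Γ)) :=
    (isQuotientManifold_quotientMk ℝ (fibrePeriods Γ)).contMDiff.comp
      (contDiff_bundleCoordInv.snd).contMDiff
  refine ((h1.prodMk h2) _).congr_of_eventuallyEq ?_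
  have hcont : Filter.Tendsto (fun u : Fin 3 → ℂ => (bundleCoordInv u).1)
      (𝓝 (bundleCoord (s y, w))) (𝓝 (s y)) :=
    (contDiff_bundleCoordInv.fst).continuous.continuousAt
  filter_upwards [hcont.eventually hy] with u hu
  have := he ((QuotientAddGroup.mk (bundleCoordInv u).1 : ℂ ⧸ basePeriods Γ),
    (QuotientAddGroup.mk (bundleCoordInv u).2 : (Fin 2 → ℂ) ⧸ fibrePeriods Γ)) hu.1
  rw [trivializationInv_mk, hu.2, bundleCoord_bundleCoordInv] at this
  exact this

variable (Γ) in
theorem exists_trivialization (b : ℂ ⧸ basePeriods Γ) :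
    ∃ e : Bundle.Trivialization ((Fin 2 → ℂ) ⧸ fibrePeriods Γ) (fibration Γ), b ∈ e.baseSet ∧
      ContMDiffOn 𝓘(ℝ, Fin 3 → ℂ) (𝓘(ℝ, ℂ).prod 𝓘(ℝ, Fin 2 → ℂ)) ∞ e e.source ∧
      ContMDiffOn (𝓘(ℝ, ℂ).prod 𝓘(ℝ, Fin 2 → ℂ)) 𝓘(ℝ, Fin 3 → ℂ) ∞
        e.toOpenPartialHomeomorph.symm e.target := by
  have hΛ := isQuotientManifold_quotientMk ℝ (basePeriods Γ)
  set c := chartAt ℂ b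
  have hc : ∀ z, c.symm z = QuotientAddGroup.mk z := fun z => congrFun (hΛ.chartAt_symm b) z
  have hs : ∀ y ∈ c.source, QuotientAddGroup.mk (c y) = y := fun y hy => by
    rw [← hc, c.left_inv hy]
  have hbij := bijOn_trivializationInv hs
  set E := hbij.toPartialEquiv
  have hE : ∀ q, E q = trivializationInv Γ c q := fun _ => rfl
  have hsrc : E.source = c.source ×ˢ Set.univ := rfl
  have htgt : E.target = fibration Γ ⁻¹' c.source := rfl
  have h1 : ContMDiffOn (𝓘(ℝ, ℂ).prod 𝓘(ℝ, Fin 2 → ℂ)) 𝓘(ℝ, Fin 3 → ℂ) ∞ E E.source := by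
    rintro q ⟨hq, -⟩
    refine ((contMDiffAt_trivializationInv ?_).of_le le_top).contMDiffWithinAt
    exact contMDiffOn_chart.contMDiffAt (c.open_source.mem_nhds hq)
  have h2 : ContMDiffOn 𝓘(ℝ, Fin 3 → ℂ) (𝓘(ℝ, ℂ).prod 𝓘(ℝ, Fin 2 → ℂ)) ∞ E.symm E.target := by
    intro m hm
    obtain ⟨⟨y, x⟩, ⟨hy, -⟩, rfl⟩ := hbij.surjOn hm
    refine ((contMDiffAt_of_rightInverse_trivializationInv ?_
      (fun q hq => E.left_inv ⟨hq, trivial⟩) x).of_le le_top).contMDiffWithinAt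
    filter_upwards [c.open_target.mem_nhds (c.map_source hy)] with z hz
    rw [← hc]
    exact ⟨c.map_target hz, c.right_inv hz⟩
  have hcont : Continuous (fibration Γ) :=
    (continuous_quotient_mk'.comp
      (Complex.equivRealProdCLM.symm.continuous.comp
        ((continuous_log_apply 0).prodMk (continuous_log_apply 1)))).quotient_lift _
  -- The chart c itself serves as the local section of ℂ → ℂ / Λ; source and target are exchanged
  -- because E goes from the product to the total space.
  refine ⟨{ toPartialEquiv := E.symm
            open_source := c.open_source.preimage hcont
            open_target := c.open_source.prod isOpen_univ
            continuousOn_toFun := h2.continuousOn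
            continuousOn_invFun := h1.continuousOn
            baseSet := c.source
            open_baseSet := c.open_source
            source_eq := htgt
            target_eq := hsrc
            proj_toFun := ?_ }, mem_chart_source ℂ b, h2, h1⟩
  intro m hm
  change (E.symm m).1 = _
  have hm' : E.symm m ∈ E.source := E.map_target hm
  have := fibration_trivializationInv hs hm'.1
  rw [← this, ← hE, E.right_inv hm]

theorem isComplexTorusBundle_fibration
    (h : Submodule.span ℝ (fibrePeriods Γ : Set (Fin 2 → ℂ)) = ⊤) :
    IsComplexTorusBundle 2 (Fin 3 → ℂ) ℂ (fibration Γ) := by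
  have hM := isQuotientManifold_coordMk Γ
  have hΛ := isQuotientManifold_quotientMk ℂ (basePeriods Γ)
  let pr : (Fin 3 → ℂ) →L[ℂ] ℂ := ContinuousLinearMap.proj 0
  have hhol : ContMDiff 𝓘(ℂ, Fin 3 → ℂ) 𝓘(ℂ, ℂ) ω (fibration Γ) := by
    apply hM.contMDiff_of_comp
    exact hΛ.contMDiff.comp pr.contDiff.contMDiff
  refine ⟨hhol, fun x => ?_, isEmbeddedComplexTorus_fibre Γ h,
    fibrePeriods Γ, inferInstance, ⟨inferInstance, h⟩, exists_trivialization Γ⟩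
  obtain ⟨u, rfl⟩ := coordMk_surjective Γ x
  refine hM.mfderiv_surjective_of_lift hΛ pr.differentiable (hhol.mdifferentiable (by simp))
    (fibration_coordMk Γ) ?_
  rw [pr.fderiv]
  exact fun z => ⟨fun _ => z, rfl⟩

end Nilmanifold

/-! ### Obstruction to a principal bundle structure -/

namespace Nilmanifold

open H7 LieAlgH7 unitInterval

variable {Γ : Subgroup H7}

/-- If `fibration Γ` is a principal bundle, then the fundamental group of the fibre is central in
the fundamental group `Γ` of the total space. -/
theorem commute_of_isPrincipalBundle [DiscreteTopology Γ] {G : Type*} [Group G] [TopologicalSpace G]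
    [IsTopologicalGroup G] [MulAction G (Nilmanifold Γ)] [ContinuousSMul G (Nilmanifold Γ)]
    (hG : IsPrincipalBundle G (fibration Γ)) {w : Fin 2 → ℂ} (hw : expFibre w ∈ Γ) {δ : H7}
    (hδ : δ ∈ Γ) : δ * expFibre w = expFibre w * δ := by
  have hcov := isCoveringMap_mk Γ
  obtain ⟨e, hb, he⟩ := hG (fibration Γ (mk Γ 1))
  let m : I → Nilmanifold Γ := fun t => mk Γ (expFibre ((t : ℝ) • w))
  have hmk : Continuous (mk Γ) := continuous_quotient_mk'
  have hpath : Continuous fun t : I => expFibre ((t : ℝ) • w) :=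
    continuous_expFibre.comp (by fun_prop)
  have hm : Continuous m := hmk.comp hpath
  have hfib : ∀ t, fibration Γ (m t) = fibration Γ (mk Γ 1) := fun t => rfl
  have hsource : ∀ t, m t ∈ e.source := fun t => by
    rw [e.source_eq, Set.mem_preimage, hfib]
    exact hb
  have hsource1 : mk Γ 1 ∈ e.source := by
    rw [e.source_eq]
    exact hb
  -- ℓ t is the group element carrying the base point to m t, read off in the trivialisation. It is
  -- a loop at 1 since m is a loop in the fibre.
  let ℓ : I → G := fun t => (e (m t)).2 * (e (mk Γ 1)).2⁻¹
  have hem : Continuous fun t => (e (m t)).2 :=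
    continuous_snd.comp (e.toOpenPartialHomeomorph.continuousOn.comp_continuous hm hsource)
  have hℓ : Continuous ℓ := hem.fun_mul continuous_const
  have hexp0 : expFibre 0 = 1 := by ext <;> simp [expFibre]
  have hm0 : m 0 = mk Γ 1 := by simp [m, hexp0]
  have hm1 : m 1 = mk Γ 1 := by
    simp only [m, Set.Icc.coe_one, one_smul]
    exact (mk_eq_mk_iff Γ).2 ⟨_, hw, mul_one _⟩
  have hℓ0 : ℓ 0 = 1 := by simp [ℓ, hm0]
  have hℓ1 : ℓ 1 = 1 := by simp [ℓ, hm1]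
  have hact : ∀ t, ℓ t • mk Γ 1 = m t := by
    intro t
    obtain ⟨h1, h2⟩ := he _ hsource1 (ℓ t)
    apply e.injOn h1 (hsource t)
    refine h2.trans (Prod.ext ?_ (by simp [ℓ]))
    change (e (mk Γ 1)).1 = (e (m t)).1
    rw [e.coe_fst hsource1, e.coe_fst (hsource t), hfib]
  let f : C(I, H7) := ⟨fun t => exp ((t : ℝ) • δ.log), continuous_exp.comp (by fun_prop)⟩
  have hf0 : f 0 = 1 := by
    change exp (((0 : I) : ℝ) • δ.log) = 1
    rw [Set.Icc.coe_zero, zero_smul]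
    rfl
  have hf1 : f 1 = δ := by
    change exp (((1 : I) : ℝ) • δ.log) = δ
    rw [Set.Icc.coe_one, one_smul]
  -- A torus in M swept out by letting the loop ℓ act on the loop of δ. The corner K (1, 1) of its
  -- lift to the group is computed along two pairs of edges: δ followed by w, and w followed by δ.
  let H : C(I × I, Nilmanifold Γ) :=
    ⟨fun q => ℓ q.1 • mk Γ (f q.2), (hℓ.comp continuous_fst).smul
      (hmk.comp (f.continuous.comp continuous_snd))⟩
  have hH0 : ∀ t, H (0, t) = mk Γ (f t) := fun t => by
    change ℓ 0 • mk Γ (f t) = _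
    rw [hℓ0, one_smul]
  set K := hcov.liftHomotopy H f hH0
  have hK : ∀ q, mk Γ (K q) = ℓ q.1 • mk Γ (f q.2) :=
    fun q => congrFun (hcov.liftHomotopy_lifts H f hH0) q
  have hK0 : ∀ t, K (0, t) = f t := hcov.liftHomotopy_zero H f hH0
  have huniq : ∀ g₁ g₂ : I → H7, Continuous g₁ → Continuous g₂ →
      (∀ t, mk Γ (g₁ t) = mk Γ (g₂ t)) → g₁ 0 = g₂ 0 → g₁ 1 = g₂ 1 := by
    intro g₁ g₂ h₁ h₂ h h0
    exact congrFun (hcov.eq_of_comp_eq h₁ h₂ (funext h) 0 h0) 1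
  have hδ1 : mk Γ δ = mk Γ 1 := (mk_eq_mk_iff Γ).2 ⟨δ, hδ, mul_one δ⟩
  have h10 : K (1, 0) = expFibre w := by
    have := huniq (fun t => K (t, 0)) (fun t => expFibre ((t : ℝ) • w))
      (K.continuous.comp (by fun_prop)) hpath
      (fun t => by rw [hK, hf0]; exact hact t) (by simp [hK0, hf0, hexp0])
    simpa using this
  have h11 : K (1, 1) = δ * expFibre w := by
    have := huniq (fun t => K (t, 1)) (fun t => δ * expFibre ((t : ℝ) • w))
      (K.continuous.comp (by fun_prop)) (continuous_const.mul hpath)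
      (fun t => by
        rw [hK, hf1, hδ1]
        exact (hact t).trans ((mk_eq_mk_iff Γ).2 ⟨δ, hδ, rfl⟩).symm) (by simp [hK0, hf1, hexp0])
    simpa using this
  have h11' : K (1, 1) = expFibre w * δ := by
    have := huniq (fun t => K (1, t)) (fun t => expFibre w * f t)
      (K.continuous.comp (by fun_prop)) (continuous_const.mul f.continuous)
      (fun t => by
        rw [hK, hℓ1, one_smul]
        exact ((mk_eq_mk_iff Γ).2 ⟨_, hw, rfl⟩).symm) (by simp [h10, hf0])
    simpa [hf1] using this
  rw [← h11, h11']

theorem not_admitsPrincipalBundleStructure [DiscreteTopology Γ] [CompactSpace (Nilmanifold Γ)]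
    (h : Submodule.span ℝ (fibrePeriods Γ : Set (Fin 2 → ℂ)) = ⊤) :
    ¬ AdmitsPrincipalBundleStructure (fibration Γ) := by
  rintro ⟨G, _, _, _, _, _, hG⟩
  have hzero : ∀ δ ∈ Γ, baseCoord δ = 0 := by
    intro δ hδ
    -- Commutation makes this real linear map vanish on the periods, hence on 𝔣. Its value at e₃ has
    -- e₅- and e₆-coordinates equal to the base coordinates of δ.
    let φ : (Fin 2 → ℂ) →ₗ[ℝ] LieAlgH7 :=
      { toFun := fun w => ⁅fibreInclusion w, δ.log⁆
        map_add' := fun w w' => by rw [map_add, add_lie]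
        map_smul' := fun c w => by rw [map_smul, smul_lie]; rfl }
    have hφ : Submodule.span ℝ (fibrePeriods Γ : Set (Fin 2 → ℂ)) ≤ LinearMap.ker φ := by
      rw [Submodule.span_le]
      intro w hw
      have hc := commute_of_isPrincipalBundle hG hw hδ
      have : ⁅fibreInclusion w, δ.log⁆ = (expFibre w * δ * (expFibre w)⁻¹ * δ⁻¹).log :=
        (log_commutator _ _).symm
      rw [SetLike.mem_coe, LinearMap.mem_ker]
      change ⁅fibreInclusion w, δ.log⁆ = 0
      rw [this, ← hc, mul_inv_cancel_right, mul_inv_cancel, log_one]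
    have h1 : φ ![1, 0] = 0 := hφ (h ▸ Submodule.mem_top)
    have h4 : φ ![1, 0] 4 = 0 := by rw [h1]; rfl
    have h5 : φ ![1, 0] 5 = 0 := by rw [h1]; rfl
    apply Complex.ext
    · change δ.log 0 = 0
      simpa [φ, bracket_def, fibreInclusion, expFibre] using h4
    · change δ.log 1 = 0
      simpa [φ, bracket_def, fibreInclusion, expFibre] using h5
  have htop := span_basePeriods Γ
  have hle : Submodule.span ℝ (basePeriods Γ : Set ℂ) ≤ ⊥ := by
    rw [Submodule.span_le]
    rintro _ ⟨g, hg, rfl⟩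
    exact hzero g hg
  rw [htop] at hle
  exact one_ne_zero ((Submodule.mem_bot ℝ).1 (hle (Submodule.mem_top (x := (1 : ℂ)))))

end Nilmanifold

/-! ### A family of lattices whose leaves are non-compact toroidal groups -/

namespace Nilmanifold

open H7 LieAlgH7

/-- The lattice with generators `exp e₁`, `exp e₂`, `exp (α e₂ + e₃)`, enlarged by the halves of the
commutators. -/
def slopeLattice (α : ℝ) : Subgroup H7 where
  carrier := {g | ∃ n₁ n₂ n₃ k l p : ℤ, g.log = ofCoords
    ![n₁, n₂ + α * n₃, n₃, (k + α * l) / 2, l / 2, p / 2]}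
  one_mem' := ⟨0, 0, 0, 0, 0, 0, by ext <;> simp⟩
  mul_mem' := by
    rintro g h ⟨n₁, n₂, n₃, k, l, p, hg⟩ ⟨n₁', n₂', n₃', k', l', p', hh⟩
    -- Closure holds because the α-part of the e₄-coordinate changes by the same integer n₁n₃' −
    -- n₃n₁' as the e₅-coordinate, while α cancels in the e₆-coordinate. The halves absorb the
    -- factor 1/2 of the product formula.
    refine ⟨n₁ + n₁', n₂ + n₂', n₃ + n₃', k + k' - (n₁ * n₂' - n₂ * n₁'),
      l + l' - (n₁ * n₃' - n₃ * n₁'), p + p' - (n₂ * n₃' - n₃ * n₂'), ?_⟩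
    rw [log_mul, hg, hh]
    ext <;> simp [bracket_def] <;> ring
  inv_mem' := by
    rintro g ⟨n₁, n₂, n₃, k, l, p, hg⟩
    refine ⟨-n₁, -n₂, -n₃, -k, -l, -p, ?_⟩
    rw [log_inv, hg]
    ext <;> simp <;> ring

variable (α : ℝ)

instance : DiscreteTopology (slopeLattice α) := by
  have hint : ∀ n : ℤ, |(n : ℝ)| < 1 → n = 0 := fun n hn => by
    rw [← Int.cast_abs, ← Int.cast_one, Int.cast_lt, Int.abs_lt_one_iff] at hn
    exact hn
  rw [discreteTopology_iff_exists_gap]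
  refine ⟨1 / 2, by norm_num, ?_⟩
  rintro g ⟨n₁, n₂, n₃, k, l, p, hg⟩ hn
  have hi : ∀ i, |g.log i| < 1 / 2 := fun i => (abs_apply_le_norm _ i).trans_lt hn
  rw [hg] at hi
  have half : ∀ x : ℝ, |x / 2| < 1 / 2 → |x| < 1 := fun x hx => by
    rw [abs_div, abs_two] at hx
    linarith
  have h1 : n₁ = 0 := hint _ ((hi 0).trans (by norm_num))
  have h3 : n₃ = 0 := hint _ ((hi 2).trans (by norm_num))
  have h2 : n₂ = 0 := by
    have : |n₂ + α * n₃| < 1 / 2 := hi 1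
    rw [h3, Int.cast_zero, mul_zero, add_zero] at this
    exact hint _ (this.trans (by norm_num))
  have hl : l = 0 := hint _ (half _ (hi 4))
  have hp : p = 0 := hint _ (half _ (hi 5))
  have hk : k = 0 := by
    have : |(k + α * l) / 2| < 1 / 2 := hi 3
    rw [hl, Int.cast_zero, mul_zero, add_zero] at this
    exact hint _ (half _ this)
  apply H7.ext
  rw [hg, log_one]
  ext <;> simp [h1, h2, h3, hl, hp, hk]

instance : CompactSpace (Nilmanifold (slopeLattice α)) := by
  have : ProperSpace LieAlgH7 := FiniteDimensional.proper ℝ LieAlgH7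
  have hK : IsCompact ((mk (slopeLattice α) ∘ exp) '' Metric.closedBall 0 1) :=
    (isCompact_closedBall (0 : LieAlgH7) 1).image
      (continuous_quotient_mk'.comp continuous_exp)
  refine ⟨hK.of_isClosed_subset isClosed_univ ?_⟩
  rintro m -
  obtain ⟨g, rfl⟩ := mk_surjective _ m
  have hfract : ∀ x : ℝ, |x + ((-⌊x⌋ : ℤ) : ℝ)| ≤ 1 := fun x => by
    rw [Int.cast_neg, ← sub_eq_add_neg, Int.self_sub_floor, abs_of_nonneg (Int.fract_nonneg x)]
    exact (Int.fract_lt_one x).le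
  have hhalf : ∀ x y : ℝ, |x + y| ≤ 1 → |x / 2 + y / 2| ≤ 1 := fun x y h => by
    rw [← add_div, abs_div, abs_two]
    linarith
  obtain ⟨n₁, hn₁⟩ : ∃ n : ℤ, |g.log 0 + n| ≤ 1 := ⟨_, hfract _⟩
  obtain ⟨n₃, hn₃⟩ : ∃ n : ℤ, |g.log 2 + n| ≤ 1 := ⟨_, hfract _⟩
  -- n₃ must be fixed before n₂, and below l before k, since each enters the later coordinate
  -- multiplied by α. The central coordinates are reduced only after multiplication by γ, which
  -- changes them.
  obtain ⟨n₂, hn₂⟩ : ∃ n : ℤ, |g.log 1 + α * n₃ + n| ≤ 1 := ⟨_, hfract _⟩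
  set γ : H7 := exp (ofCoords ![n₁, n₂ + α * n₃, n₃, 0, 0, 0])
  have hγ : γ ∈ slopeLattice α := ⟨n₁, n₂, n₃, 0, 0, 0, by simp [γ]⟩
  set h := γ * g
  obtain ⟨l, hl⟩ : ∃ n : ℤ, |2 * h.log 4 + n| ≤ 1 := ⟨_, hfract _⟩
  obtain ⟨p, hp⟩ : ∃ n : ℤ, |2 * h.log 5 + n| ≤ 1 := ⟨_, hfract _⟩
  obtain ⟨k, hk⟩ : ∃ n : ℤ, |2 * h.log 3 + α * l + n| ≤ 1 := ⟨_, hfract _⟩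
  set κ : H7 := exp (ofCoords ![0, 0, 0, (k + α * l) / 2, l / 2, p / 2])
  have hκ : κ ∈ slopeLattice α := ⟨0, 0, 0, k, l, p, by simp [κ]⟩
  have h4 := hhalf _ _ hl
  have h5 := hhalf _ _ hp
  have h3 := hhalf _ _ (by rw [add_assoc] at hk; exact hk)
  rw [mul_div_cancel_left₀ _ two_ne_zero] at h3 h4 h5
  refine ⟨(κ * h).log, ?_, (mk_eq_mk_iff _).2 ⟨κ * γ, mul_mem hκ hγ, mul_assoc _ _ _⟩⟩
  rw [mem_closedBall_zero_iff]
  refine (pi_norm_le_iff_of_nonneg zero_le_one).2 fun i => ?_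
  rw [Real.norm_eq_abs]
  have e0 : (κ * h).log 0 = g.log 0 + n₁ := by
    simp [κ, h, γ, log_mul, bracket_def]
    ring
  have e1 : (κ * h).log 1 = g.log 1 + α * n₃ + n₂ := by
    simp [κ, h, γ, log_mul, bracket_def]
    ring
  have e2 : (κ * h).log 2 = g.log 2 + n₃ := by
    simp [κ, h, γ, log_mul, bracket_def]
    ring
  have e3 : (κ * h).log 3 = h.log 3 + (α * l + k) / 2 := by
    simp [κ, log_mul, bracket_def]
    ring
  have e4 : (κ * h).log 4 = h.log 4 + l / 2 := by
    simp [κ, log_mul, bracket_def]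
    ring
  have e5 : (κ * h).log 5 = h.log 5 + p / 2 := by
    simp [κ, log_mul, bracket_def]
    ring
  fin_cases i
  · exact e0 ▸ hn₁
  · exact e1 ▸ hn₂
  · exact e2 ▸ hn₃
  · exact e3 ▸ h3
  · exact e4 ▸ h4
  · exact e5 ▸ h5

variable {α}

theorem mem_fibrePeriods_slopeLattice_iff (hα : Irrational α) {w : Fin 2 → ℂ} :
    w ∈ fibrePeriods (slopeLattice α) ↔
      ∃ k l p : ℤ, w = ![⟨0, (k + α * l) / 2⟩, ⟨l / 2, p / 2⟩] := by
  constructor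
  · rintro ⟨n₁, n₂, n₃, k, l, p, hw⟩
    have h := fun i => congrFun hw i
    have h1 : (0 : ℝ) = n₂ + α * n₃ := h 1
    have h2 : (w 0).re = n₃ := h 2
    have h3 : (w 0).im = (k + α * l) / 2 := h 3
    have h4 : (w 1).re = l / 2 := h 4
    have h5 : (w 1).im = p / 2 := h 5
    -- Lying in 𝔣 means n₂ + αn₃ = 0, and irrationality of α leaves no period with an e₃-component.
    have hn : n₃ = 0 := by
      by_contra hne
      have := (hα.mul_intCast hne).intCast_add n₂
      exact this ⟨0, by rw [← h1]; simp⟩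
    refine ⟨k, l, p, ?_⟩
    funext i
    fin_cases i <;> apply Complex.ext <;> simp [h2, h3, h4, h5, hn]
  · rintro ⟨k, l, p, rfl⟩
    refine ⟨0, 0, 0, k, l, p, ?_⟩
    ext <;> simp [expFibre]

theorem not_isRational_slopeLattice (hα : Irrational α) : ¬ IsRational (slopeLattice α) 𝔣 := by
  rw [isRational_𝔣_iff]
  intro h
  let φ : (Fin 2 → ℂ) →ₗ[ℝ] ℝ := Complex.reLm ∘ₗ LinearMap.proj 0
  have hle : Submodule.span ℝ (fibrePeriods (slopeLattice α) : Set (Fin 2 → ℂ)) ≤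
      LinearMap.ker φ := by
    rw [Submodule.span_le]
    intro w hw
    obtain ⟨k, l, p, rfl⟩ := (mem_fibrePeriods_slopeLattice_iff hα).1 hw
    rfl
  have : φ ![1, 0] = 0 := hle (h ▸ Submodule.mem_top)
  simp [φ] at this

/-- Toroidal coordinates on the leaf of `slopeLattice α` with glueing matrix `(α, 0)`. -/
noncomputable def slopeCoordinates (hα : Irrational α) :
    ToroidalCoordinates (fibrePeriods (slopeLattice α)) 1 1 where
  coord :=
    -- The factor −2i turns z₁ = i(k + αl)/2 into k + αl, and 2 turns z₂ into l + ip. Thus k is the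
    -- integral direction, and the basis 1, i of the torus factor carries glueing entries α and 0.
    { toFun := fun w => (fun _ => -2 * Complex.I * w 0, fun _ => 2 * w 1)
      map_add' := fun w w' => by ext <;> simp [mul_add]
      map_smul' := fun c w => by ext <;> simp [mul_left_comm]
      invFun := fun v => ![Complex.I / 2 * v.1 0, v.2 0 / 2]
      left_inv := fun w => by
        funext i
        fin_cases i
        · change Complex.I / 2 * (-2 * Complex.I * w 0) = w 0
          linear_combination (-w 0) * Complex.I_mul_I
        · change 2 * w 1 / 2 = w 1
          ring
      right_inv := fun v => by
        refine Prod.ext (funext fun i => ?_) (funext fun i => ?_)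
        · obtain rfl := Subsingleton.elim 0 i
          change -2 * Complex.I * (Complex.I / 2 * v.1 0) = v.1 0
          linear_combination (-v.1 0) * Complex.I_mul_I
        · obtain rfl := Subsingleton.elim 0 i
          change 2 * (v.2 0 / 2) = v.2 0
          ring }
  R := fun _ j => (![α, 0] : Fin 2 → ℝ) j
  P := Complex.basisOneI.map (LinearEquiv.funUnique (Fin 1) ℝ ℂ).symm
  mem_iff w := by
    rw [mem_fibrePeriods_slopeLattice_iff hα]
    constructor
    · rintro ⟨k, l, p, rfl⟩
      refine ⟨fun _ => k, ![l, p], ?_⟩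
      refine Prod.ext (funext fun i => ?_) (funext fun i => ?_)
      · apply Complex.ext <;> simp [Fin.sum_univ_two]
        ring
      · apply Complex.ext <;> simp [Fin.sum_univ_two] <;> ring
    · rintro ⟨a, b, h⟩
      refine ⟨a 0, b 0, b 1, ?_⟩
      have h0 := congrFun (congrArg Prod.fst h) 0
      have h1 := congrFun (congrArg Prod.snd h) 0
      have h0r := congrArg Complex.re h0
      have h0i := congrArg Complex.im h0
      have h1r := congrArg Complex.re h1
      have h1i := congrArg Complex.im h1
      simp [Fin.sum_univ_two] at h0r h0i h1r h1i
      funext i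
      fin_cases i <;> apply Complex.ext <;> simp <;> linarith
  irrational σ hσ τ := by
    have h0 : σ 0 ≠ 0 := fun h => hσ (funext fun i => by rw [Subsingleton.elim i 0, h]; rfl)
    refine ⟨0, fun h => ?_⟩
    have h' : (σ 0 : ℝ) * α = τ 0 := by simpa using h
    exact (hα.intCast_mul h0) ⟨τ 0, by simp [h']⟩

end Nilmanifold

/-! ### Diophantine approximation of the glueing matrix -/

theorem abs_apply_le_euclideanNorm {k : ℕ} (x : Fin k → ℝ) (i : Fin k) :
    |x i| ≤ euclideanNorm x :=
  Real.abs_le_sqrt (Finset.single_le_sum (f := fun i => x i ^ 2) (fun _ _ => sq_nonneg _)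
    (Finset.mem_univ i))

theorem euclideanNorm_le {k : ℕ} {x : Fin k → ℝ} {c : ℝ} (h : ∑ i, |x i| ≤ c) :
    euclideanNorm x ≤ c := by
  have h0 : 0 ≤ ∑ i, |x i| := Finset.sum_nonneg fun _ _ => abs_nonneg _
  refine (Real.sqrt_le_left h0).2 ?_ |>.trans h
  calc ∑ i, x i ^ 2 = ∑ i, |x i| ^ 2 := by simp only [sq_abs]
    _ ≤ (∑ i, |x i|) ^ 2 := Finset.sum_sq_le_sq_sum_of_nonneg fun _ _ => abs_nonneg _

theorem euclideanNorm_fin_one (x : Fin 1 → ℝ) : euclideanNorm x = |x 0| := by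
  simp [euclideanNorm, Real.sqrt_sq_eq_abs]

/-- `√2` is badly approximable. -/
theorem one_le_four_mul_abs_mul_sqrt_two_sub {s : ℤ} (hs : s ≠ 0) (t : ℤ) :
    1 ≤ 4 * |(s : ℝ)| * |(s : ℝ) * √2 - t| := by
  have hs1 : (1 : ℝ) ≤ |(s : ℝ)| := by exact_mod_cast Int.one_le_abs hs
  by_cases hd : 1 / 4 ≤ |(s : ℝ) * √2 - t|
  · nlinarith
  push Not at hd
  have hsqrt : √2 ≤ 3 / 2 := by rw [Real.sqrt_le_left (by norm_num)]; norm_num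
  -- The conjugate factor has size O(|s|), while the product of both factors is the non-zero integer
  -- 2s² − t².
  have hplus : |(s : ℝ) * √2 + t| ≤ 4 * |(s : ℝ)| := by
    calc |(s : ℝ) * √2 + t| = |2 * (s : ℝ) * √2 - (s * √2 - t)| := by congr 1; ring
      _ ≤ |2 * (s : ℝ) * √2| + |(s : ℝ) * √2 - t| := abs_sub _ _
      _ = 2 * |(s : ℝ)| * √2 + |(s : ℝ) * √2 - t| := by
          rw [abs_mul, abs_mul, abs_two, abs_of_nonneg (Real.sqrt_nonneg 2)]
      _ ≤ 4 * |(s : ℝ)| := by nlinarith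
  have hne : 2 * s ^ 2 - t ^ 2 ≠ 0 := by
    intro h
    have h0 : ((s : ℝ) * √2 - t) * ((s : ℝ) * √2 + t) = 0 := by
      have : ((2 * s ^ 2 - t ^ 2 : ℤ) : ℝ) = 0 := by exact_mod_cast h
      push_cast at this
      linear_combination this + (s : ℝ) ^ 2 * Real.sq_sqrt (zero_le_two (α := ℝ))
    have hirr := irrational_sqrt_two.intCast_mul hs
    rcases mul_eq_zero.1 h0 with h1 | h1
    · exact hirr ⟨t, by push_cast; linarith⟩
    · exact hirr ⟨-t, by push_cast; linarith⟩
  have hge : (1 : ℝ) ≤ |((2 * s ^ 2 - t ^ 2 : ℤ) : ℝ)| := by exact_mod_cast Int.one_le_abs hne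
  calc (1 : ℝ) ≤ |((2 * s ^ 2 - t ^ 2 : ℤ) : ℝ)| := hge
    _ = |(s : ℝ) * √2 + t| * |(s : ℝ) * √2 - t| := by
      rw [← abs_mul]
      congr 1
      push_cast
      linear_combination -(s : ℝ) ^ 2 * Real.sq_sqrt (zero_le_two (α := ℝ))
    _ ≤ _ := by gcongr

/-- A real number with super-exponentially good rational approximations exists. -/
theorem exists_irrational_forall_exists_abs_lt :
    ∃ α : ℝ, Irrational α ∧ ∀ n : ℕ, ∃ q : ℕ, ∃ p : ℤ, 1 ≤ q ∧
      |(q : ℝ) * α - p| < ((n + 1 : ℝ) ^ q)⁻¹ := by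
  let S : ℕ → Set ℝ := fun n => ⋃ (q : ℕ) (p : ℤ) (_ : 1 ≤ q),
    {α : ℝ | |(q : ℝ) * α - p| < ((n + 1 : ℝ) ^ q)⁻¹}
  -- Each S n is open and contains the dense set of rationals, with error 0 at p/q = r; so the
  -- intersection is residual and meets the residual set of irrationals.
  have hres : ∀ᶠ α in residual ℝ, α ∈ ⋂ n, S n := by
    refine residual_of_dense_Gδ (.iInter fun n => IsOpen.isGδ ?_)
      (Rat.isDenseEmbedding_coe_real.dense.mono ?_)
    · refine isOpen_iUnion fun q => isOpen_iUnion fun p => isOpen_iUnion fun _ => ?_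
      exact isOpen_lt (by fun_prop) continuous_const
    · rintro _ ⟨r, rfl⟩
      simp only [S, Set.mem_iInter, Set.mem_iUnion]
      refine fun n => ⟨r.den, r.num, r.pos, ?_⟩
      have : (r.den : ℝ) * r = r.num := by exact_mod_cast Rat.den_mul_eq_num r
      rw [Set.mem_ofPred_eq, this, sub_self, abs_zero]
      positivity
  obtain ⟨α, hα, hS⟩ := (dense_of_mem_residual (eventually_residual_irrational.and hres)).nonempty
  refine ⟨α, hα, fun n => ?_⟩
  have := Set.mem_iInter.1 hS n
  simp only [S, Set.mem_iUnion] at this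
  obtain ⟨q, p, hq, h⟩ := this
  exact ⟨q, p, hq, h⟩

/-! ### Theta and wild leaves -/

namespace Nilmanifold

open H7 LieAlgH7

/-- The polynomial lower bound 1/(4|s|) for the distance of s√2 to ℤ dominates the exponential bound
4^(−|s|) as soon as |s| ≥ 1. -/
theorem thetaCondition_slopeCoordinates_sqrt_two :
    ThetaCondition (slopeCoordinates irrational_sqrt_two).R := by
  refine ⟨4, by norm_num, fun σ hσ => le_ciInf fun τ => ?_⟩
  have h0 : σ 0 ≠ 0 := fun h => hσ (funext fun i => by rw [Subsingleton.elim i 0, h]; rfl)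
  have hs1 : (0 : ℝ) < |(σ 0 : ℝ)| := by positivity
  refine le_trans ?_ (abs_apply_le_euclideanNorm _ 0)
  have hpow : ∀ n : ℕ, 1 ≤ n → 4 * (n : ℝ) ≤ 4 ^ n := by
    intro n hn
    induction n, hn using Nat.le_induction with
    | base => norm_num
    | succ n hn ih =>
      have : (1 : ℝ) ≤ n := by exact_mod_cast hn
      rw [pow_succ]
      push_cast
      linarith
  have hle : 4 * |(σ 0 : ℝ)| ≤ 4 ^ |(σ 0 : ℝ)| := by
    have e : |(σ 0 : ℝ)| = ((σ 0).natAbs : ℝ) := by rw [Nat.cast_natAbs, Int.cast_abs]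
    rw [e, Real.rpow_natCast]
    exact hpow _ (Int.natAbs_pos.2 h0)
  have h := one_le_four_mul_abs_mul_sqrt_two_sub h0 (τ 0)
  rw [euclideanNorm_fin_one, Real.rpow_neg (by norm_num)]
  have hd : ∑ i : Fin 1, (σ i : ℝ) * (slopeCoordinates irrational_sqrt_two).R i 0 - (τ 0 : ℝ) =
      σ 0 * √2 - τ 0 := by
    simp [slopeCoordinates]
  rw [hd, inv_le_iff_one_le_mul₀ (by positivity)]
  calc (1 : ℝ) ≤ 4 * |(σ 0 : ℝ)| * |(σ 0 : ℝ) * √2 - τ 0| := h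
    _ ≤ 4 ^ |(σ 0 : ℝ)| * |(σ 0 : ℝ) * √2 - τ 0| := by gcongr
    _ = _ := mul_comm _ _

/-- Toroidal coordinates of the leaf of `slopeLattice α` have `m = q = 1`. -/
theorem eq_one_of_toroidalCoordinates {α : ℝ} (hα : Irrational α) {m q : ℕ}
    (c : ToroidalCoordinates (fibrePeriods (slopeLattice α)) m q) : m = 1 ∧ q = 1 := by
  have hdim : m + q = 2 := by
    have := c.coord.finrank_eq
    simp at this
    omega
  -- For m = 2 the glueing matrix has no columns, so no entry can witness irrationality; for m = 0
  -- the periods would contain a real basis of 𝔣.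
  have hm2 : m ≠ 2 := by
    rintro rfl
    obtain rfl : q = 0 := by omega
    obtain ⟨j, -⟩ := c.irrational 1 one_ne_zero 0
    exact Fin.elim0 j
  have hm0 : m ≠ 0 := by
    rintro rfl
    refine not_isRational_slopeLattice hα ((isRational_𝔣_iff _).2 (eq_top_iff.2 ?_))
    rintro w -
    let ψ : (Fin q → ℂ) →ₗ[ℝ] (Fin 2 → ℂ) :=
      (c.coord.symm.toLinearMap.restrictScalars ℝ) ∘ₗ LinearMap.inr ℝ (Fin 0 → ℂ) (Fin q → ℂ)
    have hw : w = ψ (c.coord w).2 := by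
      change w = c.coord.symm (0, (c.coord w).2)
      rw [LinearEquiv.eq_symm_apply]
      exact Prod.ext (Subsingleton.elim _ _) rfl
    have hP : (c.coord w).2 ∈ Submodule.span ℝ (Set.range c.P) := by
      rw [c.P.span_eq]
      trivial
    rw [hw]
    have := Submodule.mem_map_of_mem (f := ψ) hP
    rw [Submodule.map_span] at this
    refine Submodule.span_mono ?_ this
    rintro _ ⟨_, ⟨j, rfl⟩, rfl⟩
    refine (c.mem_iff _).2 ⟨0, Pi.single j 1, ?_⟩
    change c.coord (c.coord.symm (0, c.P j)) = _
    rw [LinearEquiv.apply_symm_apply]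
    refine Prod.ext (Subsingleton.elim _ _) ?_
    change c.P j = ∑ i, ((Pi.single j 1 : Fin (2 * q) → ℤ) i : ℝ) • c.P i
    rw [Finset.sum_eq_single j] <;> simp +contextual
  omega

/-- The first toroidal coordinate of a period of the leaf of `slopeLattice α` is proportional to
its fourth coordinate. -/
theorem exists_integers_of_toroidalCoordinates {α : ℝ} (hα : Irrational α)
    (c : ToroidalCoordinates (fibrePeriods (slopeLattice α)) 1 1) :
    ∃ t : ℝ, ∃ k l : ℤ, t * (k + α * l) = 1 ∧ ∀ j, ∃ k l : ℤ, t * (k + α * l) = c.R 0 j := by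
  let φ : (Fin 2 → ℂ) →ₗ[ℂ] ℂ := LinearMap.proj 0 ∘ₗ LinearMap.fst ℂ _ _ ∘ₗ c.coord.toLinearMap
  -- The first toroidal coordinate φ is real on periods because R is real. Testing on p, k and l in
  -- turn gives Re B = 0, Re A = 0 and Im B = 0, so φ depends on z₁ only.
  have hreal : ∀ k l p : ℤ, (φ ![⟨0, (k + α * l) / 2⟩, ⟨l / 2, p / 2⟩]).im = 0 := by
    intro k l p
    obtain ⟨a, b, h⟩ := (c.mem_iff _).1 ((mem_fibrePeriods_slopeLattice_iff hα).2 ⟨k, l, p, rfl⟩)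
    have : φ ![⟨0, (k + α * l) / 2⟩, ⟨l / 2, p / 2⟩] = _ := congrFun (congrArg Prod.fst h) 0
    rw [this]
    simp
  set A := φ ![1, 0]
  set B := φ ![0, 1]
  have hφ : ∀ w, φ w = w 0 * A + w 1 * B := by
    intro w
    have : w = w 0 • ![1, 0] + w 1 • ![0, 1] := by
      funext i
      fin_cases i <;> simp
    conv_lhs => rw [this]
    rw [map_add, map_smul, map_smul, smul_eq_mul, smul_eq_mul]
  have hB1 : B.re = 0 := by
    have := hreal 0 0 1
    rw [hφ] at this
    simpa using this
  have hA : A.re = 0 := by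
    have := hreal 1 0 0
    rw [hφ] at this
    simpa using this
  have hB2 : B.im = 0 := by
    have := hreal 0 1 0
    rw [hφ] at this
    simpa [hA, hB1] using this
  have hval : ∀ w ∈ fibrePeriods (slopeLattice α), ∃ k l : ℤ,
      φ w = ((-A.im / 2 * (k + α * l) : ℝ) : ℂ) := by
    intro w hw
    obtain ⟨k, l, p, rfl⟩ := (mem_fibrePeriods_slopeLattice_iff hα).1 hw
    refine ⟨k, l, ?_⟩
    rw [hφ]
    apply Complex.ext <;> simp [hA, hB1, hB2]
    ring
  have hmem : ∀ (a : Fin 1 → ℤ) (b : Fin (2 * 1) → ℤ), ∃ k l : ℤ,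
      -A.im / 2 * (k + α * l) = a 0 + ∑ j, c.R 0 j * b j := by
    intro a b
    set w := c.coord.symm (fun i => (a i : ℂ) + ∑ j, (c.R i j : ℂ) * (b j : ℂ),
      ∑ j, (b j : ℝ) • c.P j)
    obtain ⟨k, l, h⟩ := hval w ((c.mem_iff w).2 ⟨a, b, LinearEquiv.apply_symm_apply _ _⟩)
    refine ⟨k, l, ?_⟩
    have hw : φ w = (a 0 : ℂ) + ∑ j, (c.R 0 j : ℂ) * (b j : ℂ) := by
      change (c.coord w).1 0 = _
      rw [LinearEquiv.apply_symm_apply]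
    rw [hw] at h
    apply Complex.ofReal_injective
    rw [← h]
    push_cast
    rfl
  -- The period given by the identity column yields the value 1, and the j-th remaining column
  -- yields the entry R 0 j.
  obtain ⟨k, l, h⟩ := hmem 1 0
  refine ⟨-A.im / 2, k, l, by simpa using h, fun j => ?_⟩
  obtain ⟨k, l, h⟩ := hmem 0 (Pi.single j 1)
  refine ⟨k, l, h.trans ?_⟩
  rw [Finset.sum_eq_single j] <;> simp +contextual

/-- The entries of R are fractional linear in α: R 0 j = (κ + αμ)/(k + αl). If qα ≈ p, then σ = qk +
pl and τ = qκ + pμ are integers with σ R 0 j − τ = (qα − p)(μ − R 0 j · l) and |σ| = O(q), so the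
approximation quality survives up to constants. -/
theorem not_thetaCondition_of_approximations {α t : ℝ} {k l : ℤ} (h1 : t * (k + α * l) = 1)
    {R : Matrix (Fin 1) (Fin (2 * 1)) ℝ} (hR : ∀ j, ∃ k l : ℤ, t * (k + α * l) = R 0 j)
    (hα : ∀ n : ℕ, ∃ q : ℕ, ∃ p : ℤ, 1 ≤ q ∧ |(q : ℝ) * α - p| < ((n + 1 : ℝ) ^ q)⁻¹) :
    ¬ ThetaCondition R := by
  rintro ⟨r, hr, hle⟩
  choose κ μ hκ using hR
  have ht : t ≠ 0 := by
    rintro rfl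
    simp at h1
  set D := |t|⁻¹ + |(l : ℝ)|
  set C := ∑ j, |(μ j : ℝ) - R 0 j * l|
  have hD : 0 < D := by positivity
  have hC : 0 ≤ C := Finset.sum_nonneg fun _ _ => abs_nonneg _
  set ρ := max r 1
  have hρ : 1 ≤ ρ := le_max_right _ _
  -- The first summand makes (n + 1)^q beat the theta bound ρ^(Dq) and the constant C; the second is
  -- used to show σ ≠ 0.
  obtain ⟨n, hn⟩ := exists_nat_ge ((C + 1) * ρ ^ D + |(l : ℝ)| * |t|)
  have hρD : 1 ≤ ρ ^ D := Real.one_le_rpow hρ hD.le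
  obtain ⟨q, p, hq, hqp⟩ := hα n
  set ε := |(q : ℝ) * α - p|
  have hq1 : (1 : ℝ) ≤ q := by exact_mod_cast hq
  have hbase : (1 : ℝ) ≤ n + 1 := by
    have : (0 : ℝ) ≤ n := Nat.cast_nonneg n
    linarith
  have hY : 0 < (n + 1 : ℝ) ^ q := by positivity
  have h7 : ε * (n + 1 : ℝ) ^ q < 1 := by
    rwa [← one_div, lt_div_iff₀ hY] at hqp
  have hεle : ε * (n + 1) < 1 :=
    (mul_le_mul_of_nonneg_left (le_self_pow₀ hbase (by omega)) (abs_nonneg _)).trans_lt h7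
  have hε0 : 0 ≤ ε := abs_nonneg _
  have hε1 : ε < 1 := by nlinarith
  set σ : Fin 1 → ℤ := fun _ => q * k + p * l
  have hσ : (σ 0 : ℝ) - q / t = (p - q * α) * l := by
    have : (q : ℝ) / t = q * (k + α * l) := by
      rw [div_eq_iff ht]
      linear_combination -(q : ℝ) * h1
    rw [this]
    simp only [σ]
    push_cast
    ring
  have hσabs : |(σ 0 : ℝ) - q / t| = ε * |(l : ℝ)| := by
    rw [hσ, abs_mul, abs_sub_comm]
  have hqt : |(q : ℝ) / t| = q * |t|⁻¹ := by
    rw [abs_div, abs_of_nonneg (zero_le_one.trans hq1), div_eq_mul_inv]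
  -- σ lies within ε|l| of q/t. If it vanished, q would equal ε|l||t| < 1.
  have hσ0 : σ ≠ 0 := by
    intro h0
    have h2 : (σ 0 : ℝ) = 0 := by rw [h0]; simp
    rw [h2, zero_sub, abs_neg, hqt] at hσabs
    have htpos : 0 < |t| := abs_pos.2 ht
    have h3 : (q : ℝ) = ε * |(l : ℝ)| * |t| := by
      rw [← hσabs, mul_assoc, inv_mul_cancel₀ htpos.ne', mul_one]
    have h4 : |(l : ℝ)| * |t| ≤ n := by
      have : 0 ≤ (C + 1) * ρ ^ D := by positivity
      linarith
    have h5 : ε * (|(l : ℝ)| * |t|) ≤ ε * (n + 1) := by gcongr; linarith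
    linarith
  have hσle : |(σ 0 : ℝ)| ≤ D * q := by
    have h2 : |(σ 0 : ℝ)| ≤ |(σ 0 : ℝ) - q / t| + |(q : ℝ) / t| := by
      simpa using abs_add_le ((σ 0 : ℝ) - q / t) (q / t)
    rw [hσabs, hqt] at h2
    have h3 : ε * |(l : ℝ)| ≤ q * |(l : ℝ)| := by gcongr; linarith
    simp only [D]
    linarith
  set τ : Fin (2 * 1) → ℤ := fun j => q * κ j + p * μ j
  have hdiff : ∀ j, ∑ i, (σ i : ℝ) * R i j - τ j = (q * α - p) * (μ j - R 0 j * l) := by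
    intro j
    rw [Fin.sum_univ_one]
    simp only [σ, τ]
    push_cast
    linear_combination (q : ℝ) * (κ j + α * μ j) * h1 - (q : ℝ) * (k + α * l) * hκ j
  have hupper : (⨅ τ : Fin (2 * 1) → ℤ, euclideanNorm fun j =>
      ∑ i, (σ i : ℝ) * R i j - (τ j : ℝ)) ≤ ε * C := by
    refine (ciInf_le ⟨0, ?_⟩ τ).trans (euclideanNorm_le ?_)
    · rintro _ ⟨_, rfl⟩
      exact Real.sqrt_nonneg _
    · simp only [hdiff, abs_mul, ← Finset.mul_sum]
      exact le_rfl
  have hlower : (ρ ^ (D * q))⁻¹ ≤ r ^ (-euclideanNorm fun i => (σ i : ℝ)) := by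
    rw [euclideanNorm_fin_one, Real.rpow_neg hr.le]
    refine inv_anti₀ (Real.rpow_pos_of_pos hr _) ?_
    calc r ^ |(σ 0 : ℝ)| ≤ ρ ^ |(σ 0 : ℝ)| :=
          Real.rpow_le_rpow hr.le (le_max_left _ _) (abs_nonneg _)
      _ ≤ ρ ^ (D * q) := Real.rpow_le_rpow_of_exponent_le hρ hσle
  have hfinal := (hlower.trans (hle σ hσ0)).trans hupper
  rw [Real.rpow_mul (by linarith), Real.rpow_natCast] at hfinal
  -- C + 1 ≥ 1 and q ≥ 1 allow the constant to be absorbed into the q-th power.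
  have hpow : (C + 1) * (ρ ^ D) ^ q ≤ (n + 1 : ℝ) ^ q := by
    calc (C + 1) * (ρ ^ D) ^ q ≤ (C + 1) ^ q * (ρ ^ D) ^ q := by
          gcongr
          exact le_self_pow₀ (by linarith) (by omega)
      _ = ((C + 1) * ρ ^ D) ^ q := (mul_pow _ _ _).symm
      _ ≤ (n + 1 : ℝ) ^ q := by
          gcongr
          have : 0 ≤ |(l : ℝ)| * |t| := by positivity
          linarith
  have hX : 0 < (ρ ^ D) ^ q := by positivity
  have h6 : 1 ≤ ε * C * (ρ ^ D) ^ q := by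
    rwa [inv_le_iff_one_le_mul₀ hX] at hfinal
  have h8 : ε * C * (ρ ^ D) ^ q ≤ ε * (n + 1 : ℝ) ^ q := by
    rw [mul_assoc]
    gcongr
    nlinarith
  linarith

end Nilmanifold

/-! ### The proposition -/

theorem mainTheorem4 :
    (∀ (Γ : Subgroup H7) [DiscreteTopology Γ] [CompactSpace (Nilmanifold Γ)],
      ((∃ 𝔟 : LieIdeal ℝ LieAlgH7, 𝔟 ≠ ⊥ ∧ 𝔟 ≠ ⊤ ∧ LieAlgH7.IsJ₀Invariant 𝔟 ∧
          Nilmanifold.IsRational Γ 𝔟) →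
        LieAlgH7.IsJ₀Invariant LieAlgH7.𝔣 ∧ Nilmanifold.IsRational Γ LieAlgH7.𝔣 ∧
        ∃ _ : DiscreteTopology (Nilmanifold.basePeriods Γ),
          IsFullLattice (Nilmanifold.basePeriods Γ) ∧
          IsComplexTorusBundle 2 (Fin 3 → ℂ) ℂ (Nilmanifold.fibration Γ) ∧
          ¬ AdmitsPrincipalBundleStructure (Nilmanifold.fibration Γ)) ∧
      (¬ Nilmanifold.IsRational Γ LieAlgH7.𝔣 →
        IsToroidalGroup (Fin 2 → ℂ) ((Fin 2 → ℂ) ⧸ Nilmanifold.fibrePeriods Γ) ∧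
        ¬ CompactSpace ((Fin 2 → ℂ) ⧸ Nilmanifold.fibrePeriods Γ))) ∧
    (∃ (Γ : Subgroup H7) (_ : DiscreteTopology Γ) (_ : CompactSpace (Nilmanifold Γ)),
      ¬ Nilmanifold.IsRational Γ LieAlgH7.𝔣 ∧
      IsToroidalThetaGroup (Nilmanifold.fibrePeriods Γ)) ∧
    (∃ (Γ : Subgroup H7) (_ : DiscreteTopology Γ) (_ : CompactSpace (Nilmanifold Γ)),
      ¬ Nilmanifold.IsRational Γ LieAlgH7.𝔣 ∧
      IsToroidalWildGroup (Nilmanifold.fibrePeriods Γ)) := by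
  refine ⟨fun Γ _ _ => ⟨?_, fun h =>
    ⟨Nilmanifold.isToroidalGroup_leaf Γ h, Nilmanifold.not_compactSpace_leaf Γ h⟩⟩, ?_, ?_⟩
  · rintro ⟨𝔟, hbot, htop, hJ, hrat⟩
    have h𝔣 := Nilmanifold.isRational_𝔣_of_exists Γ hbot htop hJ hrat
    have hspan := (Nilmanifold.isRational_𝔣_iff Γ).1 h𝔣
    have hd := Nilmanifold.discreteTopology_basePeriods Γ h𝔣
    exact ⟨LieAlgH7.isJ₀Invariant_𝔣, h𝔣, hd, ⟨hd, Nilmanifold.span_basePeriods Γ⟩,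
      Nilmanifold.isComplexTorusBundle_fibration hspan, Nilmanifold.not_admitsPrincipalBundleStructure hspan⟩
  · have h := Nilmanifold.not_isRational_slopeLattice irrational_sqrt_two
    exact ⟨Nilmanifold.slopeLattice √2, inferInstance, inferInstance, h, Nilmanifold.isToroidalGroup_leaf _ h,
      1, 1, Nilmanifold.slopeCoordinates irrational_sqrt_two, Nilmanifold.thetaCondition_slopeCoordinates_sqrt_two⟩
  · obtain ⟨α, hα, happrox⟩ := exists_irrational_forall_exists_abs_lt
    have h := Nilmanifold.not_isRational_slopeLattice hα
    refine ⟨Nilmanifold.slopeLattice α, inferInstance, inferInstance, h, Nilmanifold.isToroidalGroup_leaf _ h, ?_⟩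
    -- Wildness denies the theta condition for every choice of toroidal coordinates, so c is
    -- arbitrary here.
    rintro ⟨-, m, q, c, hc⟩
    obtain ⟨rfl, rfl⟩ := Nilmanifold.eq_one_of_toroidalCoordinates hα c
    obtain ⟨t, k, l, h1, hR⟩ := Nilmanifold.exists_integers_of_toroidalCoordinates hα c
    exact Nilmanifold.not_thetaCondition_of_approximations h1 hR happrox hc
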